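/- A matching market consists of a finite set $F$ of firms, a finite set $W$ of workers, and match utilities such that all preferences are strict, being unmatched has utility $0$, and every agent gets positive utility from every partner on the other side. It is balanced if $|F|=|W|$. It satisfies the Sequential Preference Condition (SPC) if the firms and the workers can be ordered as $f_1,\dots,f_m$ and $w_1,\dots,w_n$ so that, for every $i\le\min(m,n)$, $f_i$ and $w_i$ are each other's favorites in the sub-market formed by $\{f_j,w_j\}_{j\ge i}$. An economy assigns to each state in a finite set $\Theta$ a matching market with the same firms and workers, every worker's utilities being the same in all states, together with a full-support prior on $\Theta$. In the associated game the state is drawn from the prior and observed by firms but not by workers; all agents simultaneously submit rank-ordered lists of acceptable partners, and the firm-proposing deferred acceptance algorithm produces a matching. "BNE" means a pure-strategy Bayesian Nash equilibrium in which all firms report truthfully in every state. Its outcome is the matching generated in each state; an outcome is unstable in a state if it is not stable for the true preferences of that state. An augmented economy of a market $\mathcal M=(F,W,U)$ with one additional firm and one additional worker is an economy with two states, each of positive probability, whose sets of agents are $F$ plus one firm and $W$ plus one worker, such that in both states the utilities of agents of $F$ and $W$ for one another are those of $\mathcal M$, and the market in each state has a unique stable matching. Proposition. Let $\mathcal M$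 be a balanced market with at least two agents on each side satisfying the SPC. Then there is an augmented economy $\mathcal E$ of $\mathcal M$ with one additional firm and one additional worker such that: 1. there is a BNE whose outcome is unstable in both states; 2. for every BNE there is a BNE with the same outcome in which every agent's strategy is weakly undominated and whose reports admit, in each state, a unique matching that is stable for the reported preferences; 3. there are two BNE for which the sets of matched workers differ in some state, and such that some worker has strictly higher expected utility in the first and some worker has strictly higher expected utility in the second. -/

import Mathlib

/-! Two-sided matching markets, firm-proposing deferred acceptance, and the induced Bayesian game.
Matchings between firms `F` and workers `W` are partial bijections `μ : F ≃. W`: `μ f : Option W` is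
the partner of `f`, `μ.symm w : Option F` the partner of `w`, and `none` means unmatched. -/

namespace Matching

/-- A matching market: match utilities (utility from being unmatched is `0`), with strict
preferences and all pairs mutually acceptable. -/
structure Market (F W : Type*) where
  /-- `firmUtil f w` is the utility of firm `f` from matching with worker `w`. -/
  firmUtil : F → W → ℝ
  /-- `workerUtil w f` is the utility of worker `w` from matching with firm `f`. -/
  workerUtil : W → F → ℝ
  firm_strict : ∀ f, Function.Injective (firmUtil f)
  worker_strict : ∀ w, Function.Injective (workerUtil w)
  firm_acceptable : ∀ f w, 0 < firmUtil f w
  worker_acceptable : ∀ w f, 0 < workerUtil w f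

/-- Utility from an assignment; being unmatched is worth `0`. -/
def value {β : Type*} (u : β → ℝ) : Option β → ℝ
  | none => 0
  | some b => u b

/-- Stability with respect to strict preference relations over partners and being unmatched
(`PF f a b`: firm `f` strictly prefers `a` to `b`): individual rationality on both sides and no
blocking pair. -/
def StableWrt {F W : Type*} (PF : F → Option W → Option W → Prop)
    (PW : W → Option F → Option F → Prop) (μ : F ≃. W) : Prop :=
  (∀ f, ¬ PF f none (μ f)) ∧ (∀ w, ¬ PW w none (μ.symm w)) ∧
    ∀ f w, ¬ (PF f (some w) (μ f) ∧ PW w (some f) (μ.symm w))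

/-- Stability for the true preferences of a market. -/
def Market.IsStable {F W : Type*} (M : Market F W) (μ : F ≃. W) : Prop :=
  StableWrt (fun f a b => value (M.firmUtil f) b < value (M.firmUtil f) a)
    (fun w a b => value (M.workerUtil w) b < value (M.workerUtil w) a) μ

/-- `(f, w)` is a top-top match of the sub-market with firms `F'` and workers `W'`: each is the
other's favorite in the sub-market. -/
def Market.IsTopTop {F W : Type*} (M : Market F W) (F' : Set F) (W' : Set W) (f : F) (w : W) :
    Prop :=
  f ∈ F' ∧ w ∈ W' ∧ (∀ w' ∈ W', M.firmUtil f w' ≤ M.firmUtil f w) ∧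
    (∀ f' ∈ F', M.workerUtil w f' ≤ M.workerUtil w f)

/-- Sequential Preference Condition: firms and workers can be ordered so that, for each
`i ≤ min(m, n)`, the `i`-th firm and `i`-th worker are a top-top match of the sub-market of all
agents of order at least `i`. -/
def Market.SPC {F W : Type*} [Fintype F] [Fintype W] (M : Market F W) : Prop :=
  ∃ (ef : Fin (Fintype.card F) ≃ F) (ew : Fin (Fintype.card W) ≃ W),
    ∀ (i : Fin (Fintype.card F)) (j : Fin (Fintype.card W)), (i : ℕ) = (j : ℕ) →
      M.IsTopTop {f | i ≤ ef.symm f} {w | j ≤ ew.symm w} (ef i) (ew j)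

/-! ### Reports and deferred acceptance -/

/-- A report: a rank-ordered list (best first) of the partners declared acceptable. -/
abbrev Report (β : Type*) := {l : List β // l.Nodup}

/-- Position of an assignment in a report: listed partners come in list order, then being
unmatched, then the unlisted (unacceptable) partners. -/
def Report.rank {β : Type*} [DecidableEq β] (r : Report β) : Option β → ℕ
  | none => r.1.length
  | some b => if b ∈ r.1 then r.1.idxOf b else r.1.length + 1

/-- Strict preference over assignments according to a report. -/
def Report.Prefers {β : Type*} [DecidableEq β] (r : Report β) (a b : Option β) : Prop :=
  r.rank a < r.rank b

/-- A report is truthful for utility `u` if it lists exactly the partners that are better than being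
unmatched, in decreasing order of utility. -/
def Report.IsTruthful {β : Type*} (u : β → ℝ) (r : Report β) : Prop :=
  (∀ b, b ∈ r.1 ↔ 0 < u b) ∧ r.1.Pairwise (fun b c => u c < u b)

section DeferredAcceptance

variable {F W : Type*} [DecidableEq F] [DecidableEq W]

/-- Given the set `R` of rejections so far (`(f, w) ∈ R`: `w` has rejected `f`), firm `f` proposes to
the best listed worker who has not rejected it, if there is one. -/
def proposal (P : F → Report W) (R : Finset (F × W)) (f : F) : Option W :=
  (P f).1.find? (fun w => decide ((f, w) ∉ R))

/-- Worker `w` holds the best listed firm among those currently proposing to him. -/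
def held (P : F → Report W) (Q : W → Report F) (R : Finset (F × W)) (w : W) : Option F :=
  (Q w).1.find? (fun f => decide (proposal P R f = some w))

/-- One round of firm-proposing deferred acceptance: every proposal that is not held is rejected. -/
def daStep [Fintype F] [Fintype W] (P : F → Report W) (Q : W → Report F) (R : Finset (F × W)) :
    Finset (F × W) :=
  R ∪ Finset.univ.filter (fun p : F × W =>
    proposal P R p.1 = some p.2 ∧ held P Q R p.2 ≠ some p.1)

/-- All rejections of the algorithm. A round that changes anything adds a rejection, so the
procedure has stopped after `|F| * |W|` rounds. -/
def daRejections [Fintype F] [Fintype W] (P : F → Report W) (Q : W → Report F) :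
    Finset (F × W) :=
  (daStep P Q)^[Fintype.card F * Fintype.card W] ∅

/-- The matching produced by firm-proposing deferred acceptance: a firm and a worker are matched if
at the end the firm proposes to the worker and the worker holds that proposal. -/
def deferredAcceptance [Fintype F] [Fintype W] (P : F → Report W) (Q : W → Report F) :
    F ≃. W where
  toFun f := (proposal P (daRejections P Q) f).filter
    (fun w => decide (held P Q (daRejections P Q) w = some f))
  invFun w := held P Q (daRejections P Q) w
  inv f w := by
    rw [Option.filter_eq_some_iff, decide_eq_true_iff]
    refine ⟨fun h => ⟨?_, h⟩, fun h => h.2⟩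
    simpa using List.find?_some h

end DeferredAcceptance

/-! ### Economies and the game -/

/-- An economy with finitely many states: one market per state on the same agents, workers'
utilities being the same in all states, and a full-support prior. -/
structure Economy (Θ F W : Type*) [Fintype Θ] where
  market : Θ → Market F W
  workerUtil_eq : ∀ θ θ', (market θ).workerUtil = (market θ').workerUtil
  prior : Θ → ℝ
  prior_pos : ∀ θ, 0 < prior θ
  prior_sum : ∑ θ, prior θ = 1

/-- Pure strategy profiles. Firms observe the state; a worker's type is the same in all states, so
his strategy is a single report. -/
structure Profile (Θ F W : Type*) where
  firm : F → Θ → Report W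
  worker : W → Report F

/-- Firm `f` switches to the strategy `s`. -/
def Profile.setFirm {Θ F W : Type*} [DecidableEq F] (σ : Profile Θ F W) (f : F)
    (s : Θ → Report W) : Profile Θ F W :=
  { σ with firm := Function.update σ.firm f s }

/-- Worker `w` switches to the report `r`. -/
def Profile.setWorker {Θ F W : Type*} [DecidableEq W] (σ : Profile Θ F W) (w : W)
    (r : Report F) : Profile Θ F W :=
  { σ with worker := Function.update σ.worker w r }

/-- The outcome of a profile: the matching generated in each state. -/
def Profile.outcome {Θ F W : Type*} [Fintype F] [DecidableEq F] [Fintype W] [DecidableEq W]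
    (σ : Profile Θ F W) (θ : Θ) : F ≃. W :=
  deferredAcceptance (fun f => σ.firm f θ) σ.worker

/-- The set of workers matched in state `θ`. -/
def Profile.matchedWorkers {Θ F W : Type*} [Fintype F] [DecidableEq F] [Fintype W]
    [DecidableEq W] (σ : Profile Θ F W) (θ : Θ) : Set W :=
  {w | (σ.outcome θ).symm w ≠ none}

/-- In state `θ` there is a unique matching that is stable for the reported preferences. -/
def Profile.UniqueReportedStable {Θ F W : Type*} [DecidableEq F] [DecidableEq W]
    (σ : Profile Θ F W) (θ : Θ) : Prop :=
  ∃! μ : F ≃. W, StableWrt (fun f => (σ.firm f θ).Prefers) (fun w => (σ.worker w).Prefers) μ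

namespace Economy

variable {Θ F W : Type*} [Fintype Θ] [Fintype F] [DecidableEq F] [Fintype W] [DecidableEq W]

/-- Expected utility of firm `f`. -/
noncomputable def firmPayoff (E : Economy Θ F W) (σ : Profile Θ F W) (f : F) : ℝ :=
  ∑ θ, E.prior θ * value ((E.market θ).firmUtil f) (σ.outcome θ f)

/-- Expected utility of worker `w`. -/
noncomputable def workerPayoff (E : Economy Θ F W) (σ : Profile Θ F W) (w : W) : ℝ :=
  ∑ θ, E.prior θ * value ((E.market θ).workerUtil w) ((σ.outcome θ).symm w)

/-- Bayesian Nash equilibrium: no firm and no worker has a profitable deviation. -/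
def IsBNE (E : Economy Θ F W) (σ : Profile Θ F W) : Prop :=
  (∀ f s, E.firmPayoff (σ.setFirm f s) f ≤ E.firmPayoff σ f) ∧
    (∀ w r, E.workerPayoff (σ.setWorker w r) w ≤ E.workerPayoff σ w)

/-- All firms report their true preferences in every state. -/
def FirmsTruthful (E : Economy Θ F W) (σ : Profile Θ F W) : Prop :=
  ∀ f θ, (σ.firm f θ).IsTruthful ((E.market θ).firmUtil f)

/-- Bayesian Nash equilibrium with truthful firms. -/
def IsTruthfulBNE (E : Economy Θ F W) (σ : Profile Θ F W) : Prop :=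
  E.IsBNE σ ∧ E.FirmsTruthful σ

/-- For firm `f`, the strategy `s'` weakly dominates `s`: it is never worse, whatever the others
play, and sometimes better. -/
def FirmDominates (E : Economy Θ F W) (f : F) (s' s : Θ → Report W) : Prop :=
  (∀ τ : Profile Θ F W, E.firmPayoff (τ.setFirm f s) f ≤ E.firmPayoff (τ.setFirm f s') f) ∧
    ∃ τ : Profile Θ F W, E.firmPayoff (τ.setFirm f s) f < E.firmPayoff (τ.setFirm f s') f

/-- For worker `w`, the report `r'` weakly dominates `r`. -/
def WorkerDominates (E : Economy Θ F W) (w : W) (r' r : Report F) : Prop :=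
  (∀ τ : Profile Θ F W,
      E.workerPayoff (τ.setWorker w r) w ≤ E.workerPayoff (τ.setWorker w r') w) ∧
    ∃ τ : Profile Θ F W,
      E.workerPayoff (τ.setWorker w r) w < E.workerPayoff (τ.setWorker w r') w

/-- No player's strategy is weakly dominated. -/
def WeaklyUndominated (E : Economy Θ F W) (σ : Profile Θ F W) : Prop :=
  (∀ f, ¬ ∃ s', E.FirmDominates f s' (σ.firm f)) ∧
    (∀ w, ¬ ∃ r', E.WorkerDominates w r' (σ.worker w))

end Economy

/-- `E` is an augmented economy of `M` with additional firms `F'` and workers `W'`: in every state,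
utilities among original agents are those of `M`, and there is a unique stable matching. (That
workers' utilities do not depend on the state and that the prior is non-degenerate is part of
`Economy`.) -/
def Economy.IsAugmentationOf {Θ F W F' W' : Type*} [Fintype Θ]
    (E : Economy Θ (F ⊕ F') (W ⊕ W')) (M : Market F W) : Prop :=
  ∀ θ, (∀ f w, (E.market θ).firmUtil (Sum.inl f) (Sum.inl w) = M.firmUtil f w) ∧
    (∀ w f, (E.market θ).workerUtil (Sum.inl w) (Sum.inl f) = M.workerUtil w f) ∧
    ∃! μ : F ⊕ F' ≃. W ⊕ W', (E.market θ).IsStable μ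

end Matching

set_option linter.unusedSectionVars false

namespace Matching

/-! ### Reports -/

section Reports

variable {β : Type*} [DecidableEq β]

/-! By the SPC all but the last two firms and workers split into top pairs `(a i, b i)`. The added
agents turn the rest into a core of three firms and three workers: `f3` is the new firm, `y` the
last worker, and `x`, `z` are the new worker and the remaining old one, the roles depending on the
taste of the last old firm `f2`. In the core, `f1` ranks z, x, y; `f2` ranks x, y, z; `f3` ranks x,
y, z in state 0 and x, z, y in state 1; `x` ranks f1, f2, f3. Workers `y` and `z` like `f3` best,
and it is worth to them more than twice either other core firm; `z` prefers `f1` to `f2`.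

The stable core matchings are f1-z, f2-x, f3-y in state 0 and f1-x, f2-y, f3-z in state 1. Worker
`x` would like `f1` in both states. Let `x` rank `f3` above `f2`. In state 0 this dislodges `f2`,
and if `z` also turns `f1` away, then `f1` goes to `x`, `f3` is released to `y`, and `f2` ends at
`z`. This happens if `z` does not list `f1` while `y` lists `f2`, or if `y` does not list `f2` and
`z` ranks `f2` above `f1`. In the second case `y` is unmatched in state 1, so the outcome is
unstable in both states. Compared with the stable outcome, `x` gains and `y` loses; this is the
disagreement among workers.

These profiles are equilibria because of firm-optimality (`swap_optimal`): if `y` starts to list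
`f2`, or `z` admits `f1`, then deferred acceptance pairs `f3` with `x` in some state, and the
deviator loses its favourite there. Since `f3` is worth more than twice any alternative, this
outweighs the gain in the other state.

Conversely, let an equilibrium with truthful firms be given. Induction along the top pairs (`tops`)
shows that they are matched: `b i` can secure `a i` by listing nobody else. In the core, stability
for the reports, the deviations of `x` to [f1, f2] and of `y` and `z` to [f3, f2], and the swap
argument leave only three outcomes (`core_characterization`). Reports of the other workers are
arbitrary, so a deviation may send a core firm to some `b j`; `no_gain` shows that this firm is then
worse off than in equilibrium, which limits the lost information.

Each of the three outcomes is generated by a candidate profile, a slight change of truthful reports.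
Its reports determine the stable matching. Its firms are undominated by strategy-proofness
(`firm_strategyproof`), and its workers because every report that puts the true favourite first is
undominated (`not_workerDominates_of_head`). The fully truthful candidate also gives uniqueness of
the true stable matchings. -/

theorem Report.rank_none (r : Report β) : r.rank none = r.1.length := rfl

theorem Report.rank_of_mem {r : Report β} {b : β} (h : b ∈ r.1) :
    r.rank (some b) = r.1.idxOf b := by
  simp [Report.rank, h]

theorem Report.rank_of_notMem {r : Report β} {b : β} (h : b ∉ r.1) :
    r.rank (some b) = r.1.length + 1 := by
  simp [Report.rank, h]

theorem Report.mem_iff_rank_lt {r : Report β} {b : β} :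
    b ∈ r.1 ↔ r.rank (some b) < r.rank none := by
  by_cases h : b ∈ r.1
  · simp [Report.rank_of_mem h, Report.rank_none, h, List.idxOf_lt_length_of_mem h]
  · simp [Report.rank_of_notMem h, Report.rank_none, h]

theorem Report.rank_ne_none (r : Report β) (b : β) : r.rank (some b) ≠ r.rank none := by
  by_cases h : b ∈ r.1
  · exact (Report.mem_iff_rank_lt.1 h).ne
  · simp [Report.rank_of_notMem h, Report.rank_none]

theorem Report.rank_inj {r : Report β} {a b : β} (ha : a ∈ r.1)
    (h : r.rank (some a) = r.rank (some b)) : a = b := by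
  have hb : b ∈ r.1 := by
    rw [Report.mem_iff_rank_lt] at ha ⊢
    omega
  rw [Report.rank_of_mem ha, Report.rank_of_mem hb] at h
  exact (List.idxOf_inj ha).1 h

theorem Report.IsTruthful.mem {u : β → ℝ} {r : Report β} (h : r.IsTruthful u) {b : β} :
    b ∈ r.1 ↔ 0 < u b := h.1 b

theorem Report.IsTruthful.idxOf_lt {u : β → ℝ} {r : Report β} (h : r.IsTruthful u) {a b : β}
    (ha : a ∈ r.1) (hb : b ∈ r.1) (hab : u b < u a) : r.1.idxOf a < r.1.idxOf b := by
  by_contra hlt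
  have hne : r.1.idxOf b ≠ r.1.idxOf a := fun he => by
    have := (List.idxOf_inj hb).1 he
    subst this
    exact lt_irrefl _ hab
  have hl : r.1.idxOf b < r.1.idxOf a := by omega
  have := List.pairwise_iff_getElem.1 h.2 _ _ (List.idxOf_lt_length_of_mem hb)
    (List.idxOf_lt_length_of_mem ha) hl
  simp only [List.getElem_idxOf] at this
  exact absurd this (not_lt.2 hab.le)

theorem Report.IsTruthful.prefers_some_iff {u : β → ℝ} {r : Report β} (h : r.IsTruthful u)
    (hu : Function.Injective u) {a : β} (ha : 0 < u a) {o : Option β} :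
    r.Prefers (some a) o ↔ value u o < u a := by
  have ham := h.mem.2 ha
  cases o with
  | none => simpa [Report.Prefers, value, ha] using Report.mem_iff_rank_lt.1 ham
  | some b =>
    by_cases hb : b ∈ r.1
    · simp only [Report.Prefers, Report.rank_of_mem ham, Report.rank_of_mem hb, value]
      constructor
      · intro hlt
        by_contra hle
        rcases (not_lt.1 hle).lt_or_eq with hl | he
        · have := h.idxOf_lt hb ham hl
          omega
        · rw [hu he] at hlt
          exact lt_irrefl _ hlt
      · exact h.idxOf_lt ham hb
    · have hb0 : ¬ 0 < u b := fun hc => hb (h.mem.2 hc)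
      have h1 := Report.mem_iff_rank_lt.1 ham
      have h2 := Report.rank_of_notMem hb
      have h3 := Report.rank_none r
      simp only [Report.Prefers, value]
      constructor
      · intro _
        linarith
      · intro _
        omega

theorem Report.IsTruthful.prefers_iff {u : β → ℝ} {r : Report β} (h : r.IsTruthful u)
    (hu : Function.Injective u) (hpos : ∀ b, 0 < u b) {a o : Option β} :
    r.Prefers a o ↔ value u o < value u a := by
  cases a with
  | some a => exact h.prefers_some_iff hu (hpos a)
  | none =>
    cases o with
    | none => simp [Report.Prefers]
    | some b =>
      have := Report.mem_iff_rank_lt.1 (h.mem.2 (hpos b))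
      simp only [Report.Prefers, value]
      constructor
      · intro h; omega
      · intro h; linarith [hpos b]

theorem Report.IsTruthful.head_eq {u : β → ℝ} {r : Report β} (h : r.IsTruthful u) {a : β}
    (ha : 0 < u a) (hmax : ∀ b, b ≠ a → u b < u a) : r.1.head? = some a := by
  have ham := h.mem.2 ha
  obtain ⟨l, hl⟩ := r
  cases l with
  | nil => simp at ham
  | cons c t =>
    rcases List.mem_cons.1 ham with rfl | hat
    · rfl
    · have h1 := (List.pairwise_cons.1 h.2).1 a hat
      by_cases hc : c = a
      · simp [hc]
      · exact absurd h1 (not_lt.2 (hmax c hc).le)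

theorem exists_truthful_report [Fintype β] (u : β → ℝ) (hu : Function.Injective u) :
    ∃ r : Report β, r.IsTruthful u := by
  classical
  let _ : LinearOrder β := LinearOrder.lift' u hu
  refine ⟨⟨(Finset.univ.filter fun b => 0 < u b).sort (· ≥ ·), Finset.sort_nodup _ _⟩, ?_, ?_⟩
  · intro b
    simp
  · have h := Finset.pairwise_sort (Finset.univ.filter fun b => 0 < u b) (· ≥ ·)
    have hn := Finset.sort_nodup (Finset.univ.filter fun b => 0 < u b) (· ≥ ·)
    refine (List.Pairwise.and h hn).imp ?_
    rintro a b ⟨h1, h2⟩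
    exact lt_of_le_of_ne h1 (fun he => h2 (hu he.symm))

end Reports

/-! ### Deferred acceptance -/

theorem exists_find?_of_mem {α : Type*} [DecidableEq α] {l : List α} {p : α → Bool} {a : α}
    (ha : a ∈ l) (hp : p a = true) : ∃ b, l.find? p = some b ∧ l.idxOf b ≤ l.idxOf a := by
  induction l with
  | nil => simp at ha
  | cons c t ih =>
    by_cases hc : p c = true
    · exact ⟨c, by simp [hc], by simp⟩
    · have hca : c ≠ a := fun h => hc (h ▸ hp)
      obtain ⟨b, hb, hle⟩ := ih ((List.mem_cons.1 ha).resolve_left (Ne.symm hca))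
      have hcb : c ≠ b := by
        rintro rfl
        exact hc (List.find?_some hb)
      refine ⟨b, by simp [hc, hb], ?_⟩
      rw [List.idxOf_cons_ne _ hcb, List.idxOf_cons_ne _ hca]
      omega

/-- Until the iteration becomes stationary each step adds an element, so a step that is still active
after `N` steps would produce more than `N` elements. -/
theorem iterate_card_fixed {α : Type*} [DecidableEq α] (g : Finset α → Finset α)
    (hg : ∀ R, R ⊆ g R) {N : ℕ} (hN : ∀ R : Finset α, R.card ≤ N) : g (g^[N] ∅) = g^[N] ∅ := by
  have key : ∀ k, g (g^[k] ∅) = g^[k] ∅ ∨ k < (g^[k + 1] ∅).card := by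
    intro k
    induction k with
    | zero =>
      by_cases h : g ∅ = ∅
      · left; simpa using h
      · right
        simpa [Finset.card_pos, Finset.nonempty_iff_ne_empty] using h
    | succ k ih =>
      by_cases h : g (g^[k + 1] ∅) = g^[k + 1] ∅
      · exact Or.inl h
      · right
        rcases ih with ih | ih
        · exfalso
          apply h
          rw [Function.iterate_succ_apply', ih, ih]
        · have hlt : (g^[k + 1] ∅).card < (g (g^[k + 1] ∅)).card :=
            Finset.card_lt_card (Finset.ssubset_iff_subset_ne.2 ⟨hg _, Ne.symm h⟩)
          rw [← Function.iterate_succ_apply' g] at hlt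
          change _ < (g^[k + 1 + 1] ∅).card at hlt
          omega
  rcases key N with h | h
  · exact h
  · exact absurd (hN _) (not_le.2 h)

section DA

variable {F W : Type*} [Fintype F] [DecidableEq F] [Fintype W] [DecidableEq W]
variable {P : F → Report W} {Q : W → Report F}

theorem subset_daStep (R : Finset (F × W)) : R ⊆ daStep P Q R := Finset.subset_union_left

theorem daStep_daRejections : daStep P Q (daRejections P Q) = daRejections P Q :=
  iterate_card_fixed _ subset_daStep fun R => by
    simpa [Fintype.card_prod] using Finset.card_le_univ R

theorem daRejections_induction (p : Finset (F × W) → Prop) (h0 : p ∅)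
    (hs : ∀ R, p R → p (daStep P Q R)) : p (daRejections P Q) := by
  unfold daRejections
  generalize Fintype.card F * Fintype.card W = N
  induction N with
  | zero => exact h0
  | succ N ih => rw [Function.iterate_succ_apply']; exact hs _ ih

theorem proposal_mem {R : Finset (F × W)} {f : F} {w : W} (h : proposal P R f = some w) :
    w ∈ (P f).1 ∧ (f, w) ∉ R :=
  ⟨List.mem_of_find?_eq_some h, by simpa using List.find?_some h⟩

theorem held_mem {R : Finset (F × W)} {f : F} {w : W} (h : held P Q R w = some f) :
    f ∈ (Q w).1 ∧ proposal P R f = some w :=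
  ⟨List.mem_of_find?_eq_some h, by simpa using List.find?_some h⟩

theorem exists_proposal {R : Finset (F × W)} {f : F} {w : W} (hw : w ∈ (P f).1)
    (hR : (f, w) ∉ R) :
    ∃ w', proposal P R f = some w' ∧ (P f).1.idxOf w' ≤ (P f).1.idxOf w :=
  exists_find?_of_mem hw (by simpa using hR)

theorem exists_held {R : Finset (F × W)} {f : F} {w : W} (hf : f ∈ (Q w).1)
    (hp : proposal P R f = some w) :
    ∃ g, held P Q R w = some g ∧ (Q w).1.idxOf g ≤ (Q w).1.idxOf f :=
  exists_find?_of_mem hf (by simpa using hp)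

/-- Rejections only accumulate, so the next proposal cannot be better than `w`, and `w` itself
remains available because a held proposal is not rejected. -/
theorem proposal_daStep {R : Finset (F × W)} {f : F} {w : W} (h : held P Q R w = some f) :
    proposal P (daStep P Q R) f = some w := by
  obtain ⟨hf, hp⟩ := held_mem h
  obtain ⟨hw, hR⟩ := proposal_mem hp
  have hR' : (f, w) ∉ daStep P Q R := by
    simp [daStep, hR, h]
  obtain ⟨w', hw', hle⟩ := exists_proposal hw hR'
  obtain ⟨hm, hn⟩ := proposal_mem hw'
  obtain ⟨w'', hw'', hle'⟩ := exists_proposal hm (fun hc => hn (subset_daStep R hc))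
  rw [hp] at hw''
  obtain rfl := Option.some.inj hw''
  have : w' = w := (List.idxOf_inj hm).1 (le_antisymm hle hle')
  rw [hw', this]

/-- Along the algorithm a worker only trades up: the invariant is that some firm better than the
rejected one keeps proposing. It survives a round because the best current proposer is held and
proposes again. -/
theorem rejection_justified {f : F} {w : W} (h : (f, w) ∈ daRejections P Q)
    (hf : f ∈ (Q w).1) :
    ∃ g, held P Q (daRejections P Q) w = some g ∧ (Q w).1.idxOf g < (Q w).1.idxOf f := by
  have key : ∀ f w, (f, w) ∈ daRejections P Q → f ∈ (Q w).1 →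
      ∃ g, g ∈ (Q w).1 ∧ proposal P (daRejections P Q) g = some w ∧
        (Q w).1.idxOf g < (Q w).1.idxOf f := by
    refine daRejections_induction (fun R => ∀ f w, (f, w) ∈ R → f ∈ (Q w).1 →
      ∃ g, g ∈ (Q w).1 ∧ proposal P R g = some w ∧ (Q w).1.idxOf g < (Q w).1.idxOf f)
      (by simp) ?_
    intro R ih f w hfw hf
    rcases Finset.mem_union.1 hfw with hold | hnew
    · obtain ⟨g, hg, hp, hlt⟩ := ih f w hold hf
      obtain ⟨h, hh, hle⟩ := exists_held hg hp
      exact ⟨h, (held_mem hh).1, proposal_daStep hh, by omega⟩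
    · simp only [Finset.mem_filter, Finset.mem_univ, true_and] at hnew
      obtain ⟨h, hh, hle⟩ := exists_held hf hnew.1
      refine ⟨h, (held_mem hh).1, proposal_daStep hh, lt_of_le_of_ne hle ?_⟩
      intro he
      rw [(List.idxOf_inj (held_mem hh).1).1 he] at hh
      exact hnew.2 hh
  obtain ⟨g, hg, hp, hlt⟩ := key f w h hf
  obtain ⟨k, hk, hle⟩ := exists_held hg hp
  exact ⟨k, hk, by omega⟩

/-- The final set of rejections is a fixed point of the round, so no proposal is left that is not
held; the filter in the definition removes nothing. -/
theorem deferredAcceptance_apply (f : F) :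
    deferredAcceptance P Q f = proposal P (daRejections P Q) f := by
  change (proposal P (daRejections P Q) f).filter _ = _
  cases hw : proposal P (daRejections P Q) f with
  | none => rfl
  | some w =>
  rw [Option.filter_eq_some_iff]
  refine ⟨rfl, ?_⟩
  by_contra hne
  have hmem : (f, w) ∈ daStep P Q (daRejections P Q) := by
    refine Finset.mem_union_right _ ?_
    simp only [Finset.mem_filter, Finset.mem_univ, true_and]
    exact ⟨hw, by simpa using hne⟩
  rw [daStep_daRejections] at hmem
  exact (proposal_mem hw).2 hmem

theorem deferredAcceptance_symm_apply (w : W) :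
    (deferredAcceptance P Q).symm w = held P Q (daRejections P Q) w := rfl

/-- Deferred acceptance produces a stable matching. -/
theorem deferredAcceptance_stable :
    StableWrt (fun f => (P f).Prefers) (fun w => (Q w).Prefers) (deferredAcceptance P Q) := by
  refine ⟨?_, ?_, ?_⟩
  · intro f h
    rw [deferredAcceptance_apply] at h
    cases hp : proposal P (daRejections P Q) f with
    | none => rw [hp] at h; exact lt_irrefl _ h
    | some w =>
      rw [hp] at h
      exact lt_asymm h (Report.mem_iff_rank_lt.1 (proposal_mem hp).1)
  · intro w h
    rw [deferredAcceptance_symm_apply] at h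
    cases hp : held P Q (daRejections P Q) w with
    | none => rw [hp] at h; exact lt_irrefl _ h
    | some f =>
      rw [hp] at h
      exact lt_asymm h (Report.mem_iff_rank_lt.1 (held_mem hp).1)
  · rintro f w ⟨h1, h2⟩
    rw [deferredAcceptance_apply] at h1
    rw [deferredAcceptance_symm_apply] at h2
    have hrej : w ∈ (P f).1 ∧ (f, w) ∈ daRejections P Q := by
      have hw : w ∈ (P f).1 := by
        by_contra hw
        have hr := Report.rank_of_notMem hw
        simp only [Report.Prefers, hr] at h1
        cases hp : proposal P (daRejections P Q) f with
        | none => rw [hp, Report.rank_none] at h1; omega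
        | some w' =>
          rw [hp] at h1
          have := Report.mem_iff_rank_lt.1 (proposal_mem hp).1
          rw [Report.rank_none] at this
          omega
      refine ⟨hw, ?_⟩
      by_contra hR
      obtain ⟨w', hw', hle⟩ := exists_proposal hw hR
      rw [hw'] at h1
      simp only [Report.Prefers, Report.rank_of_mem hw, Report.rank_of_mem (proposal_mem hw').1]
        at h1
      omega
    have hf : f ∈ (Q w).1 := by
      by_contra hf
      have hr := Report.rank_of_notMem hf
      simp only [Report.Prefers, hr] at h2
      cases hp : held P Q (daRejections P Q) w with
      | none => rw [hp, Report.rank_none] at h2; omega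
      | some w' =>
        rw [hp] at h2
        have := Report.mem_iff_rank_lt.1 (held_mem hp).1
        rw [Report.rank_none] at this
        omega
    obtain ⟨g, hg, hlt⟩ := rejection_justified hrej.2 hf
    rw [hg] at h2
    simp only [Report.Prefers, Report.rank_of_mem hf, Report.rank_of_mem (held_mem hg).1] at h2
    omega

/-- An assignment of firms that no firm could upset by displacing the firm assigned to an accepting
worker. Unassigned workers are not constrained. -/
def SafeAssignment (P : F → Report W) (Q : W → Report F) (lam : F → Option W) : Prop :=
  ∀ f w, lam f = some w → f ∈ (Q w).1 ∧
    ∀ g, g ≠ f → lam g ≠ some w ∧ ¬ ((P g).Prefers (some w) (lam g) ∧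
      (Q w).Prefers (some g) (some f))

/-- Every firm weakly prefers the outcome of deferred acceptance to any safe assignment. -/
theorem SafeAssignment.not_prefers {lam : F → Option W} (h : SafeAssignment P Q lam) (f : F) :
    ¬ (P f).Prefers (lam f) (deferredAcceptance P Q f) := by
  -- No firm is ever rejected by its assigned worker. In the first round violating this, `w` holds
  -- some `g` instead of `f`; as `g` has not been rejected by `lam g`, it prefers `w`, and so the
  -- pair `(g, w)` contradicts safety.
  have key : ∀ f w, (f, w) ∈ daRejections P Q → lam f ≠ some w := by
    refine daRejections_induction (fun R => ∀ f w, (f, w) ∈ R → lam f ≠ some w) (by simp) ?_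
    intro R ih f w hfw hl
    rcases Finset.mem_union.1 hfw with hold | hnew
    · exact ih f w hold hl
    · simp only [Finset.mem_filter, Finset.mem_univ, true_and] at hnew
      obtain ⟨hf, hs⟩ := h f w hl
      obtain ⟨g, hg, hle⟩ := exists_held hf hnew.1
      have hne : g ≠ f := by rintro rfl; exact hnew.2 hg
      obtain ⟨hgm, hgp⟩ := held_mem hg
      obtain ⟨hgl, hns⟩ := hs g hne
      refine hns ⟨?_, ?_⟩
      · have hwm := (proposal_mem hgp).1
        cases hlg : lam g with
        | none => exact Report.mem_iff_rank_lt.1 hwm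
        | some w' =>
          by_cases hw' : w' ∈ (P g).1
          · obtain ⟨w'', hw'', hle'⟩ := exists_proposal hw' (fun hc => ih g w' hc hlg)
            rw [hgp] at hw''
            obtain rfl := Option.some.inj hw''
            simp only [Report.Prefers, Report.rank_of_mem hw', Report.rank_of_mem hwm]
            refine lt_of_le_of_ne hle' ?_
            intro he
            rw [(List.idxOf_inj hwm).1 he] at hgl
            exact hgl hlg
          · have h1 := Report.mem_iff_rank_lt.1 hwm
            have h2 := Report.rank_of_notMem hw'
            have h3 := Report.rank_none (P g)
            simp only [Report.Prefers]
            omega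
      · simp only [Report.Prefers, Report.rank_of_mem hgm, Report.rank_of_mem hf]
        refine lt_of_le_of_ne hle ?_
        intro he
        exact hne ((List.idxOf_inj hgm).1 he)
  cases hl : lam f with
  | none => exact deferredAcceptance_stable.1 f
  | some w =>
    intro hp
    have hst := (deferredAcceptance_stable (P := P) (Q := Q)).1 f
    rw [deferredAcceptance_apply] at hp hst
    by_cases hw : w ∈ (P f).1
    · obtain ⟨w', hw', hle⟩ := exists_proposal hw (fun hc => key f w hc hl)
      rw [hw'] at hp
      simp only [Report.Prefers, Report.rank_of_mem hw, Report.rank_of_mem (proposal_mem hw').1]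
        at hp
      omega
    · have h2 := Report.rank_of_notMem hw
      have h3 := Report.rank_none (P f)
      simp only [Report.Prefers] at hp hst
      omega

/-- Stable matchings are safe, so deferred acceptance is the firm-optimal stable matching. -/
theorem StableWrt.safe {μ : F ≃. W}
    (h : StableWrt (fun f => (P f).Prefers) (fun w => (Q w).Prefers) μ) :
    SafeAssignment P Q μ := by
  intro f w hfw
  have hwf : μ.symm w = some f := μ.eq_some_iff.2 hfw
  refine ⟨?_, fun g hg => ⟨fun hgw => hg ?_, fun hb => h.2.2 g w ⟨hb.1, ?_⟩⟩⟩
  · have := h.2.1 w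
    rw [hwf] at this
    by_contra hc
    exact this (by simp [Report.Prefers, Report.rank_of_notMem hc, Report.rank_none])
  · have := μ.eq_some_iff.2 hgw
    rw [hwf] at this
    exact (Option.some.inj this).symm
  · rw [hwf]; exact hb.2

end DA

/-! ### Incentives under deferred acceptance: strategy-proofness for firms, undominated reports of
workers -/

section Incentives

variable {F W : Type*} [Fintype F] [DecidableEq F] [Fintype W] [DecidableEq W]
variable {P : F → Report W} {Q : W → Report F}

theorem card_matched_le (μ : F ≃. W) :
    (Finset.univ.filter fun f => μ f ≠ none).card ≤
      (Finset.univ.filter fun w => μ.symm w ≠ none).card := by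
  refine Finset.card_le_card_of_forall_subsingleton (fun f w => μ f = some w) ?_ ?_
  · intro f hf
    simp only [Finset.mem_filter, Finset.mem_univ, true_and] at hf
    obtain ⟨w, hw⟩ := Option.ne_none_iff_exists'.1 hf
    refine ⟨w, ?_, hw⟩
    have := μ.eq_some_iff.2 hw
    simp [this]
  · intro w _ f hf g hg
    have h1 := μ.eq_some_iff.2 hf.2
    have h2 := μ.eq_some_iff.2 hg.2
    rw [h1] at h2
    exact Option.some.inj h2

/-- Whatever beats an entry of the truncated list precedes it, hence survives the truncation. -/
theorem Report.Prefers.of_take {β : Type*} [DecidableEq β] {r t : Report β} {n : ℕ}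
    (ht : t.1 = r.1.take n) {a b : β} (hb : b ∈ t.1) (h : r.Prefers (some a) (some b)) :
    t.Prefers (some a) (some b) := by
  have hidx : ∀ c ∈ t.1, t.1.idxOf c = r.1.idxOf c := by
    intro c hc
    conv_rhs => rw [← List.take_append_drop n r.1]
    rw [← ht, List.idxOf_append_of_mem hc]
  have hbr : b ∈ r.1 := List.mem_of_mem_take (ht ▸ hb)
  have har : a ∈ r.1 := by
    rw [Report.mem_iff_rank_lt] at hbr ⊢
    exact lt_trans h hbr
  have hlt : r.1.idxOf a < r.1.idxOf b := by
    simpa only [Report.Prefers, Report.rank_of_mem har, Report.rank_of_mem hbr] using h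
  have hbn : r.1.idxOf b < n := by
    rw [ht, List.mem_take_iff_idxOf_lt hbr] at hb
    exact hb
  have hat : a ∈ t.1 := by
    rw [ht, List.mem_take_iff_idxOf_lt har]
    omega
  simpa only [Report.Prefers, Report.rank_of_mem hat, Report.rank_of_mem hb, hidx a hat,
    hidx b hb] using hlt

theorem Report.prefers_none_of_mem {β : Type*} [DecidableEq β] {r : Report β} {b : β}
    (h : b ∈ r.1) : r.Prefers (some b) none := Report.mem_iff_rank_lt.1 h

theorem Report.mem_of_not_prefers {β : Type*} [DecidableEq β] {r : Report β} {b : β}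
    (h : ¬ r.Prefers none (some b)) : b ∈ r.1 := by
  have := r.rank_ne_none b
  simp only [Report.Prefers] at h
  rw [Report.mem_iff_rank_lt]
  omega

theorem Report.prefers_of_ne {β : Type*} [DecidableEq β] {r : Report β} {b : β} {o : Option β}
    (hb : b ∈ r.1) (hne : o ≠ some b) (h : ¬ r.Prefers o (some b)) : r.Prefers (some b) o := by
  simp only [Report.Prefers] at h ⊢
  refine lt_of_le_of_ne (not_lt.1 h) ?_
  cases o with
  | none => exact r.rank_ne_none b
  | some c => exact fun he => hne (by rw [Report.rank_inj hb he])

/-- Under deferred acceptance no firm can gain by misreporting. -/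
theorem firm_strategyproof (P : F → Report W) (Q : W → Report F) (f : F) (s : Report W) :
    ¬ (P f).Prefers (deferredAcceptance (Function.update P f s) Q f)
      (deferredAcceptance P Q f) := by
  intro hgain
  have hst := deferredAcceptance_stable (P := P) (Q := Q)
  cases hν : deferredAcceptance (Function.update P f s) Q f with
  | none => rw [hν] at hgain; exact hst.1 f hgain
  | some w =>
  rw [hν] at hgain
  have hw : w ∈ (P f).1 := by
    rw [Report.mem_iff_rank_lt]
    have := hst.1 f
    simp only [Report.Prefers] at this hgain
    omega
  -- If `w` is obtained by some report, then it is obtained by listing `w` alone. This outcome `κ`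
  -- is compared with the outcome `lam` of the true list cut off just below `w`; the cut at `idxOf w
  -- + 1` keeps `w` itself.
  set single : Report W := ⟨[w], List.nodup_singleton w⟩ with hsingle
  set trunc : Report W := ⟨(P f).1.take ((P f).1.idxOf w + 1), (P f).2.take⟩ with htrunc
  have hwt : w ∈ trunc.1 := by
    rw [htrunc, List.mem_take_iff_idxOf_lt hw]
    omega
  have hsingle_rank : ∀ o, ¬ single.Prefers o (some w) := by
    intro o
    simp [Report.Prefers, Report.rank, hsingle]
  have hsafe1 : SafeAssignment (Function.update P f single) Q
      (deferredAcceptance (Function.update P f s) Q) := by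
    intro g v hgv
    obtain ⟨h1, h2⟩ := (deferredAcceptance_stable (P := Function.update P f s) (Q := Q)).safe g v hgv
    refine ⟨h1, fun k hk => ⟨(h2 k hk).1, fun hb => (h2 k hk).2 ⟨?_, hb.2⟩⟩⟩
    by_cases hkf : k = f
    · subst hkf
      rw [Function.update_self, hν] at hb
      exact absurd hb.1 (hsingle_rank _)
    · rw [Function.update_of_ne hkf]
      rw [Function.update_of_ne hkf] at hb
      exact hb.1
  set κ := deferredAcceptance (Function.update P f single) Q with hκ
  have hκst : StableWrt (fun g => (Function.update P f single g).Prefers)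
      (fun w => (Q w).Prefers) κ := deferredAcceptance_stable
  have hκf : κ f = some w := by
    have := hsafe1.not_prefers f
    rw [Function.update_self, hν] at this
    by_contra hne
    exact this (Report.prefers_of_ne (by simp [hsingle]) hne (hsingle_rank _))
  set lam := deferredAcceptance (Function.update P f trunc) Q with hlam
  have hlst : StableWrt (fun g => (Function.update P f trunc g).Prefers)
      (fun w => (Q w).Prefers) lam := deferredAcceptance_stable
  -- A partner under the truncated list would be at least as good as `w`, and `lam` would be safe
  -- for the original reports. Firm-optimality would then give `f` at least as much there, contrary
  -- to the supposed gain.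
  have hlf : lam f = none := by
    by_contra hne
    obtain ⟨v, hv⟩ := Option.ne_none_iff_exists'.1 hne
    have hvt : v ∈ trunc.1 := by
      have := hlst.1 f
      simp only [Function.update_self] at this
      rw [hv] at this
      exact Report.mem_of_not_prefers this
    have hsafe : SafeAssignment P Q lam := by
      intro g u hgu
      obtain ⟨h1, h2⟩ := hlst.safe g u hgu
      refine ⟨h1, fun k hk => ⟨(h2 k hk).1, fun hb => (h2 k hk).2 ⟨?_, hb.2⟩⟩⟩
      by_cases hkf : k = f
      · subst hkf
        rw [Function.update_self, hv]
        rw [hv] at hb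
        exact Report.Prefers.of_take rfl hvt hb.1
      · rw [Function.update_of_ne hkf]
        exact hb.1
    have h1 := hsafe.not_prefers f
    rw [hv] at h1
    have hvP : v ∈ (P f).1 := List.mem_of_mem_take hvt
    have hvw : (P f).1.idxOf v < (P f).1.idxOf w + 1 := (List.mem_take_iff_idxOf_lt hvP).1 hvt
    simp only [Report.Prefers, Report.rank_of_mem hvP, Report.rank_of_mem hw] at h1 hgain
    omega
  -- Being unmatched in `lam`, firm `f` would already block with `w` under the truncated list, so
  -- shortening its list to `w` creates no new block.
  have hsafe2 : SafeAssignment (Function.update P f single) Q lam := by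
    intro g u hgu
    obtain ⟨h1, h2⟩ := hlst.safe g u hgu
    refine ⟨h1, fun k hk => ⟨(h2 k hk).1, fun hb => (h2 k hk).2 ⟨?_, hb.2⟩⟩⟩
    by_cases hkf : k = f
    · subst hkf
      rw [Function.update_self, hlf] at hb ⊢
      have hu := Report.mem_iff_rank_lt.2 hb.1
      obtain rfl : u = w := by simpa [hsingle] using hu
      exact Report.prefers_none_of_mem hwt
    · rw [Function.update_of_ne hkf] at hb ⊢
      exact hb.1
  have hfirms : (Finset.univ.filter fun g => lam g ≠ none) ⊂
      (Finset.univ.filter fun g => κ g ≠ none) := by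
    rw [Finset.ssubset_iff_of_subset]
    · exact ⟨f, by simp [hκf], by simp [hlf]⟩
    · intro g hg
      simp only [Finset.mem_filter, Finset.mem_univ, true_and] at hg ⊢
      intro hκg
      have hgf : g ≠ f := by rintro rfl; exact hg hlf
      obtain ⟨u, hu⟩ := Option.ne_none_iff_exists'.1 hg
      have h1 := hsafe2.not_prefers g
      rw [← hκ, hκg, hu] at h1
      refine h1 (Report.prefers_none_of_mem ?_)
      have h2 := hlst.1 g
      simp only [Function.update_of_ne hgf, hu] at h2 ⊢
      exact Report.mem_of_not_prefers h2
  -- All firms weakly prefer `κ` to `lam`. A worker matched only in `κ` would therefore block `lam`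
  -- with his partner there. So `κ` matches more firms but no more workers, which is impossible.
  have hworkers : (Finset.univ.filter fun u => κ.symm u ≠ none) ⊆
      (Finset.univ.filter fun u => lam.symm u ≠ none) := by
    intro u hu
    simp only [Finset.mem_filter, Finset.mem_univ, true_and] at hu ⊢
    intro hlu
    obtain ⟨g, hg⟩ := Option.ne_none_iff_exists'.1 hu
    have hgu : κ g = some u := κ.eq_some_iff.1 hg
    have hlgu : lam g ≠ some u := fun hc => by
      rw [lam.eq_some_iff.2 hc] at hlu
      cases hlu
    have hQ : g ∈ (Q u).1 := (hκst.safe g u hgu).1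
    refine hlst.2.2 g u ⟨?_, ?_⟩
    · by_cases hgf : g = f
      · subst hgf
        rw [hκf] at hgu
        obtain rfl := Option.some.inj hgu
        simp only [Function.update_self]
        rw [hlf]
        exact Report.prefers_none_of_mem hwt
      · have h1 := hsafe2.not_prefers g
        rw [← hκ, hgu] at h1
        have h2 := hκst.1 g
        simp only [hgu] at h2
        rw [Function.update_of_ne hgf] at h1 h2
        simp only [Function.update_of_ne hgf]
        exact Report.prefers_of_ne (Report.mem_of_not_prefers h2) hlgu h1
    · simp only [hlu]
      exact Report.prefers_none_of_mem hQ
  have c1 := Finset.card_lt_card hfirms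
  have c2 := Finset.card_le_card hworkers
  have c3 := card_matched_le κ
  have c4 : (Finset.univ.filter fun u => lam.symm u ≠ none).card ≤
      (Finset.univ.filter fun g => lam g ≠ none).card := card_matched_le lam.symm
  omega

theorem Report.rank_of_head {β : Type*} [DecidableEq β] {r : Report β} {b : β}
    (h : r.1.head? = some b) : r.rank (some b) = 0 := by
  rw [Report.rank_of_mem (List.mem_of_mem_head? h)]
  obtain ⟨l, hl⟩ := r
  cases l with
  | nil => simp at h
  | cons a t => simp at h; simp [h]

/-- Two lists with the same entries and no inverted pair coincide. -/
theorem Report.eq_of_prefers {β : Type*} [DecidableEq β] {r s : Report β}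
    (hmem : ∀ b, b ∈ r.1 ↔ b ∈ s.1)
    (h : ∀ a b, a ∈ r.1 → b ∈ r.1 → r.Prefers (some a) (some b) →
      ¬ s.Prefers (some b) (some a)) : r = s := by
  have hperm : r.1.Perm s.1 := (List.perm_ext_iff_of_nodup r.2 s.2).2 hmem
  have hself : ∀ t : Report β,
      t.1.Pairwise fun a b => t.Prefers (some a) (some b) := by
    intro t
    rw [List.pairwise_iff_getElem]
    intro i j hi hj hij
    simp only [Report.Prefers, Report.rank_of_mem (List.getElem_mem hi),
      Report.rank_of_mem (List.getElem_mem hj), t.2.idxOf_getElem]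
    exact hij
  refine Subtype.ext (hperm.eq_of_pairwise (le := fun a b => r.Prefers (some a) (some b)) ?_
    (hself r) ?_)
  · intro a b _ _ h1 h2
    exact absurd h1 (lt_asymm h2)
  · refine (List.Pairwise.and_mem.1 (hself s)).imp ?_
    rintro a b ⟨ha, hb, hab⟩
    by_contra hc
    have ha' := (hmem a).2 ha
    have hb' := (hmem b).2 hb
    by_cases he : a = b
    · subst he; exact lt_irrefl _ hab
    · exact h b a hb' ha' (Report.prefers_of_ne hb' (by simpa using he) hc) hab

/-- With `no_applicant`, this determines the worker's match in the test profiles below, where firms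
apply to one worker only. -/
theorem StableWrt.best_applicant {μ : F ≃. W}
    (h : StableWrt (fun f => (P f).Prefers) (fun w => (Q w).Prefers) μ) {f : F} {w : W}
    (hf : (P f).1 = [w]) (hfw : f ∈ (Q w).1)
    (hbest : ∀ g, g ≠ f → w ∈ (P g).1 → ¬ (Q w).Prefers (some g) (some f)) :
    μ.symm w = some f := by
  by_contra hc
  refine h.2.2 f w ⟨Report.prefers_of_ne (by simp [hf]) (fun he => hc (μ.eq_some_iff.2 he)) ?_,
    Report.prefers_of_ne hfw hc ?_⟩
  · simp [Report.Prefers, Report.rank, hf]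
  · cases hμ : μ.symm w with
    | none => exact lt_asymm (Report.prefers_none_of_mem hfw)
    | some g =>
      refine hbest g (by rintro rfl; exact hc hμ) ?_
      have h1 := h.1 g
      simp only [μ.eq_some_iff.1 hμ] at h1
      exact Report.mem_of_not_prefers h1

theorem StableWrt.no_applicant {μ : F ≃. W}
    (h : StableWrt (fun f => (P f).Prefers) (fun w => (Q w).Prefers) μ) {w : W}
    (hno : ∀ g ∈ (Q w).1, w ∉ (P g).1) : μ.symm w = none := by
  cases hμ : μ.symm w with
  | none => rfl
  | some g =>
    exfalso
    have h1 := h.1 g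
    simp only [μ.eq_some_iff.1 hμ] at h1
    have h2 := h.2.1 w
    simp only [hμ] at h2
    exact hno g (Report.mem_of_not_prefers h2) (Report.mem_of_not_prefers h1)

variable {Θ : Type*} [Fintype Θ]

/-- A report that lists the true favourite first is not weakly dominated. -/
theorem not_workerDominates_of_head (E : Economy Θ F W) {w w' : W} (hww : w' ≠ w)
    {r r' : Report F} {t : F} (hr : r.1.head? = some t)
    (htop : ∀ θ, ∀ g, g ≠ t → (E.market θ).workerUtil w g < (E.market θ).workerUtil w t) :
    ¬ E.WorkerDominates w r' r := by
  classical
  rintro ⟨hle, τ₀, hlt₀⟩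
  have hΘ : (Finset.univ : Finset Θ).Nonempty := by
    by_contra hne
    have := E.prior_sum
    rw [Finset.not_nonempty_iff_eq_empty.1 hne] at this
    simp at this
  -- Test profiles are constant in the state, so the payoff comparison reduces to a single match.
  -- The tests force a dominating report to coincide with the given one, which contradicts strict
  -- dominance.
  have key : ∀ (P : F → Report W) (Q : W → Report F) (o o' : Option F),
      (deferredAcceptance P (Function.update Q w r)).symm w = o →
      (deferredAcceptance P (Function.update Q w r')).symm w = o' →
      ¬ ∀ θ, value ((E.market θ).workerUtil w) o' < value ((E.market θ).workerUtil w) o := by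
    intro P Q o o' ho ho' hlt
    refine not_lt.2 (hle ⟨fun g _ => P g, Q⟩) ?_
    refine Finset.sum_lt_sum_of_nonempty hΘ fun θ _ => ?_
    refine mul_lt_mul_of_pos_left ?_ (E.prior_pos θ)
    change value _ ((deferredAcceptance P (Function.update Q w r')).symm w) <
      value _ ((deferredAcceptance P (Function.update Q w r)).symm w)
    rw [ho, ho']
    exact hlt θ
  have htr : t ∈ r.1 := List.mem_of_mem_head? hr
  have ht0 := Report.rank_of_head hr
  have hpos : ∀ θ g, 0 < (E.market θ).workerUtil w g := fun θ g =>
    (E.market θ).worker_acceptable w g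
  -- In the first tests only the firms in `T` are active, and they apply to `w` alone.
  let solo : (F → Prop) → F → Report W := fun T g =>
    if T g then ⟨[w], List.nodup_singleton w⟩ else ⟨[], List.nodup_nil⟩
  have solo_mem : ∀ T g, w ∈ (solo T g).1 ↔ T g := by
    intro T g
    by_cases h : T g <;> simp [solo, h]
  have solo_eq : ∀ T g, T g → (solo T g).1 = [w] := by
    intro T g h
    simp [solo, h]
  let Q₀ : W → Report F := fun _ => ⟨[], List.nodup_nil⟩
  have soloBest : ∀ (T : F → Prop) (q : Report F) f, T f → f ∈ q.1 →
      (∀ g, g ≠ f → T g → ¬ q.Prefers (some g) (some f)) →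
      (deferredAcceptance (solo T) (Function.update Q₀ w q)).symm w = some f := by
    intro T q f hT hf hb
    refine deferredAcceptance_stable.best_applicant (solo_eq T f hT) (by simpa using hf) ?_
    intro g hg hw
    simpa using hb g hg ((solo_mem T g).1 hw)
  have soloNone : ∀ (T : F → Prop) (q : Report F), (∀ g ∈ q.1, ¬ T g) →
      (deferredAcceptance (solo T) (Function.update Q₀ w q)).symm w = none := by
    intro T q h
    refine deferredAcceptance_stable.no_applicant ?_
    intro g hg
    rw [solo_mem]
    exact h g (by simpa using hg)
  have htr' : t ∈ r'.1 := by
    by_contra h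
    exact key (solo (· = t)) Q₀ (some t) none
      (soloBest _ _ _ rfl htr fun g hg hg' => absurd hg' hg)
      (soloNone _ _ fun g hg hgt => h (hgt ▸ hg)) fun θ => hpos θ t
  have htfirst : ∀ g, g ≠ t → ¬ r'.Prefers (some g) (some t) := by
    intro g hg hp
    have hgr : g ∈ r'.1 := by
      have := Report.mem_iff_rank_lt.1 htr'
      rw [Report.mem_iff_rank_lt]
      exact lt_trans hp this
    refine key (solo (fun f => f = t ∨ f = g)) Q₀ (some t) (some g)
      (soloBest _ _ _ (Or.inl rfl) htr ?_) (soloBest _ _ _ (Or.inr rfl) hgr ?_)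
      fun θ => htop θ g hg
    · intro f _ _
      simp [Report.Prefers, ht0]
    · rintro f hfg (rfl | rfl)
      · exact lt_asymm hp
      · exact absurd rfl hfg
  have hsub : ∀ b ∈ r.1, b ∈ r'.1 := by
    intro b hb
    by_contra hb'
    exact key (solo (· = b)) Q₀ (some b) none
      (soloBest _ _ _ rfl hb fun g hg hg' => absurd hg' hg)
      (soloNone _ _ fun g hg hgt => hb' (hgt ▸ hg)) fun θ => hpos θ b
  -- A rejection chain rewards refusing `b`. Firm `t` tries `w'` before `w`, firm `b` tries `w`
  -- before `w'`, and `w'` prefers `b`. If `w` turns `b` down, then `b` displaces `t` from `w'` and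
  -- `t` comes to `w`. Under `r` this happens, while under `r'` worker `w` keeps `b`; so `r'`
  -- neither lists extra firms nor reverses a pair.
  have chain : ∀ (T : F → Prop) (b : F), b ≠ t → b ∈ r'.1 →
      (b ∉ r.1 ∨ ∃ a, T a ∧ a ≠ t ∧ a ≠ b ∧ a ∈ r.1 ∧ r.Prefers (some a) (some b)) →
      (∀ a, T a → ¬ r'.Prefers (some a) (some b)) → False := by
    intro T b hbt hb' hr1 hr2
    have htb : t ≠ b := Ne.symm hbt
    let P : F → Report W := fun g =>
      if g = t then ⟨[w', w], by simp [hww]⟩ else if g = b then ⟨[w, w'], by simp [hww.symm]⟩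
      else solo T g
    let Q : W → Report F := fun _ => ⟨[b, t], by simp [hbt]⟩
    have hPt : P t = ⟨[w', w], by simp [hww]⟩ := by simp [P]
    have hPb : P b = ⟨[w, w'], by simp [hww.symm]⟩ := by simp [P, hbt]
    have hPo : ∀ g, g ≠ t → g ≠ b → P g = solo T g := by
      intro g h1 h2
      simp [P, h1, h2]
    refine key P Q (some t) (some b) ?_ ?_ fun θ => htop θ b hbt
    · have hst := deferredAcceptance_stable (P := P) (Q := Function.update Q w r)
      set ν := deferredAcceptance P (Function.update Q w r)
      by_contra hc
      have hνt : ν t ≠ some w := fun h => hc (ν.eq_some_iff.2 h)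
      have hwt : (Function.update Q w r w).Prefers (some t) (ν.symm w) := by
        rw [Function.update_self]
        exact Report.prefers_of_ne htr hc (by simp [Report.Prefers, ht0])
      have htw' : ν t = some w' := by
        by_contra hne
        refine hst.2.2 t w ⟨?_, hwt⟩
        simp only [hPt]
        cases hν : ν t with
        | none => exact Report.prefers_none_of_mem (by simp)
        | some v =>
          have h1 := hst.1 t
          simp only [hν, hPt] at h1
          have h2 := Report.mem_of_not_prefers h1
          simp only [List.mem_cons, List.not_mem_nil, or_false] at h2
          rcases h2 with rfl | rfl
          · exact absurd hν hne
          · exact absurd hν hνt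
      have hbw : ν b = some w := by
        by_contra hne
        refine hst.2.2 b w' ⟨?_, ?_⟩
        · simp only [hPb]
          cases hν : ν b with
          | none => exact Report.prefers_none_of_mem (by simp)
          | some v =>
            have h1 := hst.1 b
            simp only [hν, hPb] at h1
            have h2 := Report.mem_of_not_prefers h1
            simp only [List.mem_cons, List.not_mem_nil, or_false] at h2
            rcases h2 with rfl | rfl
            · exact absurd hν hne
            · have h3 := ν.eq_some_iff.2 hν
              rw [ν.eq_some_iff.2 htw'] at h3
              exact absurd (Option.some.inj h3) htb
        · beta_reduce
          rw [Function.update_of_ne hww, ν.eq_some_iff.2 htw']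
          simp [Q, Report.Prefers, Report.rank, hbt]
      have hwb := ν.eq_some_iff.2 hbw
      have hbr : b ∈ r.1 := by
        have := hst.2.1 w
        beta_reduce at this
        rw [Function.update_self, hwb] at this
        exact Report.mem_of_not_prefers this
      rcases hr1 with hn | ⟨a, hTa, hat, hab, har, hp⟩
      · exact hn hbr
      · refine hst.2.2 a w ⟨?_, ?_⟩
        · beta_reduce
          rw [hPo a hat hab]
          refine Report.prefers_of_ne (by simp [solo_eq T a hTa]) ?_ ?_
          · intro h
            rw [ν.eq_some_iff.2 h] at hwb
            exact hab (Option.some.inj hwb)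
          · simp [Report.Prefers, Report.rank, solo_eq T a hTa]
        · beta_reduce
          rw [Function.update_self, hwb]
          exact hp
    · have hsafe : SafeAssignment P (Function.update Q w r')
          (fun g => if g = t then some w' else if g = b then some w else none) := by
        intro f v hf
        dsimp only at hf
        split_ifs at hf with h1 h2
        · obtain rfl := Option.some.inj hf
          subst h1
          rw [Function.update_of_ne hww]
          refine ⟨by simp [Q], fun g hg => ?_⟩
          by_cases hgb : g = b
          · subst hgb
            refine ⟨by simp [hg, hww.symm], ?_⟩
            rintro ⟨h, -⟩
            simp [hg, hPb, Report.Prefers, Report.rank] at h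
          · refine ⟨by simp [hg, hgb], ?_⟩
            rintro ⟨h, -⟩
            rw [hPo g hg hgb] at h
            simp only [hg, hgb, if_false] at h
            have := Report.mem_iff_rank_lt.2 h
            by_cases hT : T g
            · simp [solo, hT, hww] at this
            · simp [solo, hT] at this
        · obtain rfl := Option.some.inj hf
          subst h2
          rw [Function.update_self]
          refine ⟨hb', fun g hg => ?_⟩
          by_cases hgt : g = t
          · subst hgt
            refine ⟨by simp [hww], ?_⟩
            rintro ⟨h, -⟩
            simp [hPt, Report.Prefers, Report.rank] at h
          · refine ⟨by simp [hg, hgt], ?_⟩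
            rintro ⟨h, hp⟩
            rw [hPo g hgt hg] at h
            simp only [hg, hgt, if_false] at h
            have := Report.mem_iff_rank_lt.2 h
            exact hr2 g ((solo_mem T g).1 this) hp
      have h1 := hsafe.not_prefers b
      simp only [hbt, if_false, if_true] at h1
      refine (deferredAcceptance P (Function.update Q w r')).eq_some_iff.2 ?_
      by_contra hne
      refine h1 (Report.prefers_of_ne (by simp [hPb]) hne ?_)
      simp [hPb, Report.Prefers, Report.rank]
  have hsub' : ∀ b ∈ r'.1, b ∈ r.1 := by
    intro b hb
    by_contra hb'
    exact chain (fun _ => False) b (by rintro rfl; exact hb' htr) hb (Or.inl hb')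
      (fun _ h => h.elim)
  have hrr : r = r' := by
    refine Report.eq_of_prefers (fun b => ⟨hsub b, hsub' b⟩) ?_
    intro a b ha hb hab hba
    have hbt : b ≠ t := by
      rintro rfl
      simp [Report.Prefers, ht0] at hab
    have hne : a ≠ b := by
      rintro rfl
      exact lt_irrefl _ hab
    have hat : a ≠ t := by
      rintro rfl
      exact htfirst b hbt hba
    refine chain (· = a) b hbt (hsub b hb) (Or.inr ⟨a, rfl, hat, hne, ha, hab⟩) ?_
    rintro _ rfl
    exact lt_asymm hba
  subst hrr
  exact lt_irrefl _ hlt₀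

/-- Truth-telling is a weakly dominant strategy for every firm. -/
theorem firmPayoff_le_of_truthful (E : Economy Θ F W) (τ : Profile Θ F W) (f : F)
    (s t : Θ → Report W) (ht : ∀ θ, (t θ).IsTruthful ((E.market θ).firmUtil f)) :
    E.firmPayoff (τ.setFirm f s) f ≤ E.firmPayoff (τ.setFirm f t) f := by
  refine Finset.sum_le_sum fun θ _ => mul_le_mul_of_nonneg_left ?_ (E.prior_pos θ).le
  have hout : ∀ q : Θ → Report W, (τ.setFirm f q).outcome θ =
      deferredAcceptance (Function.update (fun g => τ.firm g θ) f (q θ)) τ.worker := by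
    intro q
    unfold Profile.outcome Profile.setFirm
    congr 1
    funext g
    by_cases hg : g = f
    · subst hg; simp
    · simp [hg]
  have h := firm_strategyproof (Function.update (fun g => τ.firm g θ) f (t θ)) τ.worker f (s θ)
  rw [Function.update_idem, Function.update_self, ← hout, ← hout,
    (ht θ).prefers_iff ((E.market θ).firm_strict f) ((E.market θ).firm_acceptable f)] at h
  exact not_lt.1 h

end Incentives

/-! ### Stability conditions among the last three firms and workers -/

/-- Ranks of the core firms and of being unmatched in a worker's report. -/
structure CoreRanks where
  r1 : ℕ
  r2 : ℕ
  r3 : ℕ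
  r0 : ℕ

/-- Ranks come from a report: only unlisted firms can tie. -/
structure CoreRanks.Valid (X : CoreRanks) : Prop where
  n1 : X.r1 ≠ X.r0
  n2 : X.r2 ≠ X.r0
  n3 : X.r3 ≠ X.r0
  n12 : X.r1 = X.r2 → X.r0 < X.r1
  n13 : X.r1 = X.r3 → X.r0 < X.r1
  n23 : X.r2 = X.r3 → X.r0 < X.r2

/-- The part of a matching that concerns the core: `vᵢ` is the partner of the `i`-th core firm
(`0, 1, 2` for the workers `x, y, z` and `3` for anything else), and `hx, hy, hz` are the ranks of
the partners of `x, y, z` in their reports. -/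
structure CorePattern where
  v1 : ℕ
  v2 : ℕ
  v3 : ℕ
  hx : ℕ
  hy : ℕ
  hz : ℕ

/-- Absence of blocking pairs in the core, in state `s`; the propositions `e1y`, `e2y`, `e2z` are
circumstances in which the pair in question may fail to block. -/
structure WeakCoreStable (s : Fin 2) (X Y Z : CoreRanks) (p : CorePattern) (e1y e2y e2z : Prop) :
    Prop where
  le1 : p.v1 ≤ 3
  le2 : p.v2 ≤ 3
  le3 : p.v3 ≤ 3
  d12 : p.v1 = p.v2 → p.v1 = 3
  d13 : p.v1 = p.v3 → p.v1 = 3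
  d23 : p.v2 = p.v3 → p.v2 = 3
  irx : p.hx ≤ X.r0
  iry : p.hy ≤ Y.r0
  irz : p.hz ≤ Z.r0
  x1 : p.v1 = 0 → p.hx = X.r1
  x2 : p.v2 = 0 → p.hx = X.r2
  x3 : p.v3 = 0 → p.hx = X.r3
  y1 : p.v1 = 1 → p.hy = Y.r1
  y2 : p.v2 = 1 → p.hy = Y.r2
  y3 : p.v3 = 1 → p.hy = Y.r3
  z1 : p.v1 = 2 → p.hz = Z.r1
  z2 : p.v2 = 2 → p.hz = Z.r2
  z3 : p.v3 = 2 → p.hz = Z.r3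
  b1z : p.hz ≤ Z.r1
  b1x : p.v1 = 2 ∨ p.hx ≤ X.r1
  b1y : p.v1 = 2 ∨ p.v1 = 0 ∨ p.hy ≤ Y.r1 ∨ e1y
  b2x : p.hx ≤ X.r2
  b2y : p.v2 = 0 ∨ p.hy ≤ Y.r2 ∨ e2y
  b2z : p.v2 = 0 ∨ p.v2 = 1 ∨ p.hz ≤ Z.r2 ∨ e2z
  b3x : p.hx ≤ X.r3
  b3y : p.v3 = 0 ∨ (s = 1 ∧ p.v3 = 2) ∨ p.hy ≤ Y.r3
  b3z : p.v3 = 0 ∨ (s = 0 ∧ p.v3 = 1) ∨ p.hz ≤ Z.r3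

/-- Stability in the core when the core workers are matched to core firms or unmatched. -/
structure CoreStable (s : Fin 2) (X Y Z : CoreRanks) (p : CorePattern) : Prop extends
    WeakCoreStable s X Y Z p False False False where
  cx : p.v1 ≠ 0 → p.v2 ≠ 0 → p.v3 ≠ 0 → p.hx = X.r0
  cy : p.v1 ≠ 1 → p.v2 ≠ 1 → p.v3 ≠ 1 → p.hy = Y.r0
  cz : p.v1 ≠ 2 → p.v2 ≠ 2 → p.v3 ≠ 2 → p.hz = Z.r0

/-- Core stability after a deviation, relative to the pattern `q` before the deviation. -/
abbrev DevStable (s : Fin 2) (X Y Z : CoreRanks) (q p : CorePattern) : Prop :=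
  WeakCoreStable s X Y Z p (q.v1 = 2 ∨ q.v1 = 0) (q.v2 = 0) (q.v2 = 0 ∨ q.v2 = 1)

/-- The ranks in the report `[f₁, f₂]`. -/
abbrev ranks12 : CoreRanks := ⟨0, 1, 3, 2⟩

/-- The ranks in the report `[f₃, f₂]`. -/
abbrev ranks32 : CoreRanks := ⟨3, 1, 0, 2⟩

/-- How good a core firm worker `x` gets. -/
def levelX (p : CorePattern) : ℕ :=
  if p.v1 = 0 then 3 else if p.v2 = 0 then 2 else if p.v3 = 0 then 1 else 0

/-- How good a core firm worker `y` gets; the first two core firms are not distinguished. -/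
def levelY (p : CorePattern) : ℕ :=
  if p.v3 = 1 then 2 else if p.v1 = 1 then 1 else if p.v2 = 1 then 1 else 0

/-- How good a core firm worker `z` gets. -/
def levelZ (p : CorePattern) : ℕ :=
  if p.v3 = 2 then 3 else if p.v1 = 2 then 2 else if p.v2 = 2 then 1 else 0

theorem levelX_spec (p : CorePattern) : (p.v1 = 0 ∧ levelX p = 3) ∨
    (p.v1 ≠ 0 ∧ p.v2 = 0 ∧ levelX p = 2) ∨ (p.v1 ≠ 0 ∧ p.v2 ≠ 0 ∧ p.v3 = 0 ∧ levelX p = 1) ∨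
      (p.v1 ≠ 0 ∧ p.v2 ≠ 0 ∧ p.v3 ≠ 0 ∧ levelX p = 0) := by
  unfold levelX
  split_ifs <;> simp_all

theorem levelY_spec (p : CorePattern) : (p.v3 = 1 ∧ levelY p = 2) ∨
    (p.v3 ≠ 1 ∧ (p.v1 = 1 ∨ p.v2 = 1) ∧ levelY p = 1) ∨
      (p.v1 ≠ 1 ∧ p.v2 ≠ 1 ∧ p.v3 ≠ 1 ∧ levelY p = 0) := by
  unfold levelY
  split_ifs <;> simp_all

theorem levelZ_spec (p : CorePattern) : (p.v3 = 2 ∧ levelZ p = 3) ∨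
    (p.v3 ≠ 2 ∧ p.v1 = 2 ∧ levelZ p = 2) ∨ (p.v3 ≠ 2 ∧ p.v1 ≠ 2 ∧ p.v2 = 2 ∧ levelZ p = 1) ∨
      (p.v1 ≠ 2 ∧ p.v2 ≠ 2 ∧ p.v3 ≠ 2 ∧ levelZ p = 0) := by
  unfold levelZ
  split_ifs <;> simp_all

/-! ### Core outcomes compatible with three deviations -/

section Characterization

variable {X Y Z : CoreRanks} {A B xA xB yA yB zA zB : CorePattern} {s : Fin 2}

/-- Firm `f2` likes `x` best in the core and `f1` likes only `z` better, so with the report [f1, f2]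
worker `x` misses `f1` only when `f1` sits at `z`, and then gets `f2`. -/
theorem dev_x {p q : CorePattern} (h : DevStable s ranks12 Y Z q p)
    (hc : p.v1 ≠ 0 → p.v2 ≠ 0 → p.v3 ≠ 0 → p.hx = 2) :
    p.v1 = 0 ∨ p.v1 = 2 ∧ p.v2 = 0 := by
  have h1 := h.x1
  have h2 := h.x2
  have h3 := h.x3
  have h4 := h.b1x
  have h5 := h.b2x
  dsimp only at *
  omega

/-- In state 1 `f3` prefers only `x` to `z` within the core, so listing `f3` first secures it unless
it goes to `x`. State 0 is the same with `y` in place of `z`. -/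
theorem dev_z {p q : CorePattern} (h : DevStable 1 X Y ranks32 q p)
    (hc : p.v1 ≠ 2 → p.v2 ≠ 2 → p.v3 ≠ 2 → p.hz = 2) : p.v3 = 0 ∨ p.v3 = 2 := by
  have h1 := h.z1
  have h2 := h.z2
  have h3 := h.z3
  have h4 := h.b3z
  have h5 : ¬ ((1 : Fin 2) = 0) := by decide
  dsimp only at *
  omega

theorem dev_y {p q : CorePattern} (h : DevStable 0 X ranks32 Z q p)
    (hc : p.v1 ≠ 1 → p.v2 ≠ 1 → p.v3 ≠ 1 → p.hy = 2) : p.v3 = 0 ∨ p.v3 = 1 := by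
  have h1 := h.y1
  have h2 := h.y2
  have h3 := h.y3
  have h4 := h.b3y
  have h5 : ¬ ((0 : Fin 2) = 1) := by decide
  dsimp only at *
  omega

/-- After the deviation `z` refuses `f1`, so both `f1` and `f2` compete for `x`. If `x` does not
rank `f3` first among the core firms, then `f3` cannot win. -/
theorem zB_eq (vX : X.Valid) (hT : ¬ (X.r3 < X.r0 ∧ X.r3 ≤ X.r1 ∧ X.r3 ≤ X.r2))
    (hzB : DevStable 1 X Y ranks32 B zB) (dzB : zB.v3 = 0 ∨ zB.v3 = 2) : zB.v3 = 2 := by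
  rcases dzB with h | h
  · exfalso
    have a1 := hzB.x3 h; have a2 := hzB.irx; have a3 := hzB.b1x; have a4 := hzB.b2x
    have a5 := vX.n3; have a6 := hzB.z1; have a7 := hzB.irz
    dsimp only at a6 a7
    omega
  · exact h

/-- The deviation does not cost `z` firm `f3` in state 0. If `f3` now went to `y`, then `y` would
previously have held `f1` or `f2` above `f3`, and that firm must have moved up to `x`. But `x` had
refused it in favour of the other of the two, which still wants `x`. -/
theorem zA_eq (vX : X.Valid) (vY : Y.Valid)
    (hT : ¬ (X.r3 < X.r0 ∧ X.r3 ≤ X.r1 ∧ X.r3 ≤ X.r2)) (hA : CoreStable 0 X Y Z A)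
    (hzA : DevStable 0 X Y ranks32 A zA)
    (czA : zA.v1 ≠ 2 → zA.v2 ≠ 2 → zA.v3 ≠ 2 → zA.hz = 2) (h : A.v3 = 2) : zA.v3 = 2 := by
  by_contra hne
  have b1 := hzA.z1; have b2 := hzA.irz; have b3 := hzA.b3z; have b4 := hzA.z2
  dsimp only at b1 b2 b3 b4
  have w1 : zA.v1 ≠ 2 := by omega
  have w2 : zA.v3 = 0 ∨ zA.v3 = 1 := by omega
  clear b1 b2 b3 b4 czA
  rcases w2 with w2 | w2
  · have a1 := hzA.x3 w2; have a2 := hzA.irx; have a3 := hzA.b1x; have a4 := hzA.b2x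
    have a5 := vX.n3
    omega
  · have e1 := hzA.y3 w2
    have e2 := hzA.iry
    have e3 := hA.b3y
    have e4 : ¬ ((0 : Fin 2) = 1 ∧ A.v3 = 2) := by simp
    have hAy : A.v1 = 1 ∨ A.v2 = 1 := by
      have := hA.cy; have := vY.n3
      omega
    rcases hAy with hy | hy
    · have f1 := hA.y1 hy
      have f2 := hzA.b1y
      have f3 := vY.n13
      have g1 : zA.v1 = 0 := by omega
      clear f1 f2 f3 e1 e2 e3 e4
      have := hzA.x1 g1; have := hA.b1x; have := hA.cx; have := hA.x2; have := hzA.b2x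
      have := hzA.irx; have := vX.n1; have := vX.n12
      omega
    · have f1 := hA.y2 hy
      have f2 := hzA.b2y
      have f3 := vY.n23
      have g1 : zA.v2 = 0 := by omega
      clear f1 f2 f3 e1 e2 e3 e4
      have := hzA.x2 g1; have := hA.b2x; have := hA.cx; have := hA.x1; have := hzA.b1x
      have := hzA.irx; have := vX.n2; have := vX.n12
      omega

/-- In state `1` worker `z` does not prefer `f₁` to `f₃`, so the first two core firms cannot take
`z` and `x`. -/
theorem not_z_and_x (vZ : Z.Valid) (hB : CoreStable 1 X Y Z B) (B3 : B.v3 = 2) {X' Y' : CoreRanks}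
    {p : CorePattern} (hp : DevStable 1 X' Y' Z B p) (h1 : p.v1 = 2) (h2 : p.v2 = 0) : False := by
  have := hB.b1z; have := hB.z3 B3; have := hB.irz; have := vZ.n13
  have := hp.z1 h1; have := hp.b3z; have := hp.d23
  have : ¬ ((1 : Fin 2) = 0) := by decide
  omega

/-- If the deviation of `y` moves `f3` to `x`, then `x` must rank `f1` above `f3`, so `f1` has gone
to `z`. Before it, `x` must have held `f1`. Firm `f2` is left with `y`, who now lists it second. -/
theorem yA_eq (vX : X.Valid) (vZ : Z.Valid)
    (hT : ¬ (X.r3 < X.r0 ∧ X.r3 ≤ X.r1 ∧ X.r3 ≤ X.r2)) (hA : CoreStable 0 X Y Z A)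
    (hyA : DevStable 0 X ranks32 Z A yA)
    (cyA : yA.v1 ≠ 1 → yA.v2 ≠ 1 → yA.v3 ≠ 1 → yA.hy = 2) (hne : A.v3 ≠ 0)
    (y3 : yA.v3 = 0) :
    yA.v2 = 1 ∧ A.v1 = 0 ∧ X.r1 < X.r3 ∧ X.r3 < X.r0 ∧ X.r3 ≤ X.r2 ∧ Z.r1 < Z.r0 := by
  have e1 := hyA.x3 y3
  have e2 := hyA.irx
  have e3 := hyA.b2x
  have e4 := vX.n3
  have e5 : X.r1 < X.r3 := by omega
  have e6 : yA.v1 = 2 := by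
    have := hyA.b1x
    omega
  have e7 : Z.r1 < Z.r0 := by
    have := hyA.z1 e6; have := hyA.irz; have := vZ.n1
    omega
  have a1 : A.v1 = 0 := by
    have := hA.b3x; have := hA.b1x; have := hA.x2; have := hA.cx; have := vX.n23
    omega
  refine ⟨?_, a1, e5, by omega, by omega, e7⟩
  have f1 := hyA.b2y; have f2 := hA.d12; have f3 := hyA.d23; have f4 := hyA.y1; have f5 := hyA.y3
  dsimp only at f1 f4 f5
  omega

/-- Otherwise the deviation of `y` moves `f3` to `x` and gives `y` firm `f2` in state 0. If `y`
lists `f2` or already has it there, the swap argument puts `f3` at `x` in the equilibrium itself. If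
not, `y` is unmatched in both states and gains from the deviation. -/
theorem f3_matched (vX : X.Valid) (vY : Y.Valid) (vZ : Z.Valid)
    (hT : ¬ (X.r3 < X.r0 ∧ X.r3 ≤ X.r1 ∧ X.r3 ≤ X.r2))
    (hA : CoreStable 0 X Y Z A) (hB : CoreStable 1 X Y Z B)
    (hyA : DevStable 0 X ranks32 Z A yA)
    (cyA : yA.v1 ≠ 1 → yA.v2 ≠ 1 → yA.v3 ≠ 1 → yA.hy = 2)
    (countY : levelY yA = 2 → levelY A = 2 ∨ levelY B = 2)
    (zeroY : levelY A = 0 → levelY B = 0 → levelY yA = 0)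
    (swap : A.v2 ≠ 0 → X.r3 ≤ X.r0 → X.r3 ≤ X.r2 → Z.r1 ≤ Z.r0 →
      (Y.r2 ≤ Y.r0 ∨ A.v2 = 3 ∧ Z.r1 ≤ Z.r2) → A.v3 = 0)
    (dyA : yA.v3 = 0 ∨ yA.v3 = 1) (B3 : B.v3 = 2) : A.v3 = 0 ∨ A.v3 = 1 := by
  by_contra hne
  have lyA := levelY_spec A; have lyB := levelY_spec B
  have lyA' := levelY_spec yA
  generalize levelY A = ly0 at *; generalize levelY B = ly1 at *
  generalize levelY yA = ly2 at *
  have y3 : yA.v3 = 0 := by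
    clear zeroY swap
    omega
  clear countY dyA
  obtain ⟨e8, a1, e5, e6, e6', e7⟩ := yA_eq vX vZ hT hA hyA cyA (by omega) y3
  have b1 : B.v1 = 0 := by
    have := hB.b1x; have := hB.d13; have := hB.x2; have := hB.cx
    clear lyA lyB lyA' zeroY swap
    omega
  have a2 : A.v2 ≠ 0 := by
    have := hA.d12
    clear lyA lyB lyA' zeroY swap
    omega
  have e9 : A.v2 ≠ 1 := by
    intro h
    have h2 := hA.y2 h; have h3 := hA.iry
    have := swap a2 e6.le e6' e7.le (Or.inl (by omega))
    omega
  clear swap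
  have e10 : Y.r0 < Y.r2 := by
    have := hA.cy; have := vY.n2
    have := (hA.b2y.resolve_left a2).resolve_right not_false
    clear lyA lyB lyA' zeroY
    omega
  have e11 : B.v2 ≠ 1 := by
    intro h
    have := hB.y2 h; have := hB.iry
    clear lyA lyB lyA' zeroY
    omega
  omega

/-- With `f3` at `x` in state 0, worker `x` already has `f1` in state 1; the deviation keeps that
and yields at least `f2` in state 0. -/
theorem f3_not_x (vX : X.Valid) (hT : ¬ (X.r3 < X.r0 ∧ X.r3 ≤ X.r1 ∧ X.r3 ≤ X.r2))
    (hA : CoreStable 0 X Y Z A) (hB : CoreStable 1 X Y Z B)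
    (paretoX : levelX A ≤ levelX xA → levelX B ≤ levelX xB →
      levelX xA = levelX A ∧ levelX xB = levelX B)
    (dxA : xA.v1 = 0 ∨ xA.v1 = 2 ∧ xA.v2 = 0) (dxB : xB.v1 = 0) (B3 : B.v3 = 2) :
    A.v3 ≠ 0 := by
  intro h
  have e0 := hA.x3 h
  have e1 := hA.irx
  have e2 := hA.b2x
  have e3 := vX.n3
  have e5 : X.r1 < X.r3 := by omega
  have b1 : B.v1 = 0 := by
    have := hB.b1x; have := hB.x2; have := hB.cx; have := hB.d13
    omega
  have e6 := hA.d23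
  have e7 : A.v1 = 2 := by
    have := hA.b1x
    omega
  have lxA := levelX_spec A; have lxB := levelX_spec B
  have lxA' := levelX_spec xA; have lxB' := levelX_spec xB
  clear hT
  omega

/-- If not, `x` has `f2` in both states or no core firm in either, and the report [f1, f2] secures
`f1` in state 1 and at least `f2` in state 0. -/
theorem f1_x_B (vX : X.Valid) (hA : CoreStable 0 X Y Z A) (hB : CoreStable 1 X Y Z B)
    (paretoX : levelX A ≤ levelX xA → levelX B ≤ levelX xB →
      levelX xA = levelX A ∧ levelX xB = levelX B)
    (dxA : xA.v1 = 0 ∨ xA.v1 = 2 ∧ xA.v2 = 0) (dxB : xB.v1 = 0) (B3 : B.v3 = 2)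
    (A3 : A.v3 = 1) : B.v1 = 0 := by
  by_contra hne
  have lxA := levelX_spec A; have lxB := levelX_spec B
  have lxA' := levelX_spec xA; have lxB' := levelX_spec xB
  have e1 : B.hx ≤ X.r1 := by
    have := hB.b1x; have := hB.d13
    clear lxA lxB lxA' lxB' paretoX
    omega
  have e2 := hB.b2x
  have e3 := hB.b3x
  by_cases h2 : B.v2 = 0
  · have a2 : A.v2 = 0 := by
      have := hB.x2 h2; have := hB.irx; have := vX.n2; have := vX.n12
      have := hA.b2x; have := hA.x1; have := hA.cx
      clear lxA lxB lxA' lxB' paretoX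
      omega
    have := hA.d12
    clear e1 e2 e3
    omega
  · have e4 : A.v1 ≠ 0 ∧ A.v2 ≠ 0 := by
      have := hB.cx hne h2 (by omega); have := hA.irx; have := hA.x1; have := hA.x2
      have := vX.n1; have := vX.n2
      clear lxA lxB lxA' lxB' paretoX
      omega
    clear e1 e2 e3
    omega

/-- Since `x` reports `f1` above `f2`, firm `f2` at `x` forces `f1` to `z`. If `f1` is at `x`, then
leaving `f2` unmatched would leave `z` unmatched too, and [f3, f2] would win `f2` for `z` without
losing `f3` in state 1. If neither firm is at `x`, then `x` itself gains. -/
theorem core_A (vX : X.Valid) (hA : CoreStable 0 X Y Z A) (hB : CoreStable 1 X Y Z B)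
    (hzA : DevStable 0 X Y ranks32 A zA)
    (czA : zA.v1 ≠ 2 → zA.v2 ≠ 2 → zA.v3 ≠ 2 → zA.hz = 2)
    (paretoX : levelX A ≤ levelX xA → levelX B ≤ levelX xB →
      levelX xA = levelX A ∧ levelX xB = levelX B)
    (paretoZ : levelZ B = 3 → levelZ zB = 3 → levelZ A = 0 → levelZ zA = 0)
    (dxA : xA.v1 = 0 ∨ xA.v1 = 2 ∧ xA.v2 = 0) (dxB : xB.v1 = 0) (B3 : B.v3 = 2)
    (A3 : A.v3 = 1) (B1 : B.v1 = 0) (zB3 : zB.v3 = 2) :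
    (A.v1 = 2 ∧ A.v2 = 0) ∨ (A.v1 = 0 ∧ A.v2 = 2) := by
  have xr1 := hB.x1 B1
  have xr2 := hB.b2x
  have xr3 := hB.irx
  have n12 := vX.n12
  have a12 := hA.d12
  have a23 := hA.d23
  have a13 := hA.d13
  have le1 := hA.le1
  have le2 := hA.le2
  have b1x := hA.b1x
  by_cases a2 : A.v2 = 0
  · have := hA.x2 a2
    omega
  · by_cases a1 : A.v1 = 0
    · by_contra hne
      have a3 : A.v2 = 3 := by omega
      have f1 := hA.x1 a1
      have f2 := hA.b3x
      have f3 := vX.n13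
      have z0 : zA.v1 ≠ 2 ∧ zA.v2 ≠ 2 ∧ zA.v3 ≠ 2 := by
        have lzA := levelZ_spec A; have lzB := levelZ_spec B
        have lzA' := levelZ_spec zA; have lzB' := levelZ_spec zB
        clear paretoX xr1 xr2 xr3 n12 a12 a23 a13 b1x f2 f3
        omega
      have z1 := czA z0.1 z0.2.1 z0.2.2
      have g1 := hzA.b3z; have g2 := hzA.b2z; have g3 := hzA.b1x; have g4 := hzA.x2
      have g5 := hzA.x3; have g6 := hzA.d23
      dsimp only at g1 g2
      clear a12 a23 a13 b1x paretoX paretoZ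
      omega
    · have f1 := hA.cx a1 a2 (by omega)
      have f2 := vX.n1
      have f3 : A.v1 = 2 := by omega
      have lxA := levelX_spec A; have lxB := levelX_spec B
      have lxA' := levelX_spec xA; have lxB' := levelX_spec xB
      clear paretoZ xr1 xr2 xr3 n12 a12 a23 a13 b1x f1 f2
      omega

/-- Otherwise `y` is unmatched in state 1 while `f2` cannot get `x` there; the report [f3, f2] then
wins `f2` in state 1 and keeps `f3` in state 0, since `x` holds `f2` above `f3`. -/
theorem f2_y_B (vX : X.Valid) (vZ : Z.Valid) (hA : CoreStable 0 X Y Z A)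
    (hB : CoreStable 1 X Y Z B)
    (hyA : DevStable 0 X ranks32 Z A yA) (hyB : DevStable 1 X ranks32 Z B yB)
    (cyB : yB.v1 ≠ 1 → yB.v2 ≠ 1 → yB.v3 ≠ 1 → yB.hy = 2)
    (paretoY : levelY A = 2 → levelY yA = 2 → levelY B = 0 → levelY yB = 0)
    (dyA : yA.v3 = 0 ∨ yA.v3 = 1) (B3 : B.v3 = 2)
    (A3 : A.v3 = 1) (B1 : B.v1 = 0) (A2 : A.v2 = 0) : B.v2 = 1 := by
  by_contra hne
  have xr1 := hB.x1 B1
  have xr2 := hB.b2x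
  have xr3 := hB.irx
  have n12 := vX.n12
  have y3 : yA.v3 = 1 := by
    rcases dyA with h | h
    · exfalso
      have := hyA.x3 h; have := hyA.b2x; have := hA.x2 A2; have := hA.b3x; have := vX.n23
      have := hA.irx
      omega
    · exact h
  have hb2 : B.v2 ≠ 0 := by
    have := hB.d12
    omega
  have b2 : yB.v2 ≠ 0 := by
    intro h
    have := hyB.b1x; have := hyB.x2 h
    by_cases h1 : yB.v1 = 2
    · exact not_z_and_x vZ hB B3 hyB h1 h
    · omega
  have zero : levelY yB = 0 := by
    refine paretoY ?_ ?_ ?_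
    · simp [levelY, A3]
    · simp [levelY, y3]
    · simp [levelY, B3, B1, hne]
  have l := levelY_spec yB
  have f1 := hyB.b2y
  have f2 := cyB
  dsimp only at f1
  clear paretoY
  omega

/-- The only possible core outcomes, given that none of the listed deviations is profitable. -/
theorem core_characterization (vX : X.Valid) (vY : Y.Valid) (vZ : Z.Valid)
    (hA : CoreStable 0 X Y Z A) (hB : CoreStable 1 X Y Z B)
    (hxA : DevStable 0 ranks12 Y Z A xA) (hxB : DevStable 1 ranks12 Y Z B xB)
    (hyA : DevStable 0 X ranks32 Z A yA) (hyB : DevStable 1 X ranks32 Z B yB)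
    (hzA : DevStable 0 X Y ranks32 A zA) (hzB : DevStable 1 X Y ranks32 B zB)
    (cxA : xA.v1 ≠ 0 → xA.v2 ≠ 0 → xA.v3 ≠ 0 → xA.hx = 2)
    (cxB : xB.v1 ≠ 0 → xB.v2 ≠ 0 → xB.v3 ≠ 0 → xB.hx = 2)
    (cyA : yA.v1 ≠ 1 → yA.v2 ≠ 1 → yA.v3 ≠ 1 → yA.hy = 2)
    (cyB : yB.v1 ≠ 1 → yB.v2 ≠ 1 → yB.v3 ≠ 1 → yB.hy = 2)
    (czA : zA.v1 ≠ 2 → zA.v2 ≠ 2 → zA.v3 ≠ 2 → zA.hz = 2)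
    (czB : zB.v1 ≠ 2 → zB.v2 ≠ 2 → zB.v3 ≠ 2 → zB.hz = 2)
    (paretoX : levelX A ≤ levelX xA → levelX B ≤ levelX xB →
      levelX xA = levelX A ∧ levelX xB = levelX B)
    (countY : levelY yA = 2 → levelY A = 2 ∨ levelY B = 2)
    (paretoY : levelY A = 2 → levelY yA = 2 → levelY B = 0 → levelY yB = 0)
    (zeroY : levelY A = 0 → levelY B = 0 → levelY yA = 0)
    (countZ : levelZ zB = 3 → levelZ A = 3 ∨ levelZ B = 3)
    (countZ2 : levelZ zA = 3 → levelZ zB = 3 → levelZ A = 3 ∧ levelZ B = 3)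
    (paretoZ : levelZ B = 3 → levelZ zB = 3 → levelZ A = 0 → levelZ zA = 0)
    (swap : A.v2 ≠ 0 → X.r3 ≤ X.r0 → X.r3 ≤ X.r2 → Z.r1 ≤ Z.r0 →
      (Y.r2 ≤ Y.r0 ∨ A.v2 = 3 ∧ Z.r1 ≤ Z.r2) → A.v3 = 0) :
    (B.v1 = 0 ∧ B.v3 = 2) ∧
      ((A.v1 = 2 ∧ A.v2 = 0 ∧ A.v3 = 1 ∧ B.v2 = 1) ∨
        (A.v1 = 0 ∧ A.v2 = 2 ∧ A.v3 = 1 ∧ (B.v2 = 1 ∨ B.v2 = 3))) := by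
  have dxA := dev_x hxA cxA
  have dyA := dev_y hyA cyA
  -- If `x` ranked `f3` first among the core firms, it would have `f3`, its worst core firm, in both
  -- states, and [f1, f2] would improve both.
  have hT : ¬ (X.r3 < X.r0 ∧ X.r3 ≤ X.r1 ∧ X.r3 ≤ X.r2) := by
    rintro ⟨t0, t1, t2⟩
    have a1 : A.v3 = 0 := by
      have := hA.b3x; have := hA.x1; have := hA.x2; have := hA.cx; have := vX.n13; have := vX.n23
      clear countY paretoY zeroY countZ countZ2 paretoZ swap paretoX
      omega
    have b1 : B.v3 = 0 := by
      have := hB.b3x; have := hB.x1; have := hB.x2; have := hB.cx; have := vX.n13; have := vX.n23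
      clear countY paretoY zeroY countZ countZ2 paretoZ swap paretoX
      omega
    have dxB := dev_x hxB cxB
    have := hA.d13; have := hA.d23; have := hB.d13; have := hB.d23
    have lxA := levelX_spec A; have lxB := levelX_spec B
    have lxA' := levelX_spec xA; have lxB' := levelX_spec xB
    clear countY paretoY zeroY countZ countZ2 paretoZ swap
    omega
  have zB3 := zB_eq vX hT hzB (dev_z hzB czB)
  have lz : levelZ zB = 3 := by simp [levelZ, zB3]
  have spec : ∀ p, levelZ p = 3 → p.v3 = 2 := by
    intro p hp
    have := levelZ_spec p
    omega
  -- The deviation gives `z` firm `f3` in state 1, worth more than equilibrium play without `f3` in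
  -- either state. If `z` had it in state 0 only, the deviation would yield it in both states.
  have B3 : B.v3 = 2 := by
    by_cases h : A.v3 = 2
    · have := zA_eq vX vY hT hA hzA czA h
      exact spec B (countZ2 (by simp [levelZ, this]) lz).2
    · exact spec B ((countZ lz).resolve_left fun hc => h (spec A hc))
  have dxB : xB.v1 = 0 := by
    rcases dev_x hxB cxB with h | h
    · exact h
    · exact (not_z_and_x vZ hB B3 hxB h.1 h.2).elim
  have A3 := (f3_matched vX vY vZ hT hA hB hyA cyA countY zeroY swap dyA B3).resolve_left
    (f3_not_x vX hT hA hB paretoX dxA dxB B3)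
  have B1 := f1_x_B vX hA hB paretoX dxA dxB B3 A3
  refine ⟨⟨B1, B3⟩, ?_⟩
  rcases core_A vX hA hB hzA czA paretoX paretoZ dxA dxB B3 A3 B1 zB3 with ⟨a1, a2⟩ | ⟨a1, a2⟩
  · exact Or.inl ⟨a1, a2, A3, f2_y_B vX vZ hA hB hyA hyB cyB paretoY dyA B3 A3 B1 a2⟩
  · refine Or.inr ⟨a1, a2, A3, ?_⟩
    have h1 := hB.d12; have h2 := hB.d23; have h3 := hB.le2
    clear countY paretoY zeroY countZ countZ2 paretoZ swap paretoX
    omega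

end Characterization
/-! ### Markets made of a sequence of top pairs and a core of three firms and three workers -/

/-- A sequence of pairs `(a i, b i)` together with three core firms and three core workers. -/
structure CoreAgents (A B : Type*) where
  k : ℕ
  a : Fin k → A
  b : Fin k → B
  f1 : A
  f2 : A
  f3 : A
  x : B
  y : B
  z : B

/-- The named agents are distinct and exhaust the market. -/
structure CoreAgents.Proper {A B : Type*} (c : CoreAgents A B) : Prop where
  firm_cases : ∀ f, (∃ i, f = c.a i) ∨ f = c.f1 ∨ f = c.f2 ∨ f = c.f3
  worker_cases : ∀ w, (∃ i, w = c.b i) ∨ w = c.x ∨ w = c.y ∨ w = c.z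
  a_inj : Function.Injective c.a
  b_inj : Function.Injective c.b
  a_f1 : ∀ i, c.a i ≠ c.f1
  a_f2 : ∀ i, c.a i ≠ c.f2
  a_f3 : ∀ i, c.a i ≠ c.f3
  b_x : ∀ i, c.b i ≠ c.x
  b_y : ∀ i, c.b i ≠ c.y
  b_z : ∀ i, c.b i ≠ c.z
  f12 : c.f1 ≠ c.f2
  f13 : c.f1 ≠ c.f3
  f23 : c.f2 ≠ c.f3
  xy : c.x ≠ c.y
  xz : c.x ≠ c.z
  yz : c.y ≠ c.z

/-- Firms' utilities in state `s`. -/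
structure CoreAgents.FirmUtil {A B : Type*} (c : CoreAgents A B) (s : Fin 2) (u : A → B → ℝ) :
    Prop where
  pos : ∀ f w, 0 < u f w
  inj : ∀ f, Function.Injective (u f)
  top : ∀ i w, w ≠ c.b i → (∀ j < i, w ≠ c.b j) → u (c.a i) w < u (c.a i) (c.b i)
  f1_xz : u c.f1 c.x < u c.f1 c.z
  f1_yx : u c.f1 c.y < u c.f1 c.x
  f1_adj : ∀ i, u c.f1 c.x < u c.f1 (c.b i) → u c.f1 c.z < u c.f1 (c.b i)
  f2_yx : u c.f2 c.y < u c.f2 c.x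
  f2_zy : u c.f2 c.z < u c.f2 c.y
  f3_x : ∀ i, u c.f3 (c.b i) < u c.f3 c.x
  f3_y : ∀ i, u c.f3 (c.b i) < u c.f3 c.y
  f3_z : ∀ i, u c.f3 (c.b i) < u c.f3 c.z
  f3_yx : u c.f3 c.y < u c.f3 c.x
  f3_zx : u c.f3 c.z < u c.f3 c.x
  f3_zy : s = 0 → u c.f3 c.z < u c.f3 c.y
  f3_yz : s = 1 → u c.f3 c.y < u c.f3 c.z

/-- Workers' utilities. -/
structure CoreAgents.WorkerUtil {A B : Type*} (c : CoreAgents A B) (v : B → A → ℝ) : Prop where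
  pos : ∀ w f, 0 < v w f
  inj : ∀ w, Function.Injective (v w)
  top : ∀ i f, f ≠ c.a i → (∀ j < i, f ≠ c.a j) → v (c.b i) f < v (c.b i) (c.a i)
  x12 : v c.x c.f2 < v c.x c.f1
  x23 : v c.x c.f3 < v c.x c.f2
  y_max : ∀ f, f ≠ c.f3 → v c.y f < v c.y c.f3
  y1 : 2 * v c.y c.f1 < v c.y c.f3
  y2 : 2 * v c.y c.f2 < v c.y c.f3
  z_max : ∀ f, f ≠ c.f3 → v c.z f < v c.z c.f3
  z12 : v c.z c.f2 < v c.z c.f1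
  z1 : 2 * v c.z c.f1 < v c.z c.f3

/-- Stability with respect to the firms' utilities and the workers' reports. -/
structure FirmStable {A B : Type*} [DecidableEq A] (u : A → B → ℝ) (Q : B → Report A)
    (m : A ≃. B) : Prop where
  ir : ∀ w, (Q w).rank (m.symm w) ≤ (Q w).rank none
  noblock : ∀ f w, value (u f) (m f) < u f w → (Q w).rank (m.symm w) ≤ (Q w).rank (some f)

section

variable {A B : Type*} [DecidableEq A] [DecidableEq B]

theorem StableWrt.firmStable {P : A → Report B} {Q : B → Report A} {m : A ≃. B} {u : A → B → ℝ}
    (h : StableWrt (fun f => (P f).Prefers) (fun w => (Q w).Prefers) m)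
    (hu : ∀ f, Function.Injective (u f)) (hpos : ∀ f w, 0 < u f w)
    (hP : ∀ f, (P f).IsTruthful (u f)) : FirmStable u Q m where
  ir w := not_lt.1 (h.2.1 w)
  noblock f w hlt := not_lt.1 fun hc => h.2.2 f w
    ⟨((hP f).prefers_some_iff (hu f) (hpos f w)).2 hlt, hc⟩

theorem FirmStable.mem {u : A → B → ℝ} {Q : B → Report A} {m : A ≃. B} (h : FirmStable u Q m)
    {f : A} {w : B} (hf : m f = some w) : f ∈ (Q w).1 := by
  have h1 := h.ir w
  rw [m.eq_some_iff.2 hf] at h1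
  exact Report.mem_of_not_prefers (not_lt.2 h1)

namespace CoreAgents

variable {c : CoreAgents A B} {s : Fin 2} {u : A → B → ℝ} {Q Q' : B → Report A} {m m' : A ≃. B}

/-- If the top pairs up to `n` are matched in `m` and those workers' reports are the same in `m'`,
then no firm gains from being matched to one of them in `m'`. -/
theorem no_gain (hu : c.FirmUtil s u) (hm : FirmStable u Q m) (hm' : FirmStable u Q' m') {n : ℕ}
    (htop : ∀ j : Fin c.k, (j : ℕ) < n → m (c.a j) = some (c.b j))
    (hQ : ∀ j : Fin c.k, (j : ℕ) < n → Q' (c.b j) = Q (c.b j)) (j : Fin c.k) (hj : (j : ℕ) < n)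
    (f : A) (hf : f ≠ c.a j) (hf' : m' f = some (c.b j)) :
    u f (c.b j) < value (u f) (m f) := by
  induction j using WellFoundedLT.induction generalizing f with
  | ind j ih =>
  by_contra hle
  have hmj := m.eq_some_iff.2 (htop j hj)
  have hne : m f ≠ some (c.b j) := by
    intro hc
    rw [m.eq_some_iff.2 hc] at hmj
    exact hf (Option.some.inj hmj)
  have hlt : value (u f) (m f) < u f (c.b j) := by
    refine lt_of_le_of_ne (not_lt.1 hle) ?_
    cases hmf : m f with
    | none => exact (hu.pos _ _).ne
    | some w => exact fun he => hne (by rw [hmf, hu.inj f he])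
  -- Worker `b j` reports `a j` above `f`, yet takes `f` in `m'`; so `a j` must have something at
  -- least as good, which can only be an earlier `b l`. The induction hypothesis says that this is a
  -- loss for `a j`.
  have h1 := hm.noblock f (c.b j) hlt
  rw [hmj, ← hQ j hj] at h1
  have h2 : (Q' (c.b j)).rank (some (c.a j)) < (Q' (c.b j)).rank (some f) := by
    refine lt_of_le_of_ne h1 fun he => hf ?_
    exact Report.rank_inj (hm'.mem hf') he.symm
  have h3 : ¬ value (u (c.a j)) (m' (c.a j)) < u (c.a j) (c.b j) := by
    intro hc
    have := hm'.noblock _ _ hc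
    rw [m'.eq_some_iff.2 hf'] at this
    omega
  cases hmj' : m' (c.a j) with
  | none =>
    rw [hmj'] at h3
    exact h3 (hu.pos _ _)
  | some w =>
    rw [hmj'] at h3
    have hw : w ≠ c.b j := by
      rintro rfl
      have e1 := m'.eq_some_iff.2 hmj'
      rw [m'.eq_some_iff.2 hf'] at e1
      exact hf (Option.some.inj e1)
    have hex : ∃ l < j, w = c.b l := by
      by_contra hno
      push Not at hno
      exact h3 (hu.top j w hw hno)
    obtain ⟨l, hl, rfl⟩ := hex
    have hal : c.a j ≠ c.a l := by
      intro he
      have e1 := htop l (lt_trans hl hj)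
      rw [← he, htop j hj] at e1
      exact hw (Option.some.inj e1).symm
    have := ih l hl (lt_trans hl hj) (c.a j) hal hmj'
    rw [htop j hj] at this
    exact h3 this

/-- The code of an assignment: `0, 1, 2` for the core workers and `3` for anything else. -/
def code (c : CoreAgents A B) (o : Option B) : ℕ :=
  if o = some c.x then 0 else if o = some c.y then 1 else if o = some c.z then 2 else 3

theorem code_le (o : Option B) : c.code o ≤ 3 := by
  unfold code; split_ifs <;> omega

theorem code_x : c.code (some c.x) = 0 := by simp [code]

theorem code_y (hc : c.Proper) : c.code (some c.y) = 1 := by simp [code, hc.xy.symm]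

theorem code_z (hc : c.Proper) : c.code (some c.z) = 2 := by
  simp [code, hc.xz.symm, hc.yz.symm]

theorem code_eq_zero {o : Option B} : c.code o = 0 ↔ o = some c.x := by
  unfold code; split_ifs <;> simp_all

theorem code_eq_one (hc : c.Proper) {o : Option B} : c.code o = 1 ↔ o = some c.y := by
  refine ⟨fun h => ?_, fun h => h ▸ code_y hc⟩
  unfold code at h; split_ifs at h <;> simp_all

theorem code_eq_two (hc : c.Proper) {o : Option B} : c.code o = 2 ↔ o = some c.z := by
  refine ⟨fun h => ?_, fun h => h ▸ code_z hc⟩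
  unfold code at h; split_ifs at h <;> simp_all

theorem code_inj (hc : c.Proper) {f g : A} (hfg : f ≠ g) (h : c.code (m f) = c.code (m g)) :
    c.code (m f) = 3 := by
  have key : ∀ w, m f = some w → m g = some w → False := by
    intro w h1 h2
    have := m.eq_some_iff.2 h1
    rw [m.eq_some_iff.2 h2] at this
    exact hfg (Option.some.inj this).symm
  have h0 : c.code (m f) ≠ 0 := fun h0 => key _ (code_eq_zero.1 h0) (code_eq_zero.1 (h ▸ h0))
  have h1 : c.code (m f) ≠ 1 := fun h1 =>
    key _ ((code_eq_one hc).1 h1) ((code_eq_one hc).1 (h ▸ h1))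
  have h2 : c.code (m f) ≠ 2 := fun h2 =>
    key _ ((code_eq_two hc).1 h2) ((code_eq_two hc).1 (h ▸ h2))
  have := c.code_le (m f)
  omega

/-- The ranks of the core firms in a report. -/
def ranks (c : CoreAgents A B) (r : Report A) : CoreRanks :=
  ⟨r.rank (some c.f1), r.rank (some c.f2), r.rank (some c.f3), r.rank none⟩

/-- The core pattern of a matching. -/
def pattern (c : CoreAgents A B) (Q : B → Report A) (m : A ≃. B) : CorePattern :=
  ⟨c.code (m c.f1), c.code (m c.f2), c.code (m c.f3), (Q c.x).rank (m.symm c.x),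
    (Q c.y).rank (m.symm c.y), (Q c.z).rank (m.symm c.z)⟩

theorem ranks_valid (hc : c.Proper) (r : Report A) : (c.ranks r).Valid := by
  have key : ∀ f g : A, f ≠ g → r.rank (some f) = r.rank (some g) →
      r.rank none < r.rank (some f) := by
    intro f g hfg h
    by_contra hle
    exact hfg (Report.rank_inj (Report.mem_of_not_prefers hle) h)
  exact ⟨r.rank_ne_none _, r.rank_ne_none _, r.rank_ne_none _, key _ _ hc.f12, key _ _ hc.f13,
    key _ _ hc.f23⟩

/-- A core firm and a core worker do not block, the firm has a better core worker, or (with the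
exception `e`) it may prefer its partner outside the core. -/
def Settled (c : CoreAgents A B) (u : A → B → ℝ) (Q : B → Report A) (m : A ≃. B) (f : A) (w : B)
    (e : Prop) : Prop :=
  (Q w).rank (m.symm w) ≤ (Q w).rank (some f) ∨
    (∃ w', (w' = c.x ∨ w' = c.y ∨ w' = c.z) ∧ m f = some w' ∧ u f w ≤ u f w') ∨ e

theorem weakCoreStable (hc : c.Proper) (hu : c.FirmUtil s u) (hm : FirmStable u Q m)
    {e1y e2y e2z : Prop} (h1z : c.Settled u Q m c.f1 c.z False)
    (h1x : c.Settled u Q m c.f1 c.x False) (h1y : c.Settled u Q m c.f1 c.y e1y)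
    (h2x : c.Settled u Q m c.f2 c.x False) (h2y : c.Settled u Q m c.f2 c.y e2y)
    (h2z : c.Settled u Q m c.f2 c.z e2z) (h3x : c.Settled u Q m c.f3 c.x False)
    (h3y : c.Settled u Q m c.f3 c.y False) (h3z : c.Settled u Q m c.f3 c.z False) :
    WeakCoreStable s (c.ranks (Q c.x)) (c.ranks (Q c.y)) (c.ranks (Q c.z)) (c.pattern Q m)
      e1y e2y e2z := by
  have hx : ∀ f, c.code (m f) = 0 → (Q c.x).rank (m.symm c.x) = (Q c.x).rank (some f) :=
    fun f h => by rw [m.eq_some_iff.2 (code_eq_zero.1 h)]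
  have hy : ∀ f, c.code (m f) = 1 → (Q c.y).rank (m.symm c.y) = (Q c.y).rank (some f) :=
    fun f h => by rw [m.eq_some_iff.2 ((code_eq_one hc).1 h)]
  have hz : ∀ f, c.code (m f) = 2 → (Q c.z).rank (m.symm c.z) = (Q c.z).rank (some f) :=
    fun f h => by rw [m.eq_some_iff.2 ((code_eq_two hc).1 h)]
  have p1 := hu.f1_xz; have p2 := hu.f1_yx; have p3 := hu.f2_yx; have p4 := hu.f2_zy
  have p5 := hu.f3_yx; have p6 := hu.f3_zx; have p7 := hu.f3_zy; have p8 := hu.f3_yz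
  refine ⟨c.code_le _, c.code_le _, c.code_le _, code_inj hc hc.f12, code_inj hc hc.f13,
    code_inj hc hc.f23, hm.ir _, hm.ir _, hm.ir _, hx _, hx _, hx _, hy _, hy _, hy _, hz _, hz _,
    hz _, ?_, ?_, ?_, ?_, ?_, ?_, ?_, ?_, ?_⟩
  · rcases h1z with h | ⟨w, rfl | rfl | rfl, h1, h2⟩ | h
    · exact h
    · linarith
    · linarith
    · exact (hz _ ((code_eq_two hc).2 h1)).le
    · exact h.elim
  · rcases h1x with h | ⟨w, rfl | rfl | rfl, h1, h2⟩ | h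
    · exact Or.inr h
    · exact Or.inr (hx _ (code_eq_zero.2 h1)).le
    · linarith
    · exact Or.inl ((code_eq_two hc).2 h1)
    · exact h.elim
  · rcases h1y with h | ⟨w, rfl | rfl | rfl, h1, h2⟩ | h
    · exact Or.inr (Or.inr (Or.inl h))
    · exact Or.inr (Or.inl (code_eq_zero.2 h1))
    · exact Or.inr (Or.inr (Or.inl (hy _ ((code_eq_one hc).2 h1)).le))
    · exact Or.inl ((code_eq_two hc).2 h1)
    · exact Or.inr (Or.inr (Or.inr h))
  · rcases h2x with h | ⟨w, rfl | rfl | rfl, h1, h2⟩ | h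
    · exact h
    · exact (hx _ (code_eq_zero.2 h1)).le
    · linarith
    · linarith
    · exact h.elim
  · rcases h2y with h | ⟨w, rfl | rfl | rfl, h1, h2⟩ | h
    · exact Or.inr (Or.inl h)
    · exact Or.inl (code_eq_zero.2 h1)
    · exact Or.inr (Or.inl (hy _ ((code_eq_one hc).2 h1)).le)
    · linarith
    · exact Or.inr (Or.inr h)
  · rcases h2z with h | ⟨w, rfl | rfl | rfl, h1, h2⟩ | h
    · exact Or.inr (Or.inr (Or.inl h))
    · exact Or.inl (code_eq_zero.2 h1)
    · exact Or.inr (Or.inl ((code_eq_one hc).2 h1))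
    · exact Or.inr (Or.inr (Or.inl (hz _ ((code_eq_two hc).2 h1)).le))
    · exact Or.inr (Or.inr (Or.inr h))
  · rcases h3x with h | ⟨w, rfl | rfl | rfl, h1, h2⟩ | h
    · exact h
    · exact (hx _ (code_eq_zero.2 h1)).le
    · linarith
    · linarith
    · exact h.elim
  · rcases h3y with h | ⟨w, rfl | rfl | rfl, h1, h2⟩ | h
    · exact Or.inr (Or.inr h)
    · exact Or.inl (code_eq_zero.2 h1)
    · exact Or.inr (Or.inr (hy _ ((code_eq_one hc).2 h1)).le)
    · refine Or.inr (Or.inl ⟨?_, (code_eq_two hc).2 h1⟩)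
      by_contra hs
      have := p7 (by omega)
      linarith
    · exact h.elim
  · rcases h3z with h | ⟨w, rfl | rfl | rfl, h1, h2⟩ | h
    · exact Or.inr (Or.inr h)
    · exact Or.inl (code_eq_zero.2 h1)
    · refine Or.inr (Or.inl ⟨?_, (code_eq_one hc).2 h1⟩)
      by_contra hs
      have := p8 (by omega)
      linarith
    · exact Or.inr (Or.inr (hz _ ((code_eq_two hc).2 h1)).le)
    · exact h.elim

theorem core_match_cases (hc : c.Proper) (htop : ∀ j, m (c.a j) = some (c.b j)) {f : A}
    (hf : ∀ j, c.a j ≠ f) :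
    m f = none ∨ m f = some c.x ∨ m f = some c.y ∨ m f = some c.z := by
  cases hmf : m f with
  | none => exact Or.inl rfl
  | some w =>
    rcases hc.worker_cases w with ⟨i, rfl⟩ | rfl | rfl | rfl
    · have := m.eq_some_iff.2 hmf
      rw [m.eq_some_iff.2 (htop i)] at this
      exact absurd (Option.some.inj this) (hf i)
    all_goals simp

theorem settled_of_top (hc : c.Proper) (hu : c.FirmUtil s u) (hm : FirmStable u Q m)
    (htop : ∀ j, m (c.a j) = some (c.b j)) {f : A} (hf : ∀ j, c.a j ≠ f) (w : B) :
    c.Settled u Q m f w False := by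
  by_cases h : value (u f) (m f) < u f w
  · exact Or.inl (hm.noblock f w h)
  · refine Or.inr (Or.inl ?_)
    rcases core_match_cases hc htop hf with h1 | h1 | h1 | h1
    · rw [h1] at h
      exact absurd (hu.pos f w) h
    all_goals
      rw [h1] at h
      exact ⟨_, by simp, h1, not_lt.1 h⟩

theorem symm_eq_none_of_core (hc : c.Proper) (htop : ∀ j, m (c.a j) = some (c.b j)) {w : B}
    (hw : ∀ j, c.b j ≠ w) (h1 : m c.f1 ≠ some w) (h2 : m c.f2 ≠ some w) (h3 : m c.f3 ≠ some w) :
    m.symm w = none := by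
  cases hmw : m.symm w with
  | none => rfl
  | some f =>
    have := m.eq_some_iff.1 hmw
    rcases hc.firm_cases f with ⟨i, rfl⟩ | rfl | rfl | rfl
    · rw [htop i] at this
      exact absurd (Option.some.inj this) (hw i)
    · exact absurd this h1
    · exact absurd this h2
    · exact absurd this h3

theorem coreStable (hc : c.Proper) (hu : c.FirmUtil s u) (hm : FirmStable u Q m)
    (htop : ∀ j, m (c.a j) = some (c.b j)) :
    CoreStable s (c.ranks (Q c.x)) (c.ranks (Q c.y)) (c.ranks (Q c.z)) (c.pattern Q m) where
  toWeakCoreStable := weakCoreStable hc hu hm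
    (settled_of_top hc hu hm htop hc.a_f1 _) (settled_of_top hc hu hm htop hc.a_f1 _)
    (settled_of_top hc hu hm htop hc.a_f1 _) (settled_of_top hc hu hm htop hc.a_f2 _)
    (settled_of_top hc hu hm htop hc.a_f2 _) (settled_of_top hc hu hm htop hc.a_f2 _)
    (settled_of_top hc hu hm htop hc.a_f3 _) (settled_of_top hc hu hm htop hc.a_f3 _)
    (settled_of_top hc hu hm htop hc.a_f3 _)
  cx h1 h2 h3 := congrArg (Q c.x).rank (symm_eq_none_of_core hc htop hc.b_x (mt code_eq_zero.2 h1)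
    (mt code_eq_zero.2 h2) (mt code_eq_zero.2 h3))
  cy h1 h2 h3 := congrArg (Q c.y).rank (symm_eq_none_of_core hc htop hc.b_y (mt (code_eq_one hc).2 h1)
    (mt (code_eq_one hc).2 h2) (mt (code_eq_one hc).2 h3))
  cz h1 h2 h3 := congrArg (Q c.z).rank (symm_eq_none_of_core hc htop hc.b_z (mt (code_eq_two hc).2 h1)
    (mt (code_eq_two hc).2 h2) (mt (code_eq_two hc).2 h3))

/-- A core firm may hold some `b j` after the deviation. By `no_gain` this is worse than its
previous partner, so if it still prefers `b j` to `w`, then its previous partner was strictly better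
than `w`; `he` turns this into the exception. -/
theorem settled_of_dev (hc : c.Proper) (hu : c.FirmUtil s u) (hm : FirmStable u Q m)
    (htop : ∀ j, m (c.a j) = some (c.b j)) (hm' : FirmStable u Q' m')
    (hQ : ∀ j, Q' (c.b j) = Q (c.b j)) {f : A} (hf : ∀ j, c.a j ≠ f) (w : B) {e : Prop}
    (he : ∀ j, u f w ≤ u f (c.b j) → u f (c.b j) < value (u f) (m f) → e) :
    c.Settled u Q' m' f w e := by
  by_cases h : value (u f) (m' f) < u f w
  · exact Or.inl (hm'.noblock f w h)
  · refine Or.inr ?_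
    cases hmf : m' f with
    | none =>
      rw [hmf] at h
      exact absurd (hu.pos f w) h
    | some v =>
      rw [hmf] at h
      rcases hc.worker_cases v with ⟨i, rfl⟩ | hv
      · refine Or.inr (he i (not_lt.1 h) ?_)
        exact no_gain hu hm hm' (n := c.k) (fun j _ => htop j) (fun j _ => hQ j) i i.2 f
          (Ne.symm (hf i)) hmf
      · exact Or.inl ⟨v, hv, rfl, not_lt.1 h⟩

/-- Exceptions arise only for pairs where the firm could previously have had a better core worker.
For `f1` and `x` the only such worker is `z`, and `f1_adj` says that no top worker lies between the
two. The new firm ranks all top workers below the core, so it needs no exception. -/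
theorem devStable (hc : c.Proper) (hu : c.FirmUtil s u) (hm : FirmStable u Q m)
    (htop : ∀ j, m (c.a j) = some (c.b j)) (hm' : FirmStable u Q' m')
    (hQ : ∀ j, Q' (c.b j) = Q (c.b j)) :
    DevStable s (c.ranks (Q' c.x)) (c.ranks (Q' c.y)) (c.ranks (Q' c.z)) (c.pattern Q m)
      (c.pattern Q' m') := by
  have p1 := hu.f1_xz; have p2 := hu.f1_yx; have p3 := hu.f2_yx; have p4 := hu.f2_zy
  have p5 := hu.f3_yx; have p6 := hu.f3_zx
  have q1 := core_match_cases hc htop hc.a_f1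
  have q2 := core_match_cases hc htop hc.a_f2
  have q3 := core_match_cases hc htop hc.a_f3
  refine weakCoreStable hc hu hm' ?_ ?_ ?_ ?_ ?_ ?_ ?_ ?_ ?_
  · refine settled_of_dev hc hu hm htop hm' hQ hc.a_f1 _ fun j h1 h2 => ?_
    have := hu.pos c.f1 (c.b j)
    rcases q1 with h | h | h | h <;> rw [h] at h2 <;> simp only [value] at h2 <;> linarith
  · refine settled_of_dev hc hu hm htop hm' hQ hc.a_f1 _ fun j h1 h2 => ?_
    have h3 := hu.pos c.f1 (c.b j)
    have h4 := hu.f1_adj j (lt_of_le_of_ne h1 fun he => hc.b_x j (hu.inj _ he).symm)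
    rcases q1 with h | h | h | h <;> rw [h] at h2 <;> simp only [value] at h2 <;> linarith
  · refine settled_of_dev hc hu hm htop hm' hQ hc.a_f1 _ fun j h1 h2 => ?_
    have h3 := hu.pos c.f1 (c.b j)
    rcases q1 with h | h | h | h <;> rw [h] at h2 <;> simp only [value] at h2
    · linarith
    · exact Or.inr (code_eq_zero.2 h)
    · linarith
    · exact Or.inl ((code_eq_two hc).2 h)
  · refine settled_of_dev hc hu hm htop hm' hQ hc.a_f2 _ fun j h1 h2 => ?_
    have := hu.pos c.f2 (c.b j)
    rcases q2 with h | h | h | h <;> rw [h] at h2 <;> simp only [value] at h2 <;> linarith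
  · refine settled_of_dev hc hu hm htop hm' hQ hc.a_f2 _ fun j h1 h2 => ?_
    have h3 := hu.pos c.f2 (c.b j)
    rcases q2 with h | h | h | h <;> rw [h] at h2 <;> simp only [value] at h2
    · linarith
    · exact code_eq_zero.2 h
    · linarith
    · linarith
  · refine settled_of_dev hc hu hm htop hm' hQ hc.a_f2 _ fun j h1 h2 => ?_
    have h3 := hu.pos c.f2 (c.b j)
    rcases q2 with h | h | h | h <;> rw [h] at h2 <;> simp only [value] at h2
    · linarith
    · exact Or.inl (code_eq_zero.2 h)
    · exact Or.inr ((code_eq_one hc).2 h)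
    · linarith
  · refine settled_of_dev hc hu hm htop hm' hQ hc.a_f3 _ fun j h1 h2 => ?_
    linarith [hu.f3_x j]
  · refine settled_of_dev hc hu hm htop hm' hQ hc.a_f3 _ fun j h1 h2 => ?_
    linarith [hu.f3_y j]
  · refine settled_of_dev hc hu hm htop hm' hQ hc.a_f3 _ fun j h1 h2 => ?_
    linarith [hu.f3_z j]

end CoreAgents

end

/-! ### Firm-optimality of a swapped assignment, and top pairs in equilibrium -/

section

variable {A B : Type*} [Fintype A] [DecidableEq A] [Fintype B] [DecidableEq B]

theorem value_some {β : Type*} (u : β → ℝ) (b : β) : value u (some b) = u b := rfl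

theorem value_none {β : Type*} (u : β → ℝ) : value u none = 0 := rfl

namespace CoreAgents

variable {c : CoreAgents A B} {s : Fin 2} {u : A → B → ℝ} {v : B → A → ℝ} {Q : B → Report A}
  {m : A ≃. B}

theorem top_value_lt (hc : c.Proper) (hv : c.WorkerUtil v) {i : Fin c.k}
    (htop : ∀ j < i, m (c.a j) = some (c.b j)) (hne : m (c.a i) ≠ some (c.b i)) :
    value (v (c.b i)) (m.symm (c.b i)) < v (c.b i) (c.a i) := by
  cases hm : m.symm (c.b i) with
  | none => exact hv.pos _ _
  | some f =>
    have hf := m.eq_some_iff.1 hm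
    refine hv.top i f (by rintro rfl; exact hne hf) ?_
    rintro j hj rfl
    rw [htop j hj] at hf
    exact hj.ne (hc.b_inj (Option.some.inj hf))

theorem top_firm_value_lt (hc : c.Proper) (hu : c.FirmUtil s u) {i : Fin c.k}
    (htop : ∀ j < i, m (c.a j) = some (c.b j)) (hne : m (c.a i) ≠ some (c.b i)) :
    value (u (c.a i)) (m (c.a i)) < u (c.a i) (c.b i) := by
  cases hm : m (c.a i) with
  | none => exact hu.pos _ _
  | some w =>
    refine hu.top i w (by rintro rfl; exact hne hm) ?_
    rintro j hj rfl
    have h1 := m.eq_some_iff.2 hm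
    rw [m.eq_some_iff.2 (htop j hj)] at h1
    exact hj.ne (hc.a_inj (Option.some.inj h1))

/-- Top pairs whose workers report truthfully are matched. -/
theorem top_matched (hc : c.Proper) (hu : c.FirmUtil s u) (hv : c.WorkerUtil v)
    (hm : FirmStable u Q m) {n : ℕ}
    (hQ : ∀ j : Fin c.k, (j : ℕ) < n → (Q (c.b j)).IsTruthful (v (c.b j))) (j : Fin c.k)
    (hj : (j : ℕ) < n) : m (c.a j) = some (c.b j) := by
  induction j using WellFoundedLT.induction with
  | ind j ih =>
  by_contra hne
  have htop : ∀ l < j, m (c.a l) = some (c.b l) := fun l hl => ih l hl (lt_trans hl hj)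
  have h1 := hm.noblock _ _ (top_firm_value_lt hc hu htop hne)
  have h2 := ((hQ j hj).prefers_some_iff (hv.inj _) (hv.pos _ _)).2 (top_value_lt hc hv htop hne)
  exact absurd h2 (not_lt.2 h1)

/-- The swap of `f₁` and `f₃` between `z` and `x` is safe under the stated conditions, so firm
optimality gives `x` to `f₃`. -/
theorem swap_optimal (hc : c.Proper) (hu : c.FirmUtil s u) {P : A → Report B}
    (hP : ∀ f, (P f).IsTruthful (u f))
    (htop : ∀ j, deferredAcceptance P Q (c.a j) = some (c.b j))
    (h2x : deferredAcceptance P Q c.f2 ≠ some c.x)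
    (h3 : (Q c.x).rank (some c.f3) ≤ (Q c.x).rank none)
    (h32 : (Q c.x).rank (some c.f3) ≤ (Q c.x).rank (some c.f2))
    (h1 : (Q c.z).rank (some c.f1) ≤ (Q c.z).rank none)
    (h2 : (Q c.y).rank (some c.f2) ≤ (Q c.y).rank none ∨
      deferredAcceptance P Q c.f2 = none ∧
        (Q c.z).rank (some c.f1) ≤ (Q c.z).rank (some c.f2)) :
    deferredAcceptance P Q c.f3 = some c.x := by
  set m := deferredAcceptance P Q with hmdef
  have hm : FirmStable u Q m := deferredAcceptance_stable.firmStable hu.inj hu.pos hP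
  have hpref : ∀ f w o, (P f).Prefers (some w) o ↔ value (u f) o < u f w :=
    fun f w o => (hP f).prefers_some_iff (hu.inj f) (hu.pos f w)
  -- The place of `f2` in the swapped assignment: `y` if `y` lists it, and otherwise unmatched,
  -- which is harmless when `z` reports `f1` at least as high as `f2`.
  obtain ⟨o, ho, hoy⟩ : ∃ o : Option B, (o = some c.y ∧ c.f2 ∈ (Q c.y).1 ∨
      o = none ∧ m c.f2 = none ∧ (Q c.z).rank (some c.f1) ≤ (Q c.z).rank (some c.f2)) ∧
      ∀ w, o = some w → w = c.y := by
    rcases h2 with h2 | h2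
    · exact ⟨some c.y, Or.inl ⟨rfl, Report.mem_of_not_prefers (not_lt.2 h2)⟩,
        fun w hw => (Option.some.inj hw).symm⟩
    · exact ⟨none, Or.inr ⟨rfl, h2⟩, fun w hw => by cases hw⟩
  -- This assignment need not be stable: an unassigned `y` may be part of a block. Safety is all
  -- that is needed to bound the firms' outcome from below. The remaining blocks are excluded by the
  -- firms' tastes, the report of `x`, or stability of the original matching.
  let lam : A → Option B := fun f =>
    if f = c.f3 then some c.x else if f = c.f1 then some c.z else if f = c.f2 then o else m f
  have l3 : lam c.f3 = some c.x := by simp [lam]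
  have l1 : lam c.f1 = some c.z := by simp [lam, hc.f13]
  have l2 : lam c.f2 = o := by simp [lam, hc.f23, hc.f12.symm]
  have la : ∀ j, lam (c.a j) = some (c.b j) := by
    intro j
    simp [lam, hc.a_f1, hc.a_f2, hc.a_f3, htop]
  have topne : ∀ j w, (∀ l, c.b l ≠ w) → ¬ (P (c.a j)).Prefers (some w) (some (c.b j)) := by
    intro j w hw h
    rw [hpref] at h
    exact lt_asymm h (hu.top j w (hw j).symm fun l _ => (hw l).symm)
  have q2 := core_match_cases hc htop hc.a_f2
  have q1 := core_match_cases hc htop hc.a_f1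
  have q3 := core_match_cases hc htop hc.a_f3
  have p1 := hu.f1_xz; have p2 := hu.f1_yx; have p3 := hu.f2_yx; have p4 := hu.f2_zy
  have p5 := hu.f3_yx; have p6 := hu.f3_zx
  have hsafe : SafeAssignment P Q lam := by
    intro f w hfw
    rcases hc.firm_cases f with ⟨i, rfl⟩ | rfl | rfl | rfl
    · rw [la] at hfw
      obtain rfl := Option.some.inj hfw
      have hmi := m.eq_some_iff.2 (htop i)
      refine ⟨hm.mem (htop i), fun g hg => ?_⟩
      have hblock : ∀ g, value (u g) (m g) < u g (c.b i) →
          ¬ (Q (c.b i)).Prefers (some g) (some (c.a i)) := by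
        intro g hg
        have := hm.noblock g _ hg
        rw [hmi] at this
        exact not_lt.2 this
      rcases hc.firm_cases g with ⟨j, rfl⟩ | rfl | rfl | rfl
      · rw [la]
        refine ⟨fun h => hg (congrArg _ (hc.b_inj (Option.some.inj h))), fun h => ?_⟩
        rw [← htop j, hpref] at h
        exact hblock _ h.1 h.2
      · rw [l1]
        refine ⟨fun h => hc.b_z i (Option.some.inj h).symm, fun h => ?_⟩
        rw [hpref] at h
        simp only [value] at h
        refine hblock _ ?_ h.2
        have := hu.pos c.f1 (c.b i)
        rcases q1 with h | h | h | h <;> rw [h] <;> simp only [value] <;> linarith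
      · rw [l2]
        refine ⟨fun h => hc.b_y i (hoy _ h), fun h => ?_⟩
        rw [hpref] at h
        refine hblock _ ?_ h.2
        rcases ho with ⟨rfl, -⟩ | ⟨rfl, ho, -⟩
        · simp only [value] at h
          have := hu.pos c.f2 (c.b i)
          rcases q2 with h | h | h | h
          · rw [h]; simpa only [value] using this
          · exact absurd h h2x
          all_goals
            rw [h]; simp only [value]; linarith
        · rw [ho]
          exact hu.pos _ _
      · rw [l3]
        refine ⟨fun h => hc.b_x i (Option.some.inj h).symm, fun h => ?_⟩
        rw [hpref] at h
        exact lt_asymm h.1 (hu.f3_x i)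
    · rw [l1] at hfw
      obtain rfl := Option.some.inj hfw
      refine ⟨Report.mem_of_not_prefers (not_lt.2 h1), fun g hg => ?_⟩
      rcases hc.firm_cases g with ⟨j, rfl⟩ | rfl | rfl | rfl
      · rw [la]
        exact ⟨fun h => hc.b_z j (Option.some.inj h), fun h => topne _ _ hc.b_z h.1⟩
      · exact absurd rfl hg
      · rw [l2]
        refine ⟨fun h => hc.yz (hoy _ h).symm, fun h => ?_⟩
        rcases ho with ⟨rfl, -⟩ | ⟨rfl, -, ho⟩
        · rw [hpref] at h
          exact lt_asymm h.1 p4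
        · exact absurd h.2 (not_lt.2 ho)
      · rw [l3]
        refine ⟨fun h => hc.xz (Option.some.inj h), fun h => ?_⟩
        rw [hpref] at h
        exact lt_asymm h.1 p6
    · rw [l2] at hfw
      obtain rfl := hoy _ hfw
      have hmem : c.f2 ∈ (Q c.y).1 := by
        rcases ho with ⟨-, h⟩ | ⟨rfl, -⟩
        · exact h
        · cases hfw
      refine ⟨hmem, fun g hg => ?_⟩
      rcases hc.firm_cases g with ⟨j, rfl⟩ | rfl | rfl | rfl
      · rw [la]
        exact ⟨fun h => hc.b_y j (Option.some.inj h), fun h => topne _ _ hc.b_y h.1⟩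
      · rw [l1]
        refine ⟨fun h => hc.yz (Option.some.inj h).symm, fun h => ?_⟩
        rw [hpref] at h
        exact lt_asymm h.1 (lt_trans p2 p1)
      · exact absurd rfl hg
      · rw [l3]
        refine ⟨fun h => hc.xy (Option.some.inj h), fun h => ?_⟩
        rw [hpref] at h
        exact lt_asymm h.1 p5
    · rw [l3] at hfw
      obtain rfl := Option.some.inj hfw
      refine ⟨Report.mem_of_not_prefers (not_lt.2 h3), fun g hg => ?_⟩
      rcases hc.firm_cases g with ⟨j, rfl⟩ | rfl | rfl | rfl
      · rw [la]
        exact ⟨fun h => hc.b_x j (Option.some.inj h), fun h => topne _ _ hc.b_x h.1⟩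
      · rw [l1]
        refine ⟨fun h => hc.xz (Option.some.inj h).symm, fun h => ?_⟩
        rw [hpref] at h
        exact lt_asymm h.1 p1
      · rw [l2]
        exact ⟨fun h => hc.xy (hoy _ h), fun h => absurd h.2 (not_lt.2 h32)⟩
      · exact absurd rfl hg
  have h := hsafe.not_prefers c.f3
  rw [l3, hpref, ← hmdef] at h
  rcases q3 with h' | h' | h' | h'
  · rw [h'] at h
    exact absurd (hu.pos _ _) h
  · exact h'
  · rw [h'] at h
    exact absurd p5 h
  · rw [h'] at h
    exact absurd p6 h

end CoreAgents

/-- An economy of top pairs and a core, with the uniform prior on two states. -/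
structure Economy.IsCore (E : Economy (Fin 2) A B) (c : CoreAgents A B) : Prop where
  proper : c.Proper
  prior : ∀ s, E.prior s = 1 / 2
  firm : ∀ s, c.FirmUtil s (E.market s).firmUtil
  worker : c.WorkerUtil (E.market 0).workerUtil

namespace Economy.IsCore

variable {E : Economy (Fin 2) A B} {c : CoreAgents A B} {σ : Profile (Fin 2) A B}

theorem firmStable (hE : E.IsCore c) (hσ : E.FirmsTruthful σ) (s : Fin 2) :
    FirmStable (E.market s).firmUtil σ.worker (σ.outcome s) :=
  deferredAcceptance_stable.firmStable (hE.firm s).inj (hE.firm s).pos fun f => hσ f s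

theorem workerPayoff_eq (hE : E.IsCore c) (σ : Profile (Fin 2) A B) (w : B) :
    E.workerPayoff σ w = (value ((E.market 0).workerUtil w) ((σ.outcome 0).symm w) +
      value ((E.market 0).workerUtil w) ((σ.outcome 1).symm w)) / 2 := by
  unfold Economy.workerPayoff
  rw [Fin.sum_univ_two, hE.prior, hE.prior, E.workerUtil_eq 1 0]
  ring

theorem dev_le (hE : E.IsCore c) (hσ : E.IsBNE σ) (w : B) (r : Report A) :
    value ((E.market 0).workerUtil w) (((σ.setWorker w r).outcome 0).symm w) +
      value ((E.market 0).workerUtil w) (((σ.setWorker w r).outcome 1).symm w) ≤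
    value ((E.market 0).workerUtil w) ((σ.outcome 0).symm w) +
      value ((E.market 0).workerUtil w) ((σ.outcome 1).symm w) := by
  have := hσ.2 w r
  rw [hE.workerPayoff_eq, hE.workerPayoff_eq] at this
  linarith

theorem setWorker_firmStable (hE : E.IsCore c) (hσ : E.FirmsTruthful σ) (w : B) (r : Report A)
    (s : Fin 2) : FirmStable (E.market s).firmUtil (Function.update σ.worker w r)
      ((σ.setWorker w r).outcome s) :=
  hE.firmStable (σ := σ.setWorker w r) hσ s

/-- In every equilibrium with truthful firms the top pairs are matched. -/
theorem tops (hE : E.IsCore c) (hσ : E.IsTruthfulBNE σ) (i : Fin c.k) (s : Fin 2) :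
    σ.outcome s (c.a i) = some (c.b i) := by
  induction i using WellFoundedLT.induction generalizing s with
  | ind i ih =>
  have hc := hE.proper
  -- Listing only `a i` secures it in both states: the only alternatives `a i` prefers are earlier
  -- `b l`, and by `no_gain` ending at one of these would be a loss compared with the equilibrium,
  -- where it has at best `b i`.
  set r : Report A := ⟨[c.a i], List.nodup_singleton _⟩ with hr
  have hdev : ∀ s, ((σ.setWorker (c.b i) r).outcome s).symm (c.b i) = some (c.a i) := by
    intro s
    have hu := hE.firm s
    have hm := hE.firmStable hσ.2 s
    have hm' := hE.setWorker_firmStable hσ.2 (c.b i) r s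
    set m' := (σ.setWorker (c.b i) r).outcome s
    cases hmi : m'.symm (c.b i) with
    | some f =>
      have := hm'.mem (m'.eq_some_iff.1 hmi)
      rw [Function.update_self] at this
      simp [hr] at this
      rw [this]
    | none =>
      exfalso
      have h1 : ¬ value ((E.market s).firmUtil (c.a i)) (m' (c.a i)) <
          (E.market s).firmUtil (c.a i) (c.b i) := by
        intro h
        have := hm'.noblock _ _ h
        rw [hmi, Function.update_self] at this
        simp [Report.rank, hr] at this
      cases hw : m' (c.a i) with
      | none =>
        rw [hw] at h1
        exact h1 (hu.pos _ _)
      | some w =>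
        rw [hw] at h1
        have hex : ∃ l < i, w = c.b l := by
          by_contra hno
          push Not at hno
          refine h1 (hu.top i w ?_ hno)
          rintro rfl
          rw [m'.eq_some_iff.2 hw] at hmi
          cases hmi
        obtain ⟨l, hl, rfl⟩ := hex
        have h2 := CoreAgents.no_gain (n := i) hu hm hm' (fun j hj => ih j hj s)
          (fun j hj => Function.update_of_ne (fun h => (Fin.lt_def.2 hj).ne (hc.b_inj h)) _ _)
          l hl (c.a i) (fun h => hl.ne' (hc.a_inj h)) hw
        by_cases hi : σ.outcome s (c.a i) = some (c.b i)
        · rw [hi] at h2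
          exact h1 h2
        · have h3 := CoreAgents.top_firm_value_lt hc hu (fun j hj => ih j hj s) hi
          exact h1 (h2.trans h3)
  have hle := hE.dev_le hσ.1 (c.b i) r
  rw [hdev, hdev] at hle
  have hval : ∀ s, value ((E.market 0).workerUtil (c.b i)) ((σ.outcome s).symm (c.b i)) ≤
      (E.market 0).workerUtil (c.b i) (c.a i) := by
    intro s
    by_cases h : σ.outcome s (c.a i) = some (c.b i)
    · rw [(σ.outcome s).eq_some_iff.2 h]; exact le_rfl
    · exact (CoreAgents.top_value_lt hc hE.worker (fun j hj => ih j hj s) h).le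
  by_contra hne
  have hlt := CoreAgents.top_value_lt hc hE.worker (fun j hj => ih j hj s) hne
  have h0 := hval 0
  have h1 := hval 1
  simp only [value_some] at hle
  fin_cases s
  · simp only [Fin.zero_eta] at hlt
    linarith
  · simp only [Fin.mk_one] at hlt
    linarith

end Economy.IsCore

end

/-! ### From expected utilities to the possible equilibrium outcomes -/

section

variable {A B : Type*} [Fintype A] [DecidableEq A] [Fintype B] [DecidableEq B]

namespace CoreAgents

variable {c : CoreAgents A B} {s : Fin 2} {u : A → B → ℝ} {v : B → A → ℝ} {Q : B → Report A}
  {m : A ≃. B}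

/-- Worker `w` is matched to a core firm or unmatched. -/
def InCore (c : CoreAgents A B) (m : A ≃. B) (w : B) : Prop :=
  ∀ f, m f = some w → f = c.f1 ∨ f = c.f2 ∨ f = c.f3

theorem inCore_of_tops (hc : c.Proper) (htop : ∀ j, m (c.a j) = some (c.b j)) {w : B}
    (hw : ∀ j, c.b j ≠ w) : c.InCore m w := by
  intro f hf
  rcases hc.firm_cases f with ⟨i, rfl⟩ | h
  · rw [htop i] at hf
    exact absurd (Option.some.inj hf) (hw i)
  · exact h

theorem inCore_of_report (hm : FirmStable u Q m) {w : B}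
    (hw : ∀ f ∈ (Q w).1, f = c.f1 ∨ f = c.f2 ∨ f = c.f3) : c.InCore m w :=
  fun _ hf => hw _ (hm.mem hf)

theorem InCore.symm_eq_none {w : B} (h : c.InCore m w) (h1 : m c.f1 ≠ some w)
    (h2 : m c.f2 ≠ some w) (h3 : m c.f3 ≠ some w) : m.symm w = none := by
  cases hmw : m.symm w with
  | none => rfl
  | some f =>
    have hf := m.eq_some_iff.1 hmw
    rcases h f hf with rfl | rfl | rfl
    exacts [absurd hf h1, absurd hf h2, absurd hf h3]

theorem pattern_hx (h : c.InCore m c.x) (h1 : (c.pattern Q m).v1 ≠ 0)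
    (h2 : (c.pattern Q m).v2 ≠ 0) (h3 : (c.pattern Q m).v3 ≠ 0) :
    (c.pattern Q m).hx = (Q c.x).rank none :=
  congrArg (Q c.x).rank (h.symm_eq_none (mt code_eq_zero.2 h1) (mt code_eq_zero.2 h2)
    (mt code_eq_zero.2 h3))

theorem pattern_hy (hc : c.Proper) (h : c.InCore m c.y) (h1 : (c.pattern Q m).v1 ≠ 1)
    (h2 : (c.pattern Q m).v2 ≠ 1) (h3 : (c.pattern Q m).v3 ≠ 1) :
    (c.pattern Q m).hy = (Q c.y).rank none :=
  congrArg (Q c.y).rank (h.symm_eq_none (mt (code_eq_one hc).2 h1) (mt (code_eq_one hc).2 h2)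
    (mt (code_eq_one hc).2 h3))

theorem pattern_hz (hc : c.Proper) (h : c.InCore m c.z) (h1 : (c.pattern Q m).v1 ≠ 2)
    (h2 : (c.pattern Q m).v2 ≠ 2) (h3 : (c.pattern Q m).v3 ≠ 2) :
    (c.pattern Q m).hz = (Q c.z).rank none :=
  congrArg (Q c.z).rank (h.symm_eq_none (mt (code_eq_two hc).2 h1) (mt (code_eq_two hc).2 h2)
    (mt (code_eq_two hc).2 h3))

theorem levelX_value (Q : B → Report A) (h : c.InCore m c.x) :
    (levelX (c.pattern Q m) = 3 ∧ value (v c.x) (m.symm c.x) = v c.x c.f1) ∨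
    (levelX (c.pattern Q m) = 2 ∧ value (v c.x) (m.symm c.x) = v c.x c.f2) ∨
    (levelX (c.pattern Q m) = 1 ∧ value (v c.x) (m.symm c.x) = v c.x c.f3) ∨
    (levelX (c.pattern Q m) = 0 ∧ value (v c.x) (m.symm c.x) = 0) := by
  rcases levelX_spec (c.pattern Q m) with ⟨h1, hl⟩ | ⟨-, h1, hl⟩ | ⟨-, -, h1, hl⟩ | ⟨h1, h2, h3, hl⟩
  · exact Or.inl ⟨hl, by rw [m.eq_some_iff.2 (code_eq_zero.1 h1)]; rfl⟩
  · exact Or.inr (Or.inl ⟨hl, by rw [m.eq_some_iff.2 (code_eq_zero.1 h1)]; rfl⟩)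
  · exact Or.inr (Or.inr (Or.inl ⟨hl, by rw [m.eq_some_iff.2 (code_eq_zero.1 h1)]; rfl⟩))
  · refine Or.inr (Or.inr (Or.inr ⟨hl, ?_⟩))
    rw [h.symm_eq_none (mt code_eq_zero.2 h1) (mt code_eq_zero.2 h2) (mt code_eq_zero.2 h3)]
    rfl

theorem levelX_value_lt (hv : c.WorkerUtil v) {m' : A ≃. B} {Q Q' : B → Report A}
    (h : c.InCore m c.x) (h' : c.InCore m' c.x)
    (hlt : levelX (c.pattern Q m) < levelX (c.pattern Q' m')) :
    value (v c.x) (m.symm c.x) < value (v c.x) (m'.symm c.x) := by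
  have p1 := hv.x12; have p2 := hv.x23; have p3 := hv.pos c.x c.f3
  rcases levelX_value (v := v) Q h with ⟨e, e'⟩ | ⟨e, e'⟩ | ⟨e, e'⟩ | ⟨e, e'⟩ <;>
  rcases levelX_value (v := v) Q' h' with ⟨d, d'⟩ | ⟨d, d'⟩ | ⟨d, d'⟩ | ⟨d, d'⟩ <;>
  rw [e, d] at hlt <;> first | omega | (rw [e', d']; linarith)

theorem levelX_value_le (hv : c.WorkerUtil v) {m' : A ≃. B} {Q Q' : B → Report A}
    (h : c.InCore m c.x) (h' : c.InCore m' c.x)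
    (hle : levelX (c.pattern Q m) ≤ levelX (c.pattern Q' m')) :
    value (v c.x) (m.symm c.x) ≤ value (v c.x) (m'.symm c.x) := by
  rcases hle.lt_or_eq with hlt | he
  · exact (levelX_value_lt hv h h' hlt).le
  · rcases levelX_value (v := v) Q h with ⟨e, e'⟩ | ⟨e, e'⟩ | ⟨e, e'⟩ | ⟨e, e'⟩ <;>
    rcases levelX_value (v := v) Q' h' with ⟨d, d'⟩ | ⟨d, d'⟩ | ⟨d, d'⟩ | ⟨d, d'⟩ <;>
    rw [e, d] at he <;> first | omega | (rw [e', d'])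

/-- How a worker whose favourite `f₃` is worth more than twice any other relevant firm values
level `l`, where `t` is the level of `f₃`. -/
structure LevelValue (t l : ℕ) (top val : ℝ) : Prop where
  eq_top : l = t → val = top
  lt_top : l ≠ t → 2 * val < top
  zero : l = 0 → val = 0
  pos : l ≠ 0 → 0 < val

theorem LevelValue.nonneg {t l : ℕ} {top val : ℝ} (h : LevelValue t l top val) : 0 ≤ val := by
  by_cases hl : l = 0
  · exact (h.zero hl).ge
  · exact (h.pos hl).le

theorem levelY_value (hc : c.Proper) (hv : c.WorkerUtil v) (Q : B → Report A)
    (h : c.InCore m c.y) :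
    LevelValue 2 (levelY (c.pattern Q m)) (v c.y c.f3) (value (v c.y) (m.symm c.y)) := by
  have p1 := hv.y1; have p2 := hv.y2; have p3 := hv.pos c.y c.f3
  have p4 := hv.pos c.y c.f1; have p5 := hv.pos c.y c.f2
  rcases levelY_spec (c.pattern Q m) with ⟨h1, hl⟩ | ⟨-, h1 | h1, hl⟩ | ⟨h1, h2, h3, hl⟩
  · rw [hl, m.eq_some_iff.2 ((code_eq_one hc).1 h1), value_some]
    exact ⟨fun _ => rfl, fun h => absurd rfl h, fun h => by omega, fun _ => p3⟩
  · rw [hl, m.eq_some_iff.2 ((code_eq_one hc).1 h1), value_some]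
    exact ⟨fun h => by omega, fun _ => p1, fun h => by omega, fun _ => p4⟩
  · rw [hl, m.eq_some_iff.2 ((code_eq_one hc).1 h1), value_some]
    exact ⟨fun h => by omega, fun _ => p2, fun h => by omega, fun _ => p5⟩
  · rw [hl, h.symm_eq_none (mt (code_eq_one hc).2 h1) (mt (code_eq_one hc).2 h2)
      (mt (code_eq_one hc).2 h3), value_none]
    exact ⟨fun h => by omega, fun _ => by linarith, fun _ => rfl, fun h => absurd rfl h⟩

theorem levelZ_value (hc : c.Proper) (hv : c.WorkerUtil v) (Q : B → Report A)
    (h : c.InCore m c.z) :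
    LevelValue 3 (levelZ (c.pattern Q m)) (v c.z c.f3) (value (v c.z) (m.symm c.z)) := by
  have p1 := hv.z1; have p2 := hv.z12; have p3 := hv.pos c.z c.f3
  have p4 := hv.pos c.z c.f1; have p5 := hv.pos c.z c.f2
  rcases levelZ_spec (c.pattern Q m) with ⟨h1, hl⟩ | ⟨-, h1, hl⟩ | ⟨-, -, h1, hl⟩ |
    ⟨h1, h2, h3, hl⟩
  · rw [hl, m.eq_some_iff.2 ((code_eq_two hc).1 h1), value_some]
    exact ⟨fun _ => rfl, fun h => absurd rfl h, fun h => by omega, fun _ => p3⟩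
  · rw [hl, m.eq_some_iff.2 ((code_eq_two hc).1 h1), value_some]
    exact ⟨fun h => by omega, fun _ => p1, fun h => by omega, fun _ => p4⟩
  · rw [hl, m.eq_some_iff.2 ((code_eq_two hc).1 h1), value_some]
    exact ⟨fun h => by omega, fun _ => by linarith, fun h => by omega, fun _ => p5⟩
  · rw [hl, h.symm_eq_none (mt (code_eq_two hc).2 h1) (mt (code_eq_two hc).2 h2)
      (mt (code_eq_two hc).2 h3), value_none]
    exact ⟨fun h => by omega, fun _ => by linarith, fun _ => rfl, fun h => absurd rfl h⟩

/-- The report `[f, g]`. -/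
def pairReport {f g : A} (h : f ≠ g) : Report A := ⟨[f, g], by simpa using h⟩

theorem ranks_pair12 (hc : c.Proper) : c.ranks (pairReport hc.f12) = ranks12 := by
  simp [ranks, pairReport, Report.rank, hc.f12.symm, hc.f13.symm, hc.f23.symm,
    hc.f12]

theorem ranks_pair32 (hc : c.Proper) : c.ranks (pairReport hc.f23.symm) = ranks32 := by
  simp [ranks, pairReport, Report.rank, hc.f12, hc.f13, hc.f23,
    hc.f23.symm]

/-- The codes of the core firms in the possible equilibrium outcomes. -/
def OutcomeCodes (c : CoreAgents A B) (m0 m1 : A ≃. B) : Prop :=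
  (c.code (m1 c.f1) = 0 ∧ c.code (m1 c.f3) = 2) ∧
    ((c.code (m0 c.f1) = 2 ∧ c.code (m0 c.f2) = 0 ∧ c.code (m0 c.f3) = 1 ∧
        c.code (m1 c.f2) = 1) ∨
      (c.code (m0 c.f1) = 0 ∧ c.code (m0 c.f2) = 2 ∧ c.code (m0 c.f3) = 1 ∧
        (c.code (m1 c.f2) = 1 ∨ c.code (m1 c.f2) = 3)))

/-- Once the top pairs are matched, code 3 of a core firm can only mean that it is unmatched, so the
three codes determine the matching. -/
theorem eq_of_codes (hc : c.Proper) {m m' : A ≃. B} (ht : ∀ j, m (c.a j) = some (c.b j))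
    (ht' : ∀ j, m' (c.a j) = some (c.b j)) (h1 : c.code (m c.f1) = c.code (m' c.f1))
    (h2 : c.code (m c.f2) = c.code (m' c.f2)) (h3 : c.code (m c.f3) = c.code (m' c.f3)) :
    m = m' := by
  have key : ∀ f, (∀ j, c.a j ≠ f) → c.code (m f) = c.code (m' f) → m f = m' f := by
    intro f hf h
    rcases core_match_cases hc ht hf with e | e | e | e <;>
    rcases core_match_cases hc ht' hf with d | d | d | d <;>
    rw [e, d] at h ⊢ <;> simp [code_x, code_y hc, code_z hc] at h <;> simp [code] at h
  refine PEquiv.ext fun f => ?_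
  rcases hc.firm_cases f with ⟨i, rfl⟩ | rfl | rfl | rfl
  · rw [ht, ht']
  · exact key _ hc.a_f1 h1
  · exact key _ hc.a_f2 h2
  · exact key _ hc.a_f3 h3

end CoreAgents

namespace Economy.IsCore

open CoreAgents

variable {E : Economy (Fin 2) A B} {c : CoreAgents A B} {σ : Profile (Fin 2) A B}

theorem dev_devStable (hE : E.IsCore c) (hσ : E.IsTruthfulBNE σ) (w : B) (hw : ∀ j, c.b j ≠ w)
    (r : Report A) (s : Fin 2) :
    DevStable s (c.ranks (Function.update σ.worker w r c.x))
      (c.ranks (Function.update σ.worker w r c.y)) (c.ranks (Function.update σ.worker w r c.z))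
      (c.pattern σ.worker (σ.outcome s))
      (c.pattern (Function.update σ.worker w r) ((σ.setWorker w r).outcome s)) :=
  devStable hE.proper (hE.firm s) (hE.firmStable hσ.2 s) (fun j => hE.tops hσ j s)
    (hE.setWorker_firmStable hσ.2 w r s) fun j => Function.update_of_ne (hw j) _ _

/-- With equal priors, unprofitable deviations become inequalities between sums over the two states.
`LevelValue` translates these into the counting and Pareto conditions of `core_characterization`:
getting `f3` once beats two matches without it. -/
theorem outcomeCodes (hE : E.IsCore c) (hσ : E.IsTruthfulBNE σ) :
    c.OutcomeCodes (σ.outcome 0) (σ.outcome 1) := by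
  have hc := hE.proper
  have hv := hE.worker
  have ht := fun s j => hE.tops hσ j s
  have hA := coreStable hc (hE.firm 0) (hE.firmStable hσ.2 0) (ht 0)
  have hB := coreStable hc (hE.firm 1) (hE.firmStable hσ.2 1) (ht 1)
  have inx := fun s => inCore_of_tops hc (ht s) hc.b_x
  have iny := fun s => inCore_of_tops hc (ht s) hc.b_y
  have inz := fun s => inCore_of_tops hc (ht s) hc.b_z
  set r12 : Report A := pairReport hc.f12
  set r32 : Report A := pairReport hc.f23.symm
  have l12 : r12.rank none = 2 := rfl
  have l32 : r32.rank none = 2 := rfl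
  have dx := hE.dev_devStable hσ c.x hc.b_x r12
  have dy := hE.dev_devStable hσ c.y hc.b_y r32
  have dz := hE.dev_devStable hσ c.z hc.b_z r32
  simp only [Function.update_self, Function.update_of_ne hc.xy.symm,
    Function.update_of_ne hc.xz.symm, r12, ranks_pair12 hc] at dx
  simp only [Function.update_self, Function.update_of_ne hc.xy,
    Function.update_of_ne hc.yz.symm, r32, ranks_pair32 hc] at dy
  simp only [Function.update_self, Function.update_of_ne hc.xz,
    Function.update_of_ne hc.yz, r32, ranks_pair32 hc] at dz
  have inx' : ∀ s, c.InCore ((σ.setWorker c.x r12).outcome s) c.x := fun s =>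
    inCore_of_report (hE.setWorker_firmStable hσ.2 c.x r12 s) fun f hf => by
      rw [Function.update_self] at hf
      simp [r12, pairReport] at hf
      tauto
  have iny' : ∀ s, c.InCore ((σ.setWorker c.y r32).outcome s) c.y := fun s =>
    inCore_of_report (hE.setWorker_firmStable hσ.2 c.y r32 s) fun f hf => by
      rw [Function.update_self] at hf
      simp [r32, pairReport] at hf
      tauto
  have inz' : ∀ s, c.InCore ((σ.setWorker c.z r32).outcome s) c.z := fun s =>
    inCore_of_report (hE.setWorker_firmStable hσ.2 c.z r32 s) fun f hf => by
      rw [Function.update_self] at hf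
      simp [r32, pairReport] at hf
      tauto
  have px := hE.dev_le hσ.1 c.x r12
  have py := hE.dev_le hσ.1 c.y r32
  have pz := hE.dev_le hσ.1 c.z r32
  have cx : ∀ s, _ := fun s => pattern_hx (Q := Function.update σ.worker c.x r12) (inx' s)
  have cy : ∀ s, _ := fun s => pattern_hy (Q := Function.update σ.worker c.y r32) hc (iny' s)
  have cz : ∀ s, _ := fun s => pattern_hz (Q := Function.update σ.worker c.z r32) hc (inz' s)
  simp only [Function.update_self, l12, l32] at cx cy cz
  have y0 := levelY_value hc hv σ.worker (iny 0); have y1 := levelY_value hc hv σ.worker (iny 1)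
  have y0' := levelY_value hc hv (Function.update σ.worker c.y r32) (iny' 0)
  have y1' := levelY_value hc hv (Function.update σ.worker c.y r32) (iny' 1)
  have z0 := levelZ_value hc hv σ.worker (inz 0); have z1 := levelZ_value hc hv σ.worker (inz 1)
  have z0' := levelZ_value hc hv (Function.update σ.worker c.z r32) (inz' 0)
  have z1' := levelZ_value hc hv (Function.update σ.worker c.z r32) (inz' 1)
  have y0n := y0.nonneg; have y1n := y1.nonneg; have y0n' := y0'.nonneg; have y1n' := y1'.nonneg
  have z0n := z0.nonneg; have z1n := z1.nonneg; have z0n' := z0'.nonneg; have z1n' := z1'.nonneg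
  have hyp := hv.pos c.y c.f3; have hzp := hv.pos c.z c.f3
  refine core_characterization (ranks_valid hc _) (ranks_valid hc _) (ranks_valid hc _) hA hB
    (dx 0) (dx 1) (dy 0) (dy 1) (dz 0) (dz 1) (cx 0) (cx 1) (cy 0) (cy 1) (cz 0) (cz 1)
    ?_ ?_ ?_ ?_ ?_ ?_ ?_ ?_
  · intro h0 h1
    constructor
    · by_contra hne
      have := levelX_value_lt hv (inx 0) (inx' 0) (lt_of_le_of_ne h0 (Ne.symm hne))
      have := levelX_value_le hv (inx 1) (inx' 1) h1
      linarith
    · by_contra hne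
      have := levelX_value_le hv (inx 0) (inx' 0) h0
      have := levelX_value_lt hv (inx 1) (inx' 1) (lt_of_le_of_ne h1 (Ne.symm hne))
      linarith
  · intro h
    by_contra! hne
    have := y0'.eq_top h; have := y0.lt_top hne.1; have := y1.lt_top hne.2
    linarith
  · intro h h' h1
    by_contra hne
    have := y0.eq_top h; have := y0'.eq_top h'; have := y1.zero h1; have := y1'.pos hne
    linarith
  · intro h h1
    by_contra hne
    have := y0.zero h; have := y1.zero h1; have := y0'.pos hne
    linarith
  · intro h
    by_contra! hne
    have := z1'.eq_top h; have := z0.lt_top hne.1; have := z1.lt_top hne.2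
    linarith
  · intro h h1
    have e := z0'.eq_top h; have e1 := z1'.eq_top h1
    constructor
    · by_contra hne
      have := z0.lt_top hne
      by_cases hq : levelZ (c.pattern σ.worker (σ.outcome 1)) = 3
      · have := z1.eq_top hq
        linarith
      · have := z1.lt_top hq
        linarith
    · by_contra hne
      have := z1.lt_top hne
      by_cases hq : levelZ (c.pattern σ.worker (σ.outcome 0)) = 3
      · have := z0.eq_top hq
        linarith
      · have := z0.lt_top hq
        linarith
  · intro h h' h1
    by_contra hne
    have := z1.eq_top h; have := z1'.eq_top h'; have := z0.zero h1; have := z0'.pos hne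
    linarith
  · intro h2 h3 h32 h1 h4
    refine code_eq_zero.2 (swap_optimal hc (hE.firm 0) (fun f => hσ.2 f 0) (ht 0)
      (mt code_eq_zero.2 h2) h3 h32 h1 ?_)
    refine h4.imp_right fun h => ⟨?_, h.2⟩
    have := core_match_cases hc (ht 0) hc.a_f2
    rcases this with e | e | e | e
    · exact e
    all_goals
      have h5 : c.code (σ.outcome 0 c.f2) = 3 := h.1
      rw [e] at h5
      simp [code_x, code_y hc, code_z hc] at h5

end Economy.IsCore

end

section

variable {A B : Type*} [Fintype A] [DecidableEq A] [Fintype B] [DecidableEq B]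

/-! ### Equilibrium profiles -/

/-- Reports in which `x` lists `f₁` above the other core firms, and `y` and `z` list `f₃` first. If
`xTrue` holds then `x` ranks `f₂` above `f₃` and `z` ranks `f₁` above `f₂`; otherwise they rank them
the other way, and `z` lists `f₁` only if `y` does not list `f₂`. The worker `y` lists `f₂` if
`yLists` holds. -/
structure CandidateRanks (X Y Z : CoreRanks) (xTrue yLists : Prop) : Prop where
  x12 : X.r1 < X.r2
  x13 : X.r1 < X.r3
  x20 : X.r2 < X.r0
  x30 : X.r3 < X.r0
  x23 : xTrue → X.r2 < X.r3
  x32 : ¬ xTrue → X.r3 < X.r2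
  y31 : Y.r3 < Y.r1
  y32 : Y.r3 < Y.r2
  y10 : Y.r1 < Y.r0
  y20 : yLists → Y.r2 < Y.r0
  y02 : ¬ yLists → Y.r0 < Y.r2
  z31 : Z.r3 < Z.r1
  z32 : Z.r3 < Z.r2
  z20 : Z.r2 < Z.r0
  z12 : xTrue → Z.r1 < Z.r2
  z21 : ¬ xTrue → Z.r2 < Z.r1
  z10 : xTrue ∨ ¬ yLists → Z.r1 < Z.r0
  z01 : ¬ xTrue → yLists → Z.r0 < Z.r1
  listed : xTrue → yLists

namespace CandidateRanks

variable {X Y Z : CoreRanks} {xTrue yLists : Prop} {p : CorePattern} {s : Fin 2}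

/-- When `z` ranks `f2` above `f1`, a firm `f2` that is not at `x` could leave `z` to `f1` only by
sitting at `y`. But either `z` does not list `f1` or `y` does not list `f2`. -/
theorem not_z_and_x (h : CandidateRanks X Y Z xTrue yLists) (hp : CoreStable s X Y Z p)
    (h1 : p.v1 = 2) (h2 : p.v2 ≠ 0) : xTrue := by
  by_contra hx
  have e1 := hp.z1 h1; have e2 := h.z21 hx; have e3 := hp.irz
  have e4 := (hp.b2z.resolve_left h2)
  by_cases hy : yLists
  · have := h.z01 hx hy
    omega
  · have e5 := h.y02 hy; have e6 := hp.y2; have e7 := hp.iry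
    simp only [or_false] at e4
    omega

/-- Since `x` ranks `f1` first, `f3` at `x` sends `f1` to `z`, which requires `xTrue`; but then `x`
ranks `f2` above `f3`, and `f2` blocks. -/
theorem v3_ne_zero (h : CandidateRanks X Y Z xTrue yLists) (hp : CoreStable s X Y Z p) :
    p.v3 ≠ 0 := by
  intro h3
  have e1 := hp.x3 h3; have e2 := hp.b1x; have e3 := h.x13; have e4 := hp.d23
  have e5 := h.not_z_and_x hp (by omega) (by omega)
  have := h.x23 e5; have := hp.b2x
  omega

/-- As `f3` misses `x`, it gets `y`, who ranks it first. Then `z` takes `f1` or `f2` according to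
its report, and the other one goes to `x`. -/
theorem codes_zero (h : CandidateRanks X Y Z xTrue yLists) (hp : CoreStable 0 X Y Z p) :
    p.v3 = 1 ∧ (xTrue → p.v1 = 2 ∧ p.v2 = 0) ∧ (¬ xTrue → p.v1 = 0 ∧ p.v2 = 2) := by
  have e0 := h.v3_ne_zero hp
  have e3 : p.v3 = 1 := by
    have a1 := hp.b3y.resolve_left e0
    simp only [Fin.zero_eq_one_iff, OfNat.ofNat_ne_one, false_and, false_or] at a1
    have := hp.y1; have := hp.y2; have := hp.cy; have := h.y31; have := h.y32; have := h.y10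
    omega
  refine ⟨e3, fun hx => ?_, fun hx => ?_⟩
  · have e1 : p.v1 = 2 := by
      have := hp.b1z; have := hp.z2; have := hp.cz; have := h.z12 hx; have := h.z10 (Or.inl hx)
      omega
    have := hp.b2x; have := hp.cx; have := h.x20
    omega
  · have e2 : p.v2 ≠ 0 := by
      intro h2
      have := hp.x2 h2; have := hp.b3x; have := h.x32 hx
      omega
    have e1 : p.v1 ≠ 2 := fun h1 => hx (h.not_z_and_x hp h1 e2)
    have f1 : p.v1 = 0 := by
      have := hp.b1x; have := hp.cx; have := h.x12; have := h.x20
      omega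
    have a1 := hp.b2z.resolve_left e2
    simp only [or_false] at a1
    have := hp.d23; have := hp.cz; have := h.z20
    omega

/-- Here `f3` gets `z`, so `f1` falls back on `x`, who ranks it first, and `f2` depends on whether
`y` lists it. -/
theorem codes_one (h : CandidateRanks X Y Z xTrue yLists) (hp : CoreStable 1 X Y Z p) :
    p.v1 = 0 ∧ p.v3 = 2 ∧ (yLists → p.v2 = 1) ∧ (¬ yLists → p.v2 = 3) := by
  have e0 := h.v3_ne_zero hp
  have e3 : p.v3 = 2 := by
    have a1 := hp.b3z.resolve_left e0
    simp only [one_ne_zero, false_and, false_or] at a1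
    have := hp.z1; have := hp.z2; have := hp.cz; have := h.z31; have := h.z32; have := h.z20
    omega
  have e1 : p.v1 = 0 := by
    have := hp.b1x; have := hp.cx; have := hp.d13; have := hp.x2; have := h.x12; have := h.x20
    omega
  have e2 := hp.d12
  have e4 := hp.d23
  refine ⟨e1, e3, fun hy => ?_, fun hy => ?_⟩
  · have a1 := hp.b2y
    simp only [or_false] at a1
    have := hp.cy; have := h.y20 hy
    omega
  · have := hp.le2; have := hp.y2; have := hp.iry; have := h.y02 hy
    omega

end CandidateRanks

/-- Profiles with truthful firms in which the workers of the top pairs are truthful, every worker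
lists his favourite first, and the core workers' reports are as in `CandidateRanks`. -/
structure Economy.IsCandidate (E : Economy (Fin 2) A B) (c : CoreAgents A B)
    (σ : Profile (Fin 2) A B) (xTrue yLists : Prop) : Prop where
  firms : E.FirmsTruthful σ
  tops : ∀ i, (σ.worker (c.b i)).IsTruthful ((E.market 0).workerUtil (c.b i))
  head : ∀ w, ∃ t, (σ.worker w).1.head? = some t ∧
    ∀ g, g ≠ t → (E.market 0).workerUtil w g < (E.market 0).workerUtil w t
  ranks : CandidateRanks (c.ranks (σ.worker c.x)) (c.ranks (σ.worker c.y))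
    (c.ranks (σ.worker c.z)) xTrue yLists

theorem Economy.IsCandidate.firm_le {E : Economy (Fin 2) A B} {c : CoreAgents A B}
    {σ : Profile (Fin 2) A B} {xTrue yLists : Prop} (h : E.IsCandidate c σ xTrue yLists) (f : A)
    (s : Fin 2 → Report B) : E.firmPayoff (σ.setFirm f s) f ≤ E.firmPayoff σ f := by
  have := firmPayoff_le_of_truthful E σ f s (σ.firm f) (fun θ => h.firms f θ)
  rwa [show σ.setFirm f (σ.firm f) = σ by
    unfold Profile.setFirm; rw [Function.update_eq_self]] at this

namespace Economy.IsCore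

open CoreAgents

variable {E : Economy (Fin 2) A B} {c : CoreAgents A B} {σ : Profile (Fin 2) A B}
  {xTrue yLists : Prop} {m : A ≃. B}

theorem candidate_tops (hE : E.IsCore c) (h : E.IsCandidate c σ xTrue yLists) {s : Fin 2}
    (hm : FirmStable (E.market s).firmUtil σ.worker m) (j : Fin c.k) :
    m (c.a j) = some (c.b j) :=
  top_matched (n := c.k) hE.proper (hE.firm s) hE.worker hm (fun j _ => h.tops j) j j.2

theorem candidate_codes_zero (hE : E.IsCore c) (h : E.IsCandidate c σ xTrue yLists)
    (hm : FirmStable (E.market 0).firmUtil σ.worker m) :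
    c.code (m c.f3) = 1 ∧ (xTrue → c.code (m c.f1) = 2 ∧ c.code (m c.f2) = 0) ∧
      (¬ xTrue → c.code (m c.f1) = 0 ∧ c.code (m c.f2) = 2) :=
  h.ranks.codes_zero (coreStable hE.proper (hE.firm 0) hm (hE.candidate_tops h hm))

theorem candidate_codes_one (hE : E.IsCore c) (h : E.IsCandidate c σ xTrue yLists)
    (hm : FirmStable (E.market 1).firmUtil σ.worker m) :
    c.code (m c.f1) = 0 ∧ c.code (m c.f3) = 2 ∧ (yLists → c.code (m c.f2) = 1) ∧
      (¬ yLists → c.code (m c.f2) = 3) :=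
  h.ranks.codes_one (coreStable hE.proper (hE.firm 1) hm (hE.candidate_tops h hm))

/-- The reports of a candidate admit a unique stable matching in each state. -/
theorem candidate_uniqueStable (hE : E.IsCore c) (h : E.IsCandidate c σ xTrue yLists)
    (s : Fin 2) : σ.UniqueReportedStable s := by
  refine ⟨σ.outcome s, deferredAcceptance_stable, fun m hm => ?_⟩
  have hc := hE.proper
  have hu := hE.firm s
  have hm : FirmStable (E.market s).firmUtil σ.worker m :=
    hm.firmStable hu.inj hu.pos fun f => h.firms f s
  have hm' := hE.firmStable h.firms s
  refine eq_of_codes hc (hE.candidate_tops h hm) (hE.candidate_tops h hm') ?_ ?_ ?_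
  all_goals
    fin_cases s
    · have e := hE.candidate_codes_zero h hm
      have e' := hE.candidate_codes_zero h hm'
      by_cases hx : xTrue <;> simp_all
    · have e := hE.candidate_codes_one h hm
      have e' := hE.candidate_codes_one h hm'
      by_cases hx : yLists <;> simp_all

/-- Truth-telling is dominant for firms, and each worker lists his favourite first. The second
worker needed for the rejection chain is taken from the core. -/
theorem candidate_undominated (hE : E.IsCore c) (h : E.IsCandidate c σ xTrue yLists) :
    E.WeaklyUndominated σ := by
  refine ⟨fun f => ?_, fun w => ?_⟩
  · rintro ⟨s', -, τ, hτ⟩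
    exact absurd hτ (not_lt.2 (firmPayoff_le_of_truthful E τ f s' _ (fun θ => h.firms f θ)))
  · rintro ⟨r', hr'⟩
    obtain ⟨t, ht, hmax⟩ := h.head w
    have hww : ∃ w', w' ≠ w := by
      by_cases hw : w = c.x
      · exact ⟨c.y, hw ▸ hE.proper.xy.symm⟩
      · exact ⟨c.x, Ne.symm hw⟩
    obtain ⟨w', hw'⟩ := hww
    refine not_workerDominates_of_head E hw' ht (fun θ => ?_) hr'
    rw [E.workerUtil_eq θ 0]
    exact hmax

end Economy.IsCore

end

section

variable {A B : Type*} [Fintype A] [DecidableEq A] [Fintype B] [DecidableEq B]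

/-! ### Candidates are equilibria -/

namespace CandidateRanks

variable {X Y Z R : CoreRanks} {xTrue yLists : Prop} {p : CorePattern} {s : Fin 2}

/-- With `f1` at `x`, worker `z` would have to hold `f3` to keep `f1` away; but in state 0 `f3`
prefers `y`, who ranks it first. -/
theorem dev_x_zero (h : CandidateRanks X Y Z xTrue yLists) (hx : xTrue)
    (hp : CoreStable 0 R Y Z p) : p.v1 ≠ 0 := by
  intro h1
  have e3 : p.v3 = 2 := by
    have := hp.b1z; have := hp.z2; have := hp.cz; have := h.z12 hx; have := h.z10 (Or.inl hx)
    omega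
  have a1 := hp.b3y
  simp only [e3, Fin.zero_eq_one_iff, OfNat.ofNat_ne_one, false_and, false_or,
    OfNat.ofNat_ne_zero] at a1
  have := hp.y1; have := hp.y2; have := hp.cy; have := h.y31; have := h.y32; have := h.y10
  omega

/-- In state 1 `f3` prefers `z`, who ranks it first, and `f1` prefers `x`, who ranks `f1` first. -/
theorem dev_y_one (h : CandidateRanks X Y Z xTrue yLists) (hp : CoreStable 1 X R Z p) :
    p.v3 ≠ 1 ∧ p.v1 ≠ 1 := by
  constructor
  · intro h3
    have a1 := hp.b3z
    simp only [h3, one_ne_zero, false_and, false_or] at a1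
    have := hp.z1; have := hp.z2; have := hp.cz; have := h.z31; have := h.z32; have := h.z20
    omega
  · have := hp.b1x; have := hp.x2; have := hp.x3; have := hp.cx; have := h.x12; have := h.x13
    have := h.x20
    omega

theorem dev_z_zero (h : CandidateRanks X Y Z xTrue yLists) (hp : CoreStable 0 X Y R p) :
    p.v3 ≠ 2 := by
  intro h3
  have a1 := hp.b3y
  simp only [h3, Fin.zero_eq_one_iff, OfNat.ofNat_ne_one, false_and, false_or,
    OfNat.ofNat_ne_zero] at a1
  have := hp.y1; have := hp.y2; have := hp.cy; have := h.y31; have := h.y32; have := h.y10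
  omega

theorem v2_ne_zero (h : CandidateRanks X Y Z xTrue yLists) (hx : ¬ xTrue) {Y' Z' : CoreRanks}
    (hp : CoreStable s X Y' Z' p) : p.v2 ≠ 0 := by
  intro h2
  have := hp.x2 h2; have := hp.b3x; have := h.x32 hx
  omega

end CandidateRanks

namespace CoreAgents

variable {c : CoreAgents A B} {m : A ≃. B}

theorem InCore.cases {w : B} (h : c.InCore m w) :
    (m c.f1 = some w ∧ m.symm w = some c.f1) ∨ (m c.f2 = some w ∧ m.symm w = some c.f2) ∨
      (m c.f3 = some w ∧ m.symm w = some c.f3) ∨ m.symm w = none := by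
  cases hmw : m.symm w with
  | none => simp
  | some f =>
    have hf := m.eq_some_iff.1 hmw
    rcases h f hf with rfl | rfl | rfl <;> simp [hf]

end CoreAgents

namespace Economy.IsCore

open CoreAgents

variable {E : Economy (Fin 2) A B} {c : CoreAgents A B} {σ : Profile (Fin 2) A B}
  {xTrue yLists : Prop} {m : A ≃. B}

theorem candidate_dev_tops (hE : E.IsCore c) (h : E.IsCandidate c σ xTrue yLists) {w : B}
    (hw : ∀ j, c.b j ≠ w) (r : Report A) (s : Fin 2) (j : Fin c.k) :
    (σ.setWorker w r).outcome s (c.a j) = some (c.b j) :=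
  top_matched (n := c.k) hE.proper (hE.firm s) hE.worker (hE.setWorker_firmStable h.firms w r s)
    (fun j _ => by rw [Function.update_of_ne (hw j)]; exact h.tops j) j j.2

theorem candidate_dev_stable (hE : E.IsCore c) (h : E.IsCandidate c σ xTrue yLists) {w : B}
    (hw : ∀ j, c.b j ≠ w) (r : Report A) (s : Fin 2) :
    CoreStable s (c.ranks (Function.update σ.worker w r c.x))
      (c.ranks (Function.update σ.worker w r c.y)) (c.ranks (Function.update σ.worker w r c.z))
      (c.pattern (Function.update σ.worker w r) ((σ.setWorker w r).outcome s)) :=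
  coreStable hE.proper (hE.firm s) (hE.setWorker_firmStable h.firms w r s)
    (hE.candidate_dev_tops h hw r s)

/-- Earlier top workers report truthfully, so earlier top firms stay matched whatever `b i` does,
and `a i` is the best firm left. -/
theorem candidate_top_le (hE : E.IsCore c) (h : E.IsCandidate c σ xTrue yLists) (i : Fin c.k)
    (r : Report A) (s : Fin 2) :
    value ((E.market 0).workerUtil (c.b i)) (((σ.setWorker (c.b i) r).outcome s).symm (c.b i)) ≤
      value ((E.market 0).workerUtil (c.b i)) ((σ.outcome s).symm (c.b i)) := by
  have hc := hE.proper
  rw [(σ.outcome s).eq_some_iff.2 (hE.candidate_tops h (hE.firmStable h.firms s) i), value_some]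
  by_cases hi : (σ.setWorker (c.b i) r).outcome s (c.a i) = some (c.b i)
  · rw [((σ.setWorker (c.b i) r).outcome s).eq_some_iff.2 hi, value_some]
  · refine (top_value_lt hc hE.worker (fun j hj => ?_) hi).le
    refine top_matched (n := i) hc (hE.firm s) hE.worker
      (hE.setWorker_firmStable h.firms (c.b i) r s) (fun j hj => ?_) j hj
    rw [Function.update_of_ne fun e => (Fin.lt_def.2 hj).ne (hc.b_inj e)]
    exact h.tops j

/-- Worker `x` already has `f1`, except in state 0 under `xTrue`; there it has `f2`, and no report
obtains `f1`. -/
theorem candidate_x_le (hE : E.IsCore c) (h : E.IsCandidate c σ xTrue yLists)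
    (r : Report A) (s : Fin 2) :
    value ((E.market 0).workerUtil c.x) (((σ.setWorker c.x r).outcome s).symm c.x) ≤
      value ((E.market 0).workerUtil c.x) ((σ.outcome s).symm c.x) := by
  have hc := hE.proper
  have hm := fun s => hE.firmStable h.firms s
  have ht := fun s => hE.candidate_tops h (hm s)
  have l := levelX_spec
    (c.pattern (Function.update σ.worker c.x r) ((σ.setWorker c.x r).outcome s))
  refine levelX_value_le (Q := Function.update σ.worker c.x r) (Q' := σ.worker) hE.worker
    (inCore_of_tops hc (hE.candidate_dev_tops h hc.b_x r s) hc.b_x)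
    (inCore_of_tops hc (ht s) hc.b_x) ?_
  fin_cases s
  · obtain ⟨-, h1, h2⟩ := hE.candidate_codes_zero h (hm 0)
    by_cases hx : xTrue
    · have hd := hE.candidate_dev_stable h hc.b_x r 0
      simp only [Function.update_self, Function.update_of_ne hc.xy.symm,
        Function.update_of_ne hc.xz.symm] at hd
      have := h.ranks.dev_x_zero hx hd
      have e : 2 ≤ levelX (c.pattern σ.worker (σ.outcome 0)) := by
        simp [levelX, pattern, h1 hx]
      simp only [Fin.zero_eta] at l ⊢
      omega
    · have e : levelX (c.pattern σ.worker (σ.outcome 0)) = 3 := by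
        simp [levelX, pattern, h2 hx]
      simp only [Fin.zero_eta] at l ⊢
      omega
  · obtain ⟨h1, -⟩ := hE.candidate_codes_one h (hm 1)
    have e : levelX (c.pattern σ.worker (σ.outcome 1)) = 3 := by
      simp [levelX, pattern, h1]
    simp only [Fin.mk_one] at l ⊢
    omega

/-- Worker `y` has `f3` in state 0 and can gain only by winning `f2` in state 1 when it did not list
`f2`. -/
theorem candidate_y_le (hE : E.IsCore c) (h : E.IsCandidate c σ xTrue yLists)
    (r : Report A) :
    value ((E.market 0).workerUtil c.y) (((σ.setWorker c.y r).outcome 0).symm c.y) +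
        value ((E.market 0).workerUtil c.y) (((σ.setWorker c.y r).outcome 1).symm c.y) ≤
      value ((E.market 0).workerUtil c.y) ((σ.outcome 0).symm c.y) +
        value ((E.market 0).workerUtil c.y) ((σ.outcome 1).symm c.y) := by
  have hc := hE.proper
  have hv := hE.worker
  have hm := fun s => hE.firmStable h.firms s
  have hm' := fun s => hE.setWorker_firmStable h.firms c.y r s
  have ht' := fun s => hE.candidate_dev_tops h hc.b_y r s
  have hd := fun s => hE.candidate_dev_stable h hc.b_y r s
  simp only [Function.update_self, Function.update_of_ne hc.xy,
    Function.update_of_ne hc.yz.symm] at hd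
  obtain ⟨d3, d1⟩ := h.ranks.dev_y_one (hd 1)
  obtain ⟨A3, -⟩ := hE.candidate_codes_zero h (hm 0)
  obtain ⟨-, B3, B2, B2'⟩ := hE.candidate_codes_one h (hm 1)
  have p1 := hv.y1; have p2 := hv.y2; have p3 := hv.pos c.y c.f3
  have p4 := hv.pos c.y c.f1; have p5 := hv.pos c.y c.f2
  rw [(σ.outcome 0).eq_some_iff.2 ((code_eq_one hc).1 A3), value_some]
  have c0 := (inCore_of_tops hc (ht' 0) hc.b_y).cases
  have c1 := (inCore_of_tops hc (ht' 1) hc.b_y).cases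
  have hn : 0 ≤ value ((E.market 0).workerUtil c.y) ((σ.outcome 1).symm c.y) := by
    cases (σ.outcome 1).symm c.y with
    | none => exact le_rfl
    | some f => exact (hv.pos _ _).le
  have e1 : ((σ.setWorker c.y r).outcome 1 c.f2 = some c.y ∧
      ((σ.setWorker c.y r).outcome 1).symm c.y = some c.f2) ∨
      ((σ.setWorker c.y r).outcome 1).symm c.y = none := by
    rcases c1 with e | e | e | e
    · exact absurd ((code_eq_one hc).2 e.1) d1
    · exact Or.inl e
    · exact absurd ((code_eq_one hc).2 e.1) d3
    · exact Or.inr e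
  have top0 : value ((E.market 0).workerUtil c.y) (((σ.setWorker c.y r).outcome 0).symm c.y) ≤
      (E.market 0).workerUtil c.y c.f3 := by
    rcases c0 with e | e | e | e
    · rw [e.2, value_some]; linarith
    · rw [e.2, value_some]; linarith
    · rw [e.2, value_some]
    · rw [e, value_none]; linarith
  rcases e1 with e | e
  · rw [e.2, value_some]
    by_cases hy : yLists
    · rw [(σ.outcome 1).eq_some_iff.2 ((code_eq_one hc).1 (B2 hy)), value_some]
      linarith
    · have hx : ¬ xTrue := fun hx => hy (h.ranks.listed hx)
      have hmem := (hm' 1).mem e.1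
      rw [Function.update_self] at hmem
      -- Winning `f2` in state 1 means listing it in state 0 too, where it gives `f2` a place in the
      -- swapped assignment. So `f3` goes to `x`, and two matches without `f3` are worth less than
      -- one with it.
      have hswap : (σ.setWorker c.y r).outcome 0 c.f3 = some c.x := by
        refine swap_optimal hc (hE.firm 0) (P := fun f => σ.firm f 0)
          (Q := Function.update σ.worker c.y r) (fun f => h.firms f 0) (ht' 0)
          (mt code_eq_zero.2 (h.ranks.v2_ne_zero hx (hd 0))) ?_ ?_ ?_ (Or.inl ?_)
        · rw [Function.update_of_ne hc.xy]
          exact h.ranks.x30.le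
        · rw [Function.update_of_ne hc.xy]
          exact (h.ranks.x32 hx).le
        · rw [Function.update_of_ne hc.yz.symm]
          exact (h.ranks.z10 (Or.inr hy)).le
        · rw [Function.update_self]
          exact (Report.mem_iff_rank_lt.1 hmem).le
      rcases c0 with d | d | d | d
      · rw [d.2, value_some]; linarith
      · rw [d.2, value_some]; linarith
      · rw [hswap] at d
        exact absurd (Option.some.inj d.1) hc.xy
      · rw [d, value_none]; linarith
  · rw [e, value_none]
    linarith

/-- Firm `f3` is out of reach in state 0. The only conceivable gain is `f1` instead of `f2` there.
-/
theorem candidate_z_le (hE : E.IsCore c) (h : E.IsCandidate c σ xTrue yLists)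
    (r : Report A) :
    value ((E.market 0).workerUtil c.z) (((σ.setWorker c.z r).outcome 0).symm c.z) +
        value ((E.market 0).workerUtil c.z) (((σ.setWorker c.z r).outcome 1).symm c.z) ≤
      value ((E.market 0).workerUtil c.z) ((σ.outcome 0).symm c.z) +
        value ((E.market 0).workerUtil c.z) ((σ.outcome 1).symm c.z) := by
  have hc := hE.proper
  have hv := hE.worker
  have hm := fun s => hE.firmStable h.firms s
  have hm' := fun s => hE.setWorker_firmStable h.firms c.z r s
  have ht' := fun s => hE.candidate_dev_tops h hc.b_z r s
  have hd := fun s => hE.candidate_dev_stable h hc.b_z r s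
  simp only [Function.update_self, Function.update_of_ne hc.xz,
    Function.update_of_ne hc.yz] at hd
  have d3 := h.ranks.dev_z_zero (hd 0)
  obtain ⟨-, A1, A2⟩ := hE.candidate_codes_zero h (hm 0)
  obtain ⟨-, B3, -⟩ := hE.candidate_codes_one h (hm 1)
  have p1 := hv.z1; have p2 := hv.z12; have p3 := hv.pos c.z c.f3
  have p4 := hv.pos c.z c.f1; have p5 := hv.pos c.z c.f2
  rw [(σ.outcome 1).eq_some_iff.2 ((code_eq_two hc).1 B3), value_some]
  have c0 : ((σ.setWorker c.z r).outcome 0 c.f1 = some c.z ∧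
      ((σ.setWorker c.z r).outcome 0).symm c.z = some c.f1) ∨
      value ((E.market 0).workerUtil c.z) (((σ.setWorker c.z r).outcome 0).symm c.z) ≤
        (E.market 0).workerUtil c.z c.f2 := by
    rcases (inCore_of_tops hc (ht' 0) hc.b_z).cases with e | e | e | e
    · exact Or.inl e
    · exact Or.inr (by rw [e.2, value_some])
    · exact absurd ((code_eq_two hc).2 e.1) d3
    · exact Or.inr (by rw [e, value_none]; exact p5.le)
  have c1 : ((σ.setWorker c.z r).outcome 1 c.f3 = some c.z ∧
      ((σ.setWorker c.z r).outcome 1).symm c.z = some c.f3) ∨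
      value ((E.market 0).workerUtil c.z) (((σ.setWorker c.z r).outcome 1).symm c.z) ≤
        (E.market 0).workerUtil c.z c.f1 := by
    rcases (inCore_of_tops hc (ht' 1) hc.b_z).cases with e | e | e | e
    · exact Or.inr (by rw [e.2, value_some])
    · exact Or.inr (by rw [e.2, value_some]; exact p2.le)
    · exact Or.inl e
    · exact Or.inr (by rw [e, value_none]; exact p4.le)
  have u1 : value ((E.market 0).workerUtil c.z) (((σ.setWorker c.z r).outcome 1).symm c.z) ≤
      (E.market 0).workerUtil c.z c.f3 := by
    rcases c1 with e | e
    · rw [e.2, value_some]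
    · linarith
  by_cases hx : xTrue
  · rw [(σ.outcome 0).eq_some_iff.2 ((code_eq_two hc).1 (A1 hx).1), value_some]
    rcases c0 with e | e
    · rw [e.2, value_some]; linarith
    · linarith
  · rw [(σ.outcome 0).eq_some_iff.2 ((code_eq_two hc).1 (A2 hx).2), value_some]
    rcases c0 with e | e
    · rcases c1 with d | d
      · exfalso
        have hmem := (hm' 0).mem e.1
        rw [Function.update_self] at hmem
        have hr := Report.mem_iff_rank_lt.1 hmem
        have n0 := h.ranks.v2_ne_zero hx (hd 0)
        have n1 := h.ranks.v2_ne_zero hx (hd 1)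
        -- A report that wins `f1` in state 0 lists it in state 1 as well, and ranks it at least as
        -- high as `f2` when `y` does not list `f2`. The swap then gives `f3` to `x`, so `z` cannot
        -- have kept `f3`.
        have hswap : (σ.setWorker c.z r).outcome 1 c.f3 = some c.x := by
          refine swap_optimal hc (hE.firm 1) (P := fun f => σ.firm f 1)
            (Q := Function.update σ.worker c.z r) (fun f => h.firms f 1) (ht' 1)
            (mt code_eq_zero.2 n1) ?_ ?_ ?_ ?_
          · rw [Function.update_of_ne hc.xz]
            exact h.ranks.x30.le
          · rw [Function.update_of_ne hc.xz]
            exact (h.ranks.x32 hx).le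
          · rw [Function.update_self]
            exact hr.le
          · rw [Function.update_of_ne hc.yz, Function.update_self]
            by_cases hy : yLists
            · exact Or.inl (h.ranks.y20 hy).le
            · refine Or.inr ⟨?_, ?_⟩
              · rcases core_match_cases hc (ht' 1) hc.a_f2 with q | q | q | q
                · exact q
                · exact absurd (code_eq_zero.2 q) n1
                · have q1 := (hd 1).y2 ((code_eq_one hc).2 q)
                  have q2 := (hd 1).iry
                  have q3 := h.ranks.y02 hy
                  omega
                · have q1 := (hd 1).d23
                  have q2 : (c.pattern (Function.update σ.worker c.z r)
                    ((σ.setWorker c.z r).outcome 1)).v2 = 2 := (code_eq_two hc).2 q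
                  have q3 : (c.pattern (Function.update σ.worker c.z r)
                    ((σ.setWorker c.z r).outcome 1)).v3 = 2 := (code_eq_two hc).2 d.1
                  omega
              · have q1 := (hd 0).z1 ((code_eq_two hc).2 e.1)
                have q2 := (hd 0).b2z.resolve_left n0
                have q3 := (hd 0).y2
                have q4 := (hd 0).iry
                have q5 := h.ranks.y02 hy
                simp only [or_false] at q2
                change (c.ranks r).r1 ≤ (c.ranks r).r2
                omega
        rw [hswap] at d
        exact hc.xz (Option.some.inj d.1)
      · rw [e.2, value_some]; linarith
    · linarith

/-- Candidates are equilibria. -/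
theorem candidate_isTruthfulBNE (hE : E.IsCore c) (h : E.IsCandidate c σ xTrue yLists) :
    E.IsTruthfulBNE σ := by
  refine ⟨⟨h.firm_le, fun w r => ?_⟩, h.firms⟩
  rw [hE.workerPayoff_eq, hE.workerPayoff_eq]
  refine div_le_div_of_nonneg_right ?_ zero_le_two
  rcases hE.proper.worker_cases w with ⟨i, rfl⟩ | rfl | rfl | rfl
  · exact add_le_add (hE.candidate_top_le h i r 0) (hE.candidate_top_le h i r 1)
  · exact add_le_add (hE.candidate_x_le h r 0) (hE.candidate_x_le h r 1)
  · exact hE.candidate_y_le h r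
  · exact hE.candidate_z_le h r

end Economy.IsCore

end

section

variable {A B : Type*} [Fintype A] [DecidableEq A] [Fintype B] [DecidableEq B]

/-! ### Existence of candidates -/

theorem Report.IsTruthful.rank_lt {u : A → ℝ} {r : Report A} (h : r.IsTruthful u)
    (hu : Function.Injective u) {a b : A} (ha : 0 < u a) (hab : u b < u a) :
    r.rank (some a) < r.rank (some b) :=
  (h.prefers_some_iff hu ha).2 hab

theorem Report.IsTruthful.rank_lt_none {u : A → ℝ} {r : Report A} (h : r.IsTruthful u) {a : A}
    (ha : 0 < u a) : r.rank (some a) < r.rank none :=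
  Report.mem_iff_rank_lt.1 (h.mem.2 ha)

theorem Report.IsTruthful.rank_none_lt {u : A → ℝ} {r : Report A} (h : r.IsTruthful u) {a : A}
    (ha : u a < 0) : r.rank none < r.rank (some a) := by
  have h1 : a ∉ r.1 := fun hc => lt_asymm ha (h.mem.1 hc)
  rw [Report.rank_of_notMem h1, Report.rank_none]
  exact Nat.lt_succ_self _

theorem injective_update_neg {u : A → ℝ} (hu : Function.Injective u) (hpos : ∀ a, 0 < u a)
    (b : A) : Function.Injective (Function.update u b (-1)) := by
  intro a a' h
  by_cases h1 : a = b <;> by_cases h2 : a' = b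
  · rw [h1, h2]
  · subst h1
    rw [Function.update_self, Function.update_of_ne h2] at h
    linarith [hpos a']
  · subst h2
    rw [Function.update_self, Function.update_of_ne h1] at h
    linarith [hpos a]
  · rw [Function.update_of_ne h1, Function.update_of_ne h2] at h
    exact hu h

namespace CoreAgents

variable {c : CoreAgents A B} {v : B → A → ℝ}

theorem exists_report_x (hc : c.Proper) (hv : c.WorkerUtil v) (xTrue : Prop) :
    ∃ r : Report A, (∃ t, r.1.head? = some t ∧ ∀ g, g ≠ t → v c.x g < v c.x t) ∧
      (c.ranks r).r1 < (c.ranks r).r2 ∧ (c.ranks r).r1 < (c.ranks r).r3 ∧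
      (c.ranks r).r2 < (c.ranks r).r0 ∧ (c.ranks r).r3 < (c.ranks r).r0 ∧
      (xTrue → (c.ranks r).r2 < (c.ranks r).r3) ∧ (¬ xTrue → (c.ranks r).r3 < (c.ranks r).r2) ∧
      (xTrue → r.IsTruthful (v c.x)) := by
  have p1 := hv.x12; have p2 := hv.x23; have hp := hv.pos c.x
  obtain ⟨t, -, ht⟩ := Finset.exists_max_image Finset.univ (v c.x) ⟨c.f1, Finset.mem_univ _⟩
  have ht' : ∀ g, g ≠ t → v c.x g < v c.x t := fun g hg =>
    lt_of_le_of_ne (ht g (Finset.mem_univ _)) fun e => hg (hv.inj _ e)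
  by_cases hx : xTrue
  · obtain ⟨r, hr⟩ := exists_truthful_report (v c.x) (hv.inj _)
    exact ⟨r, ⟨t, hr.head_eq (hp t) ht', ht'⟩, hr.rank_lt (hv.inj _) (hp _) p1,
      hr.rank_lt (hv.inj _) (hp _) (p2.trans p1), hr.rank_lt_none (hp _),
      hr.rank_lt_none (hp _), fun _ => hr.rank_lt (hv.inj _) (hp _) p2,
      fun h => absurd hx h, fun _ => hr⟩
  -- The report is truthful for utilities with `f2` and `f3` exchanged. The favourite is neither of
  -- them, as `f1` is better than both, so it stays in first place; it need not be a core firm.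
  · let e := Equiv.swap c.f2 c.f3
    have he1 : e c.f1 = c.f1 := Equiv.swap_apply_of_ne_of_ne hc.f12 hc.f13
    have he2 : e c.f2 = c.f3 := Equiv.swap_apply_left _ _
    have he3 : e c.f3 = c.f2 := Equiv.swap_apply_right _ _
    have hi : Function.Injective (fun f => v c.x (e f)) := (hv.inj _).comp e.injective
    obtain ⟨r, hr⟩ := exists_truthful_report _ hi
    have het : e t = t := by
      refine Equiv.swap_apply_of_ne_of_ne ?_ ?_
      · rintro rfl
        exact absurd (ht c.f1 (Finset.mem_univ _)) (not_le.2 p1)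
      · rintro rfl
        exact absurd (ht c.f1 (Finset.mem_univ _)) (not_le.2 (p2.trans p1))
    refine ⟨r, ⟨t, hr.head_eq (hp _) fun b hb => ?_, ht'⟩, ?_, ?_, hr.rank_lt_none (hp _),
      hr.rank_lt_none (hp _), fun h => absurd h hx, fun _ => ?_, fun h => absurd h hx⟩
    · simp only [het]
      refine ht' _ fun hbt => hb (e.injective ?_)
      rw [hbt, het]
    all_goals
      refine hr.rank_lt hi (hp _) ?_
      simp only [he1, he2, he3]
      linarith

theorem exists_report_y (hv : c.WorkerUtil v) (hc : c.Proper) (yLists : Prop) :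
    ∃ r : Report A, r.1.head? = some c.f3 ∧
      (c.ranks r).r3 < (c.ranks r).r1 ∧ (c.ranks r).r3 < (c.ranks r).r2 ∧
      (c.ranks r).r1 < (c.ranks r).r0 ∧ (yLists → (c.ranks r).r2 < (c.ranks r).r0) ∧
      (¬ yLists → (c.ranks r).r0 < (c.ranks r).r2) ∧
      (yLists → r.IsTruthful (v c.y)) := by
  have p := hv.y_max; have hp := hv.pos c.y
  by_cases hy : yLists
  · obtain ⟨r, hr⟩ := exists_truthful_report (v c.y) (hv.inj _)
    exact ⟨r, hr.head_eq (hp _) p, hr.rank_lt (hv.inj _) (hp _) (p _ hc.f13),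
      hr.rank_lt (hv.inj _) (hp _) (p _ hc.f23), hr.rank_lt_none (hp _),
      fun _ => hr.rank_lt_none (hp _), fun h => absurd hy h, fun _ => hr⟩
  · have hi := injective_update_neg (hv.inj c.y) hp c.f2
    -- Negative utility drops `f2` from the truthful list and leaves the rest of the order
    -- unchanged.
    set u := Function.update (v c.y) c.f2 (-1) with hu
    have u2 : u c.f2 = -1 := Function.update_self ..
    have ne : ∀ f, f ≠ c.f2 → u f = v c.y f := fun f hf => Function.update_of_ne hf ..
    have u3 := ne _ hc.f23.symm
    have u1 := ne _ hc.f12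
    have q3 := hp c.f3; have q1 := hp c.f1
    obtain ⟨r, hr⟩ := exists_truthful_report u hi
    refine ⟨r, hr.head_eq (by rw [u3]; exact q3) fun b hb => ?_,
      hr.rank_lt hi (by rw [u3]; exact q3) (by rw [u3, u1]; exact p _ hc.f13),
      hr.rank_lt hi (by rw [u3]; exact q3) (by rw [u3, u2]; linarith),
      hr.rank_lt_none (by rw [u1]; exact q1), fun h => absurd h hy,
      fun _ => hr.rank_none_lt (by rw [u2]; norm_num), fun h => absurd h hy⟩
    by_cases hb2 : b = c.f2
    · rw [hb2, u2, u3]; linarith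
    · rw [ne _ hb2, u3]; exact p _ hb

theorem exists_report_z (hv : c.WorkerUtil v) (hc : c.Proper) (xTrue yLists : Prop) :
    ∃ r : Report A, r.1.head? = some c.f3 ∧
      (c.ranks r).r3 < (c.ranks r).r1 ∧ (c.ranks r).r3 < (c.ranks r).r2 ∧
      (c.ranks r).r2 < (c.ranks r).r0 ∧ (xTrue → (c.ranks r).r1 < (c.ranks r).r2) ∧
      (¬ xTrue → (c.ranks r).r2 < (c.ranks r).r1) ∧
      (xTrue ∨ ¬ yLists → (c.ranks r).r1 < (c.ranks r).r0) ∧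
      (¬ xTrue → yLists → (c.ranks r).r0 < (c.ranks r).r1) ∧
      (xTrue → r.IsTruthful (v c.z)) := by
  have p := hv.z_max; have hp := hv.pos c.z; have p12 := hv.z12
  have q1 := hp c.f1; have q2 := hp c.f2; have q3 := hp c.f3
  by_cases hx : xTrue
  · obtain ⟨r, hr⟩ := exists_truthful_report (v c.z) (hv.inj _)
    exact ⟨r, hr.head_eq (hp _) p, hr.rank_lt (hv.inj _) (hp _) (p _ hc.f13),
      hr.rank_lt (hv.inj _) (hp _) (p _ hc.f23), hr.rank_lt_none (hp _),
      fun _ => hr.rank_lt (hv.inj _) (hp _) p12, fun h => absurd hx h,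
      fun _ => hr.rank_lt_none (hp _), fun h => absurd hx h, fun _ => hr⟩
  · by_cases hy : yLists
    · have hi := injective_update_neg (hv.inj c.z) hp c.f1
      set u := Function.update (v c.z) c.f1 (-1) with hu
      have u1 : u c.f1 = -1 := Function.update_self ..
      have ne : ∀ f, f ≠ c.f1 → u f = v c.z f := fun f hf => Function.update_of_ne hf ..
      have u3 := ne _ hc.f13.symm
      have u2 := ne _ hc.f12.symm
      obtain ⟨r, hr⟩ := exists_truthful_report u hi
      refine ⟨r, hr.head_eq (by rw [u3]; exact q3) fun b hb => ?_,
        hr.rank_lt hi (by rw [u3]; exact q3) (by rw [u3, u1]; linarith),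
        hr.rank_lt hi (by rw [u3]; exact q3) (by rw [u3, u2]; exact p _ hc.f23),
        hr.rank_lt_none (by rw [u2]; exact q2), fun h => absurd h hx,
        fun _ => hr.rank_lt hi (by rw [u2]; exact q2) (by rw [u1, u2]; linarith),
        fun h => absurd h (by tauto),
        fun _ _ => hr.rank_none_lt (by rw [u1]; norm_num), fun h => absurd h hx⟩
      by_cases hb1 : b = c.f1
      · rw [hb1, u1, u3]; linarith
      · rw [ne _ hb1, u3]; exact p _ hb
    · let e := Equiv.swap c.f1 c.f2
      have he1 : e c.f1 = c.f2 := Equiv.swap_apply_left _ _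
      have he2 : e c.f2 = c.f1 := Equiv.swap_apply_right _ _
      have he3 : e c.f3 = c.f3 := Equiv.swap_apply_of_ne_of_ne hc.f13.symm hc.f23.symm
      have hi : Function.Injective (fun f => v c.z (e f)) := (hv.inj _).comp e.injective
      obtain ⟨r, hr⟩ := exists_truthful_report _ hi
      refine ⟨r, hr.head_eq (hp _) fun b hb => ?_,
        hr.rank_lt hi (hp _) (by simp only [he1, he3]; exact p _ hc.f23),
        hr.rank_lt hi (hp _) (by simp only [he2, he3]; exact p _ hc.f13),
        hr.rank_lt_none (hp _), fun h => absurd h hx,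
        fun _ => hr.rank_lt hi (hp _) (by simp only [he1, he2]; exact p12),
        fun _ => hr.rank_lt_none (hp _), fun _ h => absurd h hy, fun h => absurd h hx⟩
      simp only [he3]
      refine p _ fun h => hb (e.injective ?_)
      rw [h, he3]

end CoreAgents

namespace Economy.IsCore

open CoreAgents

variable {E : Economy (Fin 2) A B} {c : CoreAgents A B}

theorem exists_candidate (hE : E.IsCore c) (xTrue yLists : Prop) (h : xTrue → yLists) :
    ∃ σ, E.IsCandidate c σ xTrue yLists ∧
      (xTrue → ∀ w, (σ.worker w).IsTruthful ((E.market 0).workerUtil w)) := by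
  have hc := hE.proper
  have hv := hE.worker
  obtain ⟨rx, hhx, x12, x13, x20, x30, x23, x32, tx⟩ := exists_report_x hc hv xTrue
  obtain ⟨ry, hhy, y31, y32, y10, y20, y02, ty⟩ := exists_report_y hv hc yLists
  obtain ⟨rz, hhz, z31, z32, z20, z12, z21, z10, z01, tz⟩ := exists_report_z hv hc xTrue yLists
  choose P hP using fun f θ =>
    exists_truthful_report ((E.market θ).firmUtil f) ((E.market θ).firm_strict f)
  choose Q hQ using fun w => exists_truthful_report ((E.market 0).workerUtil w) (hv.inj w)
  let q : B → Report A := fun w =>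
    if w = c.x then rx else if w = c.y then ry else if w = c.z then rz else Q w
  have qx : q c.x = rx := by simp [q]
  have qy : q c.y = ry := by simp [q, hc.xy.symm]
  have qz : q c.z = rz := by simp [q, hc.xz.symm, hc.yz.symm]
  have qb : ∀ i, q (c.b i) = Q (c.b i) := fun i => by simp [q, hc.b_x, hc.b_y, hc.b_z]
  refine ⟨⟨P, q⟩, ⟨hP, fun i => ?_, fun w => ?_, ?_⟩, fun hx w => ?_⟩
  · simp only [qb]
    exact hQ _
  · rcases hc.worker_cases w with ⟨i, rfl⟩ | rfl | rfl | rfl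
    · simp only [qb]
      obtain ⟨t, -, ht⟩ := Finset.exists_max_image Finset.univ
        ((E.market 0).workerUtil (c.b i)) ⟨c.f1, Finset.mem_univ _⟩
      have ht' : ∀ g, g ≠ t → (E.market 0).workerUtil (c.b i) g <
          (E.market 0).workerUtil (c.b i) t := fun g hg =>
        lt_of_le_of_ne (ht g (Finset.mem_univ _)) fun e => hg (hv.inj _ e)
      exact ⟨t, (hQ _).head_eq (hv.pos _ _) ht', ht'⟩
    · simp only [qx]
      exact hhx
    · simp only [qy]
      exact ⟨_, hhy, hv.y_max⟩
    · simp only [qz]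
      exact ⟨_, hhz, hv.z_max⟩
  · simp only [qx, qy, qz]
    exact ⟨x12, x13, x20, x30, x23, x32, y31, y32, y10, y20, y02, z31, z32, z20, z12, z21, z10,
      z01, h⟩
  · rcases hc.worker_cases w with ⟨i, rfl⟩ | rfl | rfl | rfl
    · simp only [qb]
      exact hQ _
    · simp only [qx]
      exact tx hx
    · simp only [qy]
      exact ty (h hx)
    · simp only [qz]
      exact tz hx

/-- The candidate with both parameters true reports truthfully throughout, so stability for its
reports is true stability. -/
theorem existsUnique_stable (hE : E.IsCore c) (s : Fin 2) :
    ∃! μ, (E.market s).IsStable μ := by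
  obtain ⟨σ, h, ht⟩ := hE.exists_candidate True True id
  have := hE.candidate_uniqueStable h s
  unfold Profile.UniqueReportedStable at this
  have hP : (fun f => (σ.firm f s).Prefers) = fun f a b =>
      value ((E.market s).firmUtil f) b < value ((E.market s).firmUtil f) a := by
    funext f a b
    exact propext ((h.firms f s).prefers_iff ((E.market s).firm_strict f)
      ((E.market s).firm_acceptable f))
  have hQ : (fun w => (σ.worker w).Prefers) = fun w a b =>
      value ((E.market s).workerUtil w) b < value ((E.market s).workerUtil w) a := by
    funext w a b
    rw [E.workerUtil_eq s 0]
    exact propext ((ht trivial w).prefers_iff ((E.market 0).worker_strict w)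
      ((E.market 0).worker_acceptable w))
  rw [hP, hQ] at this
  exact this

/-- The candidate with both parameters false: `f1` and `z` block in state 0, `f2` and `y`, both
unmatched, in state 1. -/
theorem exists_unstable (hE : E.IsCore c) :
    ∃ σ, E.IsTruthfulBNE σ ∧ ∀ θ, ¬ (E.market θ).IsStable (σ.outcome θ) := by
  have hc := hE.proper
  obtain ⟨σ, h, -⟩ := hE.exists_candidate False False id
  have hm := fun s => hE.firmStable h.firms s
  have ht := fun s => hE.candidate_tops h (hm s)
  obtain ⟨-, -, hA⟩ := hE.candidate_codes_zero h (hm 0)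
  obtain ⟨B1, B3, -, hB⟩ := hE.candidate_codes_one h (hm 1)
  obtain ⟨A1, A2⟩ := hA not_false
  have B2 := hB not_false
  refine ⟨σ, hE.candidate_isTruthfulBNE h, fun θ hst => ?_⟩
  fin_cases θ
  · refine hst.2.2 c.f1 c.z ⟨?_, ?_⟩
    · simp only [Fin.zero_eta]
      rw [code_eq_zero.1 A1]
      exact (hE.firm 0).f1_xz
    · simp only [Fin.zero_eta]
      rw [(σ.outcome 0).eq_some_iff.2 ((code_eq_two hc).1 A2)]
      exact hE.worker.z12
  · refine hst.2.2 c.f2 c.y ⟨?_, ?_⟩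
    · simp only [Fin.mk_one]
      rcases core_match_cases hc (ht 1) hc.a_f2 with e | e | e | e
      · rw [e]
        exact (hE.firm 1).pos _ _
      all_goals
        rw [e] at B2
        simp [code_x, code_y hc, code_z hc] at B2
    · simp only [Fin.mk_one]
      rw [symm_eq_none_of_core hc (ht 1) hc.b_y]
      · exact (E.market 1).worker_acceptable _ _
      all_goals
        intro e
        have := (code_eq_one hc).2 e
        omega

/-- The three possible outcomes are those of the candidates with parameters (true, true), (false,
true) and (false, false). -/
theorem exists_same_outcome (hE : E.IsCore c) {σ : Profile (Fin 2) A B}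
    (hσ : E.IsTruthfulBNE σ) :
    ∃ σ', E.IsTruthfulBNE σ' ∧ (∀ θ, σ'.outcome θ = σ.outcome θ) ∧
      E.WeaklyUndominated σ' ∧ ∀ θ, σ'.UniqueReportedStable θ := by
  have hc := hE.proper
  have key : ∃ (xT yL : Prop), (xT → yL) ∧
      (c.code (σ.outcome 0 c.f3) = 1 ∧
        (xT → c.code (σ.outcome 0 c.f1) = 2 ∧ c.code (σ.outcome 0 c.f2) = 0) ∧
        (¬ xT → c.code (σ.outcome 0 c.f1) = 0 ∧ c.code (σ.outcome 0 c.f2) = 2)) ∧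
      (c.code (σ.outcome 1 c.f1) = 0 ∧ c.code (σ.outcome 1 c.f3) = 2 ∧
        (yL → c.code (σ.outcome 1 c.f2) = 1) ∧ (¬ yL → c.code (σ.outcome 1 c.f2) = 3)) := by
    obtain ⟨⟨B1, B3⟩, ⟨A1, A2, A3, B2⟩ | ⟨A1, A2, A3, B2 | B2⟩⟩ := hE.outcomeCodes hσ
    · exact ⟨True, True, by tauto⟩
    · exact ⟨False, True, by tauto⟩
    · exact ⟨False, False, by tauto⟩
  obtain ⟨xT, yL, hxy, hA, hB⟩ := key
  obtain ⟨σ', h, -⟩ := hE.exists_candidate xT yL hxy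
  have hm := fun s => hE.firmStable h.firms s
  have ht := fun s => hE.candidate_tops h (hm s)
  refine ⟨σ', hE.candidate_isTruthfulBNE h, fun θ => ?_, hE.candidate_undominated h,
    hE.candidate_uniqueStable h⟩
  have hA' := hE.candidate_codes_zero h (hm 0)
  have hB' := hE.candidate_codes_one h (hm 1)
  refine eq_of_codes hc (ht θ) (fun j => hE.tops hσ j θ) ?_ ?_ ?_
  all_goals
    fin_cases θ
    · by_cases hx : xT <;> simp_all
    · by_cases hx : yL <;> simp_all

/-- Passing from the truthful candidate to the one with both parameters false, `y` loses `f2` in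
state 1 and `x` improves from `f2` to `f1` in state 0. -/
theorem exists_disagreement (hE : E.IsCore c) :
    ∃ σ₁ σ₂, E.IsTruthfulBNE σ₁ ∧ E.IsTruthfulBNE σ₂ ∧
      (∃ θ, σ₁.matchedWorkers θ ≠ σ₂.matchedWorkers θ) ∧
      (∃ w, E.workerPayoff σ₂ w < E.workerPayoff σ₁ w) ∧
      (∃ w, E.workerPayoff σ₁ w < E.workerPayoff σ₂ w) := by
  have hc := hE.proper
  have hv := hE.worker
  obtain ⟨σ, h, -⟩ := hE.exists_candidate True True id
  obtain ⟨τ, k, -⟩ := hE.exists_candidate False False id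
  have hm := fun s => hE.firmStable h.firms s
  have km := fun s => hE.firmStable k.firms s
  have kt := fun s => hE.candidate_tops k (km s)
  obtain ⟨A3, hA, -⟩ := hE.candidate_codes_zero h (hm 0)
  obtain ⟨B1, B3, hB, -⟩ := hE.candidate_codes_one h (hm 1)
  obtain ⟨A1, A2⟩ := hA trivial
  have B2 := hB trivial
  obtain ⟨A3', -, hA'⟩ := hE.candidate_codes_zero k (km 0)
  obtain ⟨B1', B3', -, hB'⟩ := hE.candidate_codes_one k (km 1)
  obtain ⟨A1', A2'⟩ := hA' not_false
  have B2' := hB' not_false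
  have y1 : (τ.outcome 1).symm c.y = none := by
    refine symm_eq_none_of_core hc (kt 1) hc.b_y ?_ ?_ ?_
    all_goals
      intro e
      have := (code_eq_one hc).2 e
      omega
  have sy1 := (σ.outcome 1).eq_some_iff.2 ((code_eq_one hc).1 B2)
  have sy0 := (σ.outcome 0).eq_some_iff.2 ((code_eq_one hc).1 A3)
  have ty0 := (τ.outcome 0).eq_some_iff.2 ((code_eq_one hc).1 A3')
  have sx0 := (σ.outcome 0).eq_some_iff.2 (code_eq_zero.1 A2)
  have sx1 := (σ.outcome 1).eq_some_iff.2 (code_eq_zero.1 B1)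
  have tx0 := (τ.outcome 0).eq_some_iff.2 (code_eq_zero.1 A1')
  have tx1 := (τ.outcome 1).eq_some_iff.2 (code_eq_zero.1 B1')
  refine ⟨σ, τ, hE.candidate_isTruthfulBNE h, hE.candidate_isTruthfulBNE k, ⟨1, fun e => ?_⟩,
    ⟨c.y, ?_⟩, ⟨c.x, ?_⟩⟩
  · have : c.y ∈ σ.matchedWorkers 1 := by
      unfold Profile.matchedWorkers
      simp [sy1]
    rw [e] at this
    exact this y1
  · rw [hE.workerPayoff_eq, hE.workerPayoff_eq, sy0, sy1, ty0, y1, value_some, value_some,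
      value_none]
    linarith [hv.pos c.y c.f2]
  · rw [hE.workerPayoff_eq, hE.workerPayoff_eq, sx0, sx1, tx0, tx1, value_some, value_some]
    linarith [hv.x12]

end Economy.IsCore

end

/-! ### Construction of the augmented economy -/

/-- A market consisting of top pairs `(a i, b i)`, matched one after the other, and of two further
firms and workers of which `p1` and `q1` are a top pair. -/
structure Market.TopPairs {F W : Type*} (M : Market F W) where
  k : ℕ
  a : Fin k → F
  b : Fin k → W
  p1 : F
  p2 : F
  q1 : W
  q2 : W
  firm_cases : ∀ f, (∃ i, f = a i) ∨ f = p1 ∨ f = p2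
  worker_cases : ∀ w, (∃ i, w = b i) ∨ w = q1 ∨ w = q2
  a_inj : Function.Injective a
  b_inj : Function.Injective b
  a_p1 : ∀ i, a i ≠ p1
  a_p2 : ∀ i, a i ≠ p2
  b_q1 : ∀ i, b i ≠ q1
  b_q2 : ∀ i, b i ≠ q2
  p12 : p1 ≠ p2
  q12 : q1 ≠ q2
  firm_top : ∀ i w, w ≠ b i → (∀ j < i, w ≠ b j) → M.firmUtil (a i) w < M.firmUtil (a i) (b i)
  worker_top : ∀ i f, f ≠ a i → (∀ j < i, f ≠ a j) →
    M.workerUtil (b i) f < M.workerUtil (b i) (a i)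
  p1_top : M.firmUtil p1 q2 < M.firmUtil p1 q1
  q1_top : M.workerUtil q1 p2 < M.workerUtil q1 p1

theorem equiv_cases {S : Type*} {k : ℕ} (e : Fin (k + 2) ≃ S) (f : S) :
    (∃ i, f = e (Fin.castAdd 2 i)) ∨ f = e (Fin.natAdd k 0) ∨ f = e (Fin.natAdd k 1) := by
  obtain ⟨i, rfl⟩ := e.surjective f
  refine Fin.addCases (fun j => Or.inl ⟨j, rfl⟩) (fun j => Or.inr ?_) i
  fin_cases j
  · exact Or.inl rfl
  · exact Or.inr rfl

theorem castAdd_le_symm {S : Type*} {k : ℕ} (e : Fin (k + 2) ≃ S) (i : Fin k) (f : S)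
    (hf : ∀ j < i, f ≠ e (Fin.castAdd 2 j)) : Fin.castAdd 2 i ≤ e.symm f := by
  by_contra hlt
  have hlt := Fin.lt_def.1 (not_le.1 hlt)
  simp only [Fin.val_castAdd] at hlt
  refine hf ⟨e.symm f, hlt.trans i.2⟩ hlt ?_
  rw [← e.symm_apply_eq]
  rfl

theorem Market.exists_topPairs_of_equiv {F W : Type*} (M : Market F W) {k : ℕ}
    (ef : Fin (k + 2) ≃ F) (ew : Fin (k + 2) ≃ W)
    (h : ∀ i, M.IsTopTop {f | i ≤ ef.symm f} {w | i ≤ ew.symm w} (ef i) (ew i)) :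
    Nonempty M.TopPairs := by
  have hne : ∀ (i : Fin k) (j : Fin 2), Fin.castAdd 2 i ≠ Fin.natAdd k j := fun i j he => by
    have := congrArg Fin.val he
    simp at this
    omega
  have hne01 : (Fin.natAdd k 0 : Fin (k + 2)) ≠ Fin.natAdd k 1 := fun he => by
    have := congrArg Fin.val he
    simp at this
  exact ⟨{
    k := k
    a := fun i => ef (Fin.castAdd 2 i)
    b := fun i => ew (Fin.castAdd 2 i)
    p1 := ef (Fin.natAdd k 0)
    p2 := ef (Fin.natAdd k 1)
    q1 := ew (Fin.natAdd k 0)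
    q2 := ew (Fin.natAdd k 1)
    firm_cases := equiv_cases ef
    worker_cases := equiv_cases ew
    a_inj := ef.injective.comp (Fin.castAdd_injective k 2)
    b_inj := ew.injective.comp (Fin.castAdd_injective k 2)
    a_p1 := fun i => ef.injective.ne (hne i 0)
    a_p2 := fun i => ef.injective.ne (hne i 1)
    b_q1 := fun i => ew.injective.ne (hne i 0)
    b_q2 := fun i => ew.injective.ne (hne i 1)
    p12 := ef.injective.ne hne01
    q12 := ew.injective.ne hne01
    firm_top := fun i w hw hj => lt_of_le_of_ne ((h (Fin.castAdd 2 i)).2.2.1 w (castAdd_le_symm ew i w hj))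
      fun he => hw (M.firm_strict _ he)
    worker_top := fun i f hf hj => lt_of_le_of_ne ((h (Fin.castAdd 2 i)).2.2.2 f (castAdd_le_symm ef i f hj))
      fun he => hf (M.worker_strict _ he)
    p1_top := lt_of_le_of_ne ((h _).2.2.1 _ (by simp))
      fun he => hne01.symm (ew.injective (M.firm_strict _ he))
    q1_top := lt_of_le_of_ne ((h _).2.2.2 _ (by simp))
      fun he => hne01.symm (ef.injective (M.worker_strict _ he)) }⟩

theorem Market.SPC.exists_topPairs {F W : Type*} [Fintype F] [Fintype W] {M : Market F W}
    (h : M.SPC) (hbalanced : Fintype.card F = Fintype.card W) (htwo : 2 ≤ Fintype.card F) :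
    Nonempty M.TopPairs := by
  obtain ⟨ef, ew, h⟩ := h
  obtain ⟨k, hk⟩ := Nat.exists_eq_add_of_le' htwo
  exact M.exists_topPairs_of_equiv ((finCongr hk.symm).trans ef)
    ((finCongr (hk.symm.trans hbalanced)).trans ew) fun i =>
      h (finCongr hk.symm i) (finCongr (hk.symm.trans hbalanced) i) rfl

/-! ### Utility values in prescribed position relative to finitely many others -/

section Utilities

variable {S : Type*} [Fintype S]

theorem exists_low (u : S → ℝ) (hu : ∀ a, 0 < u a) : ∃ t, 0 < t ∧ ∀ a, t < u a := by
  classical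
  obtain ⟨t, h1, h2⟩ := Order.exists_between_finsets (lo := {0}) (hi := Finset.univ.image u)
    (by simpa using hu)
  exact ⟨t, by simpa using h1, by simpa using h2⟩

theorem exists_high (u : S → ℝ) : ∃ t, 0 < t ∧ ∀ a, 2 * u a < t := by
  classical
  obtain ⟨t, h1, -⟩ := Order.exists_between_finsets
    (lo := insert 0 (Finset.univ.image fun a => 2 * u a)) (hi := ∅) (by simp)
  exact ⟨t, by simpa using h1⟩

theorem exists_just_above (u : S → ℝ) (a : S) :
    ∃ t, u a < t ∧ ∀ b, u a < u b → t < u b := by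
  classical
  obtain ⟨t, h1, h2⟩ := Order.exists_between_finsets (lo := {u a})
    (hi := (Finset.univ.filter fun b => u a < u b).image u) (by simp)
  exact ⟨t, by simpa using h1, by simpa using h2⟩

theorem exists_just_below (u : S → ℝ) (hu : ∀ a, 0 < u a) (a : S) :
    ∃ t, 0 < t ∧ t < u a ∧ ∀ b, u b < u a → u b < t := by
  classical
  obtain ⟨t, h1, h2⟩ := Order.exists_between_finsets
    (lo := insert 0 ((Finset.univ.filter fun b => u b < u a).image u)) (hi := {u a})
    (by simpa using hu a)
  simp only [Finset.mem_insert, Finset.mem_image, Finset.mem_filter, Finset.mem_univ, true_and,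
    forall_eq_or_imp, Finset.mem_singleton, forall_eq] at h1 h2
  exact ⟨t, h1.1, h2, fun b hb => h1.2 _ ⟨b, hb, rfl⟩⟩

/-- Utilities with prescribed first, second and third choice. -/
theorem exists_utility_three [DecidableEq S] {p q r : S} (hpq : p ≠ q) (hpr : p ≠ r)
    (hqr : q ≠ r) : ∃ u : S → ℝ, Function.Injective u ∧ (∀ a, 0 < u a) ∧
      (∀ a, a ≠ p → a ≠ q → a ≠ r → u a < u r) ∧ u r < u q ∧ 2 * u q < u p := by
  let e := Fintype.equivFin S
  let N := Fintype.card S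
  -- Generic values lie in 1 to N, leaving N + 1 and N + 2 for the third and second choice; 2N + 5
  -- exceeds twice N + 2.
  let g : S → ℕ := fun a => if a = p then 2 * N + 5 else if a = q then N + 2 else
    if a = r then N + 1 else e a + 1
  have gp : g p = 2 * N + 5 := by simp [g]
  have gq : g q = N + 2 := by simp [g, hpq.symm]
  have gr : g r = N + 1 := by simp [g, hpr.symm, hqr.symm]
  have ga : ∀ a, a ≠ p → a ≠ q → a ≠ r → g a = e a + 1 := by
    intro a h1 h2 h3
    simp [g, h1, h2, h3]
  have hlt : ∀ a, (e a : ℕ) < N := fun a => (e a).2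
  have hcases : ∀ a, a = p ∨ a = q ∨ a = r ∨ g a = e a + 1 := by
    intro a
    by_cases h1 : a = p; · exact Or.inl h1
    by_cases h2 : a = q; · exact Or.inr (Or.inl h2)
    by_cases h3 : a = r; · exact Or.inr (Or.inr (Or.inl h3))
    exact Or.inr (Or.inr (Or.inr (ga a h1 h2 h3)))
  refine ⟨fun a => (g a : ℝ), ?_, ?_, ?_, ?_, ?_⟩
  · intro a b hab
    have hab : g a = g b := Nat.cast_injective (R := ℝ) hab
    have h1 := hlt a; have h2 := hlt b
    rcases hcases a with rfl | rfl | rfl | ha <;> rcases hcases b with rfl | rfl | rfl | hb <;>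
      first | rfl | (exfalso; omega) | skip
    refine e.injective (Fin.ext ?_)
    omega
  · intro a
    have : 0 < g a := by
      rcases hcases a with rfl | rfl | rfl | ha <;> omega
    exact Nat.cast_pos.2 this
  · intro a h1 h2 h3
    have := hlt a
    rw [Nat.cast_lt, gr, ga a h1 h2 h3]
    omega
  · rw [Nat.cast_lt]
    omega
  · have : 2 * g q < g p := by omega
    simp only
    exact_mod_cast this

end Utilities

/-! ### Markets extended by one firm and one worker -/

section Extension

variable {F W : Type*} {M : Market F W}

/-- The data of an augmented economy: the old firms' utilities `τ` for the new worker, the old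
workers' utilities `t` for the new firm, the new firm's utilities `ρ` in each state and the new
worker's utilities `ν`. -/
structure Market.Extension (M : Market F W) where
  τ : F → ℝ
  t : W → ℝ
  ρ : Fin 2 → W ⊕ Unit → ℝ
  ν : F ⊕ Unit → ℝ
  τ_pos : ∀ f, 0 < τ f
  τ_ne : ∀ f w, M.firmUtil f w ≠ τ f
  t_pos : ∀ w, 0 < t w
  t_ne : ∀ w f, M.workerUtil w f ≠ t w
  ρ_pos : ∀ s w, 0 < ρ s w
  ρ_inj : ∀ s, Function.Injective (ρ s)
  ν_pos : ∀ f, 0 < ν f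
  ν_inj : Function.Injective ν

namespace Market.Extension

/-- The firms' utilities of the augmented economy. -/
def firmUtil (X : M.Extension) (s : Fin 2) : F ⊕ Unit → W ⊕ Unit → ℝ :=
  Sum.elim (fun f => Sum.elim (M.firmUtil f) fun _ => X.τ f) fun _ => X.ρ s

/-- The workers' utilities of the augmented economy. -/
def workerUtil (X : M.Extension) : W ⊕ Unit → F ⊕ Unit → ℝ :=
  Sum.elim (fun w => Sum.elim (M.workerUtil w) fun _ => X.t w) fun _ => X.ν

/-- The market of the augmented economy in state `s`. -/
def market (X : M.Extension) (s : Fin 2) : Market (F ⊕ Unit) (W ⊕ Unit) where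
  firmUtil := X.firmUtil s
  workerUtil := X.workerUtil
  firm_strict := by
    rintro (f | f)
    · exact (M.firm_strict f).sumElim (Function.injective_of_subsingleton _) fun w _ => X.τ_ne f w
    · exact X.ρ_inj s
  worker_strict := by
    rintro (w | w)
    · exact (M.worker_strict w).sumElim (Function.injective_of_subsingleton _) fun f _ => X.t_ne w f
    · exact X.ν_inj
  firm_acceptable := by
    rintro (f | f) (w | w)
    exacts [M.firm_acceptable f w, X.τ_pos f, X.ρ_pos s _, X.ρ_pos s _]
  worker_acceptable := by
    rintro (w | w) (f | f)
    exacts [M.worker_acceptable w f, X.t_pos w, X.ν_pos _, X.ν_pos _]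

/-- The augmented economy, with both states equally likely. -/
noncomputable def economy (X : M.Extension) : Economy (Fin 2) (F ⊕ Unit) (W ⊕ Unit) where
  market := X.market
  workerUtil_eq _ _ := rfl
  prior _ := 1 / 2
  prior_pos _ := by norm_num
  prior_sum := by norm_num

end Market.Extension

end Extension

/-! ### Choosing the extension -/

section Construction

variable {F W : Type*} [Fintype F] [DecidableEq F] [Fintype W] [DecidableEq W] {M : Market F W}

namespace Market.TopPairs

/-- The core of an augmented economy, given the roles `x` and `z`. -/
def core (T : M.TopPairs) (x z : W ⊕ Unit) : CoreAgents (F ⊕ Unit) (W ⊕ Unit) where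
  k := T.k
  a i := Sum.inl (T.a i)
  b i := Sum.inl (T.b i)
  f1 := Sum.inl T.p1
  f2 := Sum.inl T.p2
  f3 := Sum.inr ()
  x := x
  y := Sum.inl T.q2
  z := z

theorem core_proper (T : M.TopPairs) {x z : W ⊕ Unit}
    (h : x = Sum.inl T.q1 ∧ z = Sum.inr () ∨ x = Sum.inr () ∧ z = Sum.inl T.q1) :
    (T.core x z).Proper where
  firm_cases := by
    rintro (f | f)
    · rcases T.firm_cases f with ⟨i, rfl⟩ | rfl | rfl
      · exact Or.inl ⟨i, rfl⟩
      · exact Or.inr (Or.inl rfl)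
      · exact Or.inr (Or.inr (Or.inl rfl))
    · exact Or.inr (Or.inr (Or.inr rfl))
  worker_cases := by
    rintro (w | w)
    · rcases T.worker_cases w with ⟨i, rfl⟩ | rfl | rfl
      · exact Or.inl ⟨i, rfl⟩
      · rcases h with ⟨rfl, rfl⟩ | ⟨rfl, rfl⟩ <;> simp [core]
      · exact Or.inr (Or.inr (Or.inl rfl))
    · rcases h with ⟨rfl, rfl⟩ | ⟨rfl, rfl⟩ <;> simp [core]
  a_inj := Sum.inl_injective.comp T.a_inj
  b_inj := Sum.inl_injective.comp T.b_inj
  a_f1 i := Sum.inl_injective.ne (T.a_p1 i)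
  a_f2 i := Sum.inl_injective.ne (T.a_p2 i)
  a_f3 _ := Sum.inl_ne_inr
  b_x i := by
    rcases h with ⟨rfl, rfl⟩ | ⟨rfl, rfl⟩
    exacts [Sum.inl_injective.ne (T.b_q1 i), Sum.inl_ne_inr]
  b_y i := Sum.inl_injective.ne (T.b_q2 i)
  b_z i := by
    rcases h with ⟨rfl, rfl⟩ | ⟨rfl, rfl⟩
    exacts [Sum.inl_ne_inr, Sum.inl_injective.ne (T.b_q1 i)]
  f12 := Sum.inl_injective.ne T.p12
  f13 := Sum.inl_ne_inr
  f23 := Sum.inl_ne_inr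
  xy := by rcases h with ⟨rfl, rfl⟩ | ⟨rfl, rfl⟩ <;> simp [core, T.q12]
  xz := by rcases h with ⟨rfl, rfl⟩ | ⟨rfl, rfl⟩ <;> simp [core]
  yz := by rcases h with ⟨rfl, rfl⟩ | ⟨rfl, rfl⟩ <;> simp [core, T.q12.symm]

theorem exists_newFirmUtil {x y z : W ⊕ Unit} (hxy : x ≠ y) (hxz : x ≠ z) (hyz : y ≠ z) :
    ∃ ρ : Fin 2 → W ⊕ Unit → ℝ, (∀ s w, 0 < ρ s w) ∧ (∀ s, Function.Injective (ρ s)) ∧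
      ∀ s, (∀ w, w ≠ x → w ≠ y → w ≠ z → ρ s w < ρ s x ∧ ρ s w < ρ s y ∧ ρ s w < ρ s z) ∧
        ρ s y < ρ s x ∧ ρ s z < ρ s x ∧ (s = 0 → ρ s z < ρ s y) ∧ (s = 1 → ρ s y < ρ s z) := by
  obtain ⟨u, hu, hpos, h1, h2, h3⟩ := exists_utility_three hxy hxz hyz
  obtain ⟨v, hv, vpos, k1, k2, k3⟩ := exists_utility_three hxz hxy hyz.symm
  have p1 := hpos y; have p2 := vpos z
  refine ⟨![u, v], ?_, ?_, ?_⟩ <;> refine Fin.forall_fin_two.2 ⟨?_, ?_⟩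
  · exact hpos
  · exact vpos
  · exact hu
  · exact hv
  · refine ⟨fun w a b c => ?_, ?_, ?_, fun _ => h2, fun h => absurd h (by decide)⟩
    · have := h1 w a b c
      exact ⟨by simp; linarith, by simp; linarith, by simpa using this⟩
    · simp; linarith
    · simp; linarith
  · refine ⟨fun w a b c => ?_, ?_, ?_, fun h => absurd h (by decide), fun _ => k2⟩
    · have := k1 w a c b
      exact ⟨by simp; linarith, by simpa using this, by simp; linarith⟩
    · simp; linarith
    · simp; linarith

/-- Both last firms prefer `q1` to `q2`, so `q1` plays `x` and the new worker plays `z`: just above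
`q1` for `p1`, so that no old worker comes between, and at the bottom for all other old firms. The
new firm is far above the rest for `q2` and last for the other old workers. -/
theorem exists_isCore_of_lt (T : M.TopPairs)
    (h2 : M.firmUtil T.p2 T.q2 < M.firmUtil T.p2 T.q1) :
    ∃ (X : M.Extension) (c : CoreAgents (F ⊕ Unit) (W ⊕ Unit)), X.economy.IsCore c := by
  have hc := T.core_proper (Or.inl ⟨rfl, rfl⟩)
  have hτ : ∀ f, ∃ t, 0 < t ∧ (∀ w, M.firmUtil f w ≠ t) ∧
      (f ≠ T.p1 → ∀ w, t < M.firmUtil f w) ∧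
      (f = T.p1 → M.firmUtil f T.q1 < t ∧
        ∀ w, M.firmUtil f T.q1 < M.firmUtil f w → t < M.firmUtil f w) := by
    intro f
    by_cases hf : f = T.p1
    · obtain ⟨t, h1, h2⟩ := exists_just_above (M.firmUtil f) T.q1
      refine ⟨t, (M.firm_acceptable _ _).trans h1, ?_, fun h => absurd hf h, fun _ => ⟨h1, h2⟩⟩
      rintro w rfl
      exact lt_irrefl _ (h2 w h1)
    · obtain ⟨t, h0, h1⟩ := exists_low (M.firmUtil f) (M.firm_acceptable f)
      exact ⟨t, h0, fun w => (h1 w).ne', fun _ => h1, fun h => absurd h hf⟩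
  have ht : ∀ w, ∃ t, 0 < t ∧ (∀ f, M.workerUtil w f ≠ t) ∧
      (w ≠ T.q2 → ∀ f, t < M.workerUtil w f) ∧ (w = T.q2 → ∀ f, 2 * M.workerUtil w f < t) := by
    intro w
    by_cases hw : w = T.q2
    · obtain ⟨t, h0, ht⟩ := exists_high (M.workerUtil w)
      exact ⟨t, h0, fun f => by linarith [ht f, M.worker_acceptable w f], fun h => absurd hw h,
        fun _ => ht⟩
    · obtain ⟨t, h0, h1⟩ := exists_low (M.workerUtil w) (M.worker_acceptable w)
      exact ⟨t, h0, fun w => (h1 w).ne', fun _ => h1, fun h => absurd h hw⟩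
  choose τ τ_pos τ_ne τ_low τ_1 using hτ
  choose t t_pos t_ne t_low t_high using ht
  obtain ⟨ρ, ρ_pos, ρ_inj, hρ⟩ := exists_newFirmUtil hc.xy hc.xz hc.yz
  obtain ⟨ν, ν_inj, ν_pos, ν1, ν2, ν3⟩ := exists_utility_three hc.f13.symm hc.f23.symm hc.f12
  have n1 := ν_pos (T.core (Sum.inl T.q1) (Sum.inr ())).f1
  have hb := fun s i => (hρ s).1 (Sum.inl (T.b i)) (hc.b_x i) (hc.b_y i) (hc.b_z i)
  refine ⟨⟨τ, t, ρ, ν, τ_pos, τ_ne, t_pos, t_ne, ρ_pos, ρ_inj, ν_pos, ν_inj⟩, _, hc,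
    fun _ => rfl, fun s => ?_, ?_⟩
  · exact {
      pos := (Market.Extension.market _ s).firm_acceptable
      inj := (Market.Extension.market _ s).firm_strict
      top := by
        rintro i (w | w) hw hj
        · exact T.firm_top i w (fun h => hw (congrArg Sum.inl h))
            fun j hlt h => hj j hlt (congrArg Sum.inl h)
        · exact τ_low _ (T.a_p1 i) _
      f1_xz := (τ_1 _ rfl).1
      f1_yx := T.p1_top
      f1_adj := fun i h => (τ_1 _ rfl).2 _ h
      f2_yx := h2
      f2_zy := τ_low _ T.p12.symm _
      f3_x := fun i => (hb s i).1
      f3_y := fun i => (hb s i).2.1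
      f3_z := fun i => (hb s i).2.2
      f3_yx := (hρ s).2.1
      f3_zx := (hρ s).2.2.1
      f3_zy := (hρ s).2.2.2.1
      f3_yz := (hρ s).2.2.2.2 }
  · exact {
      pos := (Market.Extension.market _ 0).worker_acceptable
      inj := (Market.Extension.market _ 0).worker_strict
      top := by
        rintro i (f | f) hf hj
        · exact T.worker_top i f (fun h => hf (congrArg Sum.inl h))
            fun j hlt h => hj j hlt (congrArg Sum.inl h)
        · exact t_low _ (T.b_q2 i) _
      x12 := T.q1_top
      x23 := t_low _ T.q12 _
      y_max := by
        rintro (f | f) hf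
        · have h1 : 2 * M.workerUtil T.q2 f < t T.q2 := t_high _ rfl f
          have h2 := M.worker_acceptable T.q2 f
          change M.workerUtil T.q2 f < t T.q2
          linarith
        · exact absurd rfl hf
      y1 := t_high _ rfl _
      y2 := t_high _ rfl _
      z_max := by
        intro f hf
        change ν f < ν (Sum.inr ())
        change 2 * ν _ < ν (Sum.inr ()) at ν3
        by_cases hf1 : f = Sum.inl T.p1
        · subst hf1
          change 0 < ν (Sum.inl T.p1) at n1
          change 2 * ν (Sum.inl T.p1) < _ at ν3
          linarith
        · by_cases hf2 : f = Sum.inl T.p2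
          · subst hf2
            change ν (Sum.inl T.p2) < _ at ν2
            linarith
          · have := ν1 f hf hf1 hf2
            linarith
      z12 := ν2
      z1 := ν3 }

/-- Here `p2` ranks `q2` above `q1`, matching the order of `y` and `z` for `f2`, so `q1` plays `z`
and the new worker plays `x`: just below `q1` for `p1`, on top for `p2`, and at the bottom for the
other old firms. Both `q1` and `q2` put the new firm far above the rest. -/
theorem exists_isCore_of_gt (T : M.TopPairs)
    (h2 : M.firmUtil T.p2 T.q1 < M.firmUtil T.p2 T.q2) :
    ∃ (X : M.Extension) (c : CoreAgents (F ⊕ Unit) (W ⊕ Unit)), X.economy.IsCore c := by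
  have hc := T.core_proper (Or.inr ⟨rfl, rfl⟩)
  have hτ : ∀ f, ∃ t, 0 < t ∧ (∀ w, M.firmUtil f w ≠ t) ∧
      (f ≠ T.p1 → f ≠ T.p2 → ∀ w, t < M.firmUtil f w) ∧
      (f = T.p1 → t < M.firmUtil f T.q1 ∧
        ∀ w, M.firmUtil f w < M.firmUtil f T.q1 → M.firmUtil f w < t) ∧
      (f = T.p2 → ∀ w, M.firmUtil f w < t) := by
    intro f
    by_cases hf : f = T.p1
    · obtain ⟨t, h0, h1, h2⟩ := exists_just_below (M.firmUtil f) (M.firm_acceptable f) T.q1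
      refine ⟨t, h0, ?_, fun h => absurd hf h, fun _ => ⟨h1, h2⟩,
        fun h => absurd (hf.symm.trans h) T.p12⟩
      rintro w rfl
      exact lt_irrefl _ (h2 w h1)
    · by_cases hf' : f = T.p2
      · obtain ⟨t, h0, h1⟩ := exists_high (M.firmUtil f)
        have h1 : ∀ w, M.firmUtil f w < t := fun w => by
          linarith [h1 w, M.firm_acceptable f w]
        exact ⟨t, h0, fun w => (h1 w).ne, fun _ h => absurd hf' h, fun h => absurd h hf,
          fun _ => h1⟩
      · obtain ⟨t, h0, h1⟩ := exists_low (M.firmUtil f) (M.firm_acceptable f)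
        exact ⟨t, h0, fun w => (h1 w).ne', fun _ _ => h1, fun h => absurd h hf,
          fun h => absurd h hf'⟩
  have ht : ∀ w, ∃ t, 0 < t ∧ (∀ f, M.workerUtil w f ≠ t) ∧
      (w ≠ T.q1 → w ≠ T.q2 → ∀ f, t < M.workerUtil w f) ∧
      (w = T.q1 ∨ w = T.q2 → ∀ f, 2 * M.workerUtil w f < t) := by
    intro w
    by_cases hw : w = T.q1 ∨ w = T.q2
    · obtain ⟨t, h0, ht⟩ := exists_high (M.workerUtil w)
      exact ⟨t, h0, fun f => by linarith [ht f, M.worker_acceptable w f],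
        fun h h' => absurd hw (not_or.2 ⟨h, h'⟩), fun _ => ht⟩
    · obtain ⟨t, h0, h1⟩ := exists_low (M.workerUtil w) (M.worker_acceptable w)
      exact ⟨t, h0, fun w => (h1 w).ne', fun _ _ => h1, fun h => absurd h hw⟩
  choose τ τ_pos τ_ne τ_low τ_1 τ_2 using hτ
  choose t t_pos t_ne t_low t_high using ht
  obtain ⟨ρ, ρ_pos, ρ_inj, hρ⟩ := exists_newFirmUtil hc.xy hc.xz hc.yz
  obtain ⟨ν, ν_inj, ν_pos, ν1, ν2, ν3⟩ := exists_utility_three hc.f12 hc.f13 hc.f23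
  have n2 := ν_pos (T.core (Sum.inr ()) (Sum.inl T.q1)).f2
  have hb := fun s i => (hρ s).1 (Sum.inl (T.b i)) (hc.b_x i) (hc.b_y i) (hc.b_z i)
  have hmax : ∀ w, w = T.q1 ∨ w = T.q2 → ∀ f, M.workerUtil w f < t w := fun w hw f => by
    linarith [t_high w hw f, M.worker_acceptable w f]
  refine ⟨⟨τ, t, ρ, ν, τ_pos, τ_ne, t_pos, t_ne, ρ_pos, ρ_inj, ν_pos, ν_inj⟩, _, hc,
    fun _ => rfl, fun s => ?_, ?_⟩
  · exact {
      pos := (Market.Extension.market _ s).firm_acceptable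
      inj := (Market.Extension.market _ s).firm_strict
      top := by
        rintro i (w | w) hw hj
        · exact T.firm_top i w (fun h => hw (congrArg Sum.inl h))
            fun j hlt h => hj j hlt (congrArg Sum.inl h)
        · exact τ_low _ (T.a_p1 i) (T.a_p2 i) _
      f1_xz := (τ_1 _ rfl).1
      f1_yx := (τ_1 _ rfl).2 _ T.p1_top
      f1_adj := fun i h => by
        by_contra hle
        change τ T.p1 < M.firmUtil T.p1 (T.b i) at h
        change ¬ M.firmUtil T.p1 T.q1 < M.firmUtil T.p1 (T.b i) at hle
        have h1 : M.firmUtil T.p1 (T.b i) < M.firmUtil T.p1 T.q1 :=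
          lt_of_le_of_ne (not_lt.1 hle) fun he => T.b_q1 i (M.firm_strict _ he)
        exact lt_asymm h ((τ_1 _ rfl).2 _ h1)
      f2_yx := τ_2 _ rfl _
      f2_zy := h2
      f3_x := fun i => (hb s i).1
      f3_y := fun i => (hb s i).2.1
      f3_z := fun i => (hb s i).2.2
      f3_yx := (hρ s).2.1
      f3_zx := (hρ s).2.2.1
      f3_zy := (hρ s).2.2.2.1
      f3_yz := (hρ s).2.2.2.2 }
  · exact {
      pos := (Market.Extension.market _ 0).worker_acceptable
      inj := (Market.Extension.market _ 0).worker_strict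
      top := by
        rintro i (f | f) hf hj
        · exact T.worker_top i f (fun h => hf (congrArg Sum.inl h))
            fun j hlt h => hj j hlt (congrArg Sum.inl h)
        · exact t_low _ (T.b_q1 i) (T.b_q2 i) _
      x12 := by
        change ν (Sum.inl T.p2) < ν (Sum.inl T.p1)
        change 0 < ν (Sum.inl T.p2) at n2
        change 2 * ν (Sum.inl T.p2) < ν (Sum.inl T.p1) at ν3
        linarith
      x23 := ν2
      y_max := by
        rintro (f | f) hf
        · exact hmax _ (Or.inr rfl) f
        · exact absurd rfl hf
      y1 := t_high _ (Or.inr rfl) _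
      y2 := t_high _ (Or.inr rfl) _
      z_max := by
        rintro (f | f) hf
        · exact hmax _ (Or.inl rfl) f
        · exact absurd rfl hf
      z12 := T.q1_top
      z1 := t_high _ (Or.inl rfl) _ }

/-- Every market made of top pairs has an augmented economy with a core. -/
theorem exists_isCore (T : M.TopPairs) :
    ∃ (X : M.Extension) (c : CoreAgents (F ⊕ Unit) (W ⊕ Unit)), X.economy.IsCore c := by
  rcases lt_or_gt_of_ne ((M.firm_strict T.p2).ne T.q12) with h | h
  · exact T.exists_isCore_of_gt h
  · exact T.exists_isCore_of_lt h

end Market.TopPairs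

end Construction

end Matching

theorem proposition3 {F W : Type*} [Fintype F] [DecidableEq F] [Fintype W] [DecidableEq W]
    (M : Matching.Market F W) (hbalanced : Fintype.card F = Fintype.card W)
    (htwo : 2 ≤ Fintype.card F) (hSPC : M.SPC) :
    ∃ E : Matching.Economy (Fin 2) (F ⊕ Unit) (W ⊕ Unit),
      E.IsAugmentationOf M ∧
      -- some equilibrium has unstable outcomes in both states
      (∃ σ, E.IsTruthfulBNE σ ∧ ∀ θ, ¬ (E.market θ).IsStable (σ.outcome θ)) ∧
      -- every equilibrium outcome is supported by an equilibrium in weakly undominated strategies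
      -- whose reports have a unique stable matching in each state
      (∀ σ, E.IsTruthfulBNE σ →
        ∃ σ', E.IsTruthfulBNE σ' ∧ (∀ θ, σ'.outcome θ = σ.outcome θ) ∧
          E.WeaklyUndominated σ' ∧ ∀ θ, σ'.UniqueReportedStable θ) ∧
      -- the set of matched workers varies, and workers disagree on the preferred equilibrium
      (∃ σ₁ σ₂, E.IsTruthfulBNE σ₁ ∧ E.IsTruthfulBNE σ₂ ∧
        (∃ θ, σ₁.matchedWorkers θ ≠ σ₂.matchedWorkers θ) ∧
        (∃ w, E.workerPayoff σ₂ w < E.workerPayoff σ₁ w) ∧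
        (∃ w, E.workerPayoff σ₁ w < E.workerPayoff σ₂ w)) := by
  obtain ⟨T⟩ := hSPC.exists_topPairs hbalanced htwo
  obtain ⟨X, c, hE⟩ := T.exists_isCore
  exact ⟨X.economy, fun θ => ⟨fun _ _ => rfl, fun _ _ => rfl, hE.existsUnique_stable θ⟩,
    hE.exists_unstable, fun σ hσ => hE.exists_same_outcome hσ, hE.exists_disagreement⟩
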